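/- Consider the cubic nonlinear Schrödinger equation $$-i\,\partial_t q=-\partial_x^2 q\pm 2|q|^2q\qquad\text{(NLS)}$$ for complex-valued $q(t,x)$, and the modified Korteweg–de Vries equation $$\partial_t q=-\partial_x^3 q\pm 6q^2\,\partial_x q\qquad\text{(mKdV)}$$ for real-valued $q(t,x)$, each with either choice of sign and posed either on the line $\mathbb R$ or on the circle $\mathbb R/\mathbb Z$. By a Schwartz solution we mean a global-in-time solution $q$ for which $t\mapsto q(t)$ is a continuous curve, defined for $t\in\mathbb R$, in the Schwartz space $\mathcal S(\mathbb R)$ (on the line) or in $C^\infty(\mathbb R/\mathbb Z)$ (on the circle), and which satisfies the equation at every point $(t,x)$. For $s\in\mathbb R$ put $$\|f\|_{H^s(\mathbb R)}^2=\int_{\mathbb R}(1+\xi^2)^s|\hat f(\xi)|^2\,d\xi,\qquad \hat f(\xi)=\tfrac1{\sqrt{2\pi}}\int_{\mathbb R}e^{-i\xi x}f(x)\,dx,$$ $$\|f\|_{H^s(\mathbb R/\mathbb Z)}^2=\sum_{\xi\in2\pi\mathbb Z}(1+\xi^2)^s|\hat f(\xi)|^2,\qquad \hat f(\xi)=\int_0^1e^{-i\xi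 x}f(x)\,dx.$$ **Theorem.** Fix $-\tfrac12<s<0$. There is a constant $C>0$, depending only on $s$, such that every Schwartz solution $q$ of (NLS) or (mKdV), with either sign and on either $\mathbb R$ or $\mathbb R/\mathbb Z$, satisfies $$\|q(t)\|_{H^s}\le C\,\|q(0)\|_{H^s}\bigl(1+\|q(0)\|_{H^s}^2\bigr)^{\frac{|s|}{1-2|s|}}\qquad\text{for all }t\in\mathbb R,$$ where $H^s$ denotes $H^s(\mathbb R)$ or $H^s(\mathbb R/\mathbb Z)$, respectively. -/

import Mathlib

open scoped SchwartzMap ContDiff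

noncomputable section

namespace AKNS

/-- The Fourier transform on the line, normalised as
`(2π)^(-1/2) ∫ e^{-iξx} f(x) dx`. -/
def fourierLine (f : ℝ → ℂ) (ξ : ℝ) : ℂ :=
  ((1 / Real.sqrt (2 * Real.pi) : ℝ) : ℂ) *
    ∫ x : ℝ, Complex.exp (-Complex.I * (ξ : ℂ) * (x : ℂ)) * f x

/-- The `H^s(ℝ)` norm: the square root of `∫ (1 + ξ²)^s |f̂(ξ)|² dξ`. -/
def sobolevLine (s : ℝ) (f : ℝ → ℂ) : ℝ :=
  Real.sqrt (∫ ξ : ℝ, (1 + ξ ^ 2) ^ s * ‖fourierLine f ξ‖ ^ 2)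

/-- The Fourier coefficient `∫₀¹ e^{-iξx} f(x) dx` of a `1`-periodic function on the line
(that is, of a function on `ℝ/ℤ`); it is used at the frequencies `ξ ∈ 2πℤ`. -/
def fourierCircle (f : ℝ → ℂ) (ξ : ℝ) : ℂ :=
  ∫ x in (0 : ℝ)..1, Complex.exp (-Complex.I * (ξ : ℂ) * (x : ℂ)) * f x

/-- The `H^s(ℝ/ℤ)` norm: the square root of `∑ (1 + ξ²)^s |f̂(ξ)|²` over `ξ ∈ 2πℤ`. -/
def sobolevCircle (s : ℝ) (f : ℝ → ℂ) : ℝ :=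
  Real.sqrt (∑' n : ℤ, (1 + (2 * Real.pi * (n : ℝ)) ^ 2) ^ s *
    ‖fourierCircle f (2 * Real.pi * (n : ℝ))‖ ^ 2)

/-- Complex-valued `q` solves `-i ∂ₜq = -q'' + 2σ|q|²q` at every point of space-time, the equation
being solved for `∂ₜq`. The equation with `±` is the one with `σ = ±1`. -/
def SolvesNLS (σ : ℝ) (q : ℝ → ℝ → ℂ) : Prop :=
  ∀ t x : ℝ, HasDerivAt (fun τ => q τ x)
    (Complex.I * (-iteratedDeriv 2 (q t) x + 2 * (σ : ℂ) * ((‖q t x‖ ^ 2 : ℝ) : ℂ) * q t x)) t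

/-- Real-valued `q` solves `∂ₜq = -q''' + 6σq²q'` at every point of space-time.
The equation with `±` is the one with `σ = ±1`. -/
def SolvesMKdV (σ : ℝ) (q : ℝ → ℝ → ℝ) : Prop :=
  ∀ t x : ℝ, HasDerivAt (fun τ => q τ x)
    (-iteratedDeriv 3 (q t) x + 6 * σ * q t x ^ 2 * deriv (q t) x) t

/-- `q` is a continuous curve, parametrised by time, in the space `C^∞(ℝ/ℤ)` with its usual
Fréchet topology. Functions on `ℝ/ℤ` are written as `1`-periodic functions on the line; since the
circle is compact, continuity in `C^∞(ℝ/ℤ)` is joint continuity of each spatial derivative. -/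
structure IsSmoothCircleCurve {E : Type*} [NormedAddCommGroup E] [NormedSpace ℝ E]
    (q : ℝ → ℝ → E) : Prop where
  periodic : ∀ t, Function.Periodic (q t) 1
  smooth : ∀ t, ContDiff ℝ ∞ (q t)
  continuous : ∀ n : ℕ, Continuous fun p : ℝ × ℝ => iteratedDeriv n (q p.1) p.2

/-- A (global) Schwartz solution of cubic NLS on the line: a continuous curve in the Schwartz space
that solves the equation. (The equation then makes the curve continuously differentiable in the
Schwartz space.) -/
structure IsSchwartzNLSLine (σ : ℝ) (q : ℝ → 𝓢(ℝ, ℂ)) : Prop where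
  continuous : Continuous q
  solves : SolvesNLS σ fun t x => q t x

/-- A (global) Schwartz solution of mKdV on the line. -/
structure IsSchwartzMKdVLine (σ : ℝ) (q : ℝ → 𝓢(ℝ, ℝ)) : Prop where
  continuous : Continuous q
  solves : SolvesMKdV σ fun t x => q t x

/-- A (global) Schwartz solution of cubic NLS on the circle `ℝ/ℤ`. -/
structure IsSchwartzNLSCircle (σ : ℝ) (q : ℝ → ℝ → ℂ) : Prop where
  curve : IsSmoothCircleCurve q
  solves : SolvesNLS σ q

/-- A (global) Schwartz solution of mKdV on the circle `ℝ/ℤ`. -/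
structure IsSchwartzMKdVCircle (σ : ℝ) (q : ℝ → ℝ → ℝ) : Prop where
  curve : IsSmoothCircleCurve q
  solves : SolvesMKdV σ q

/-- The a priori bound: the norm `b` at time `t` is at most
`C a (1 + a²)^{|s|/(1-2|s|)}`, with `a` the norm at time zero. -/
def GrowthBound (C s a b : ℝ) : Prop :=
  b ≤ C * (a * (1 + a ^ 2) ^ (|s| / (1 - 2 * |s|)))

end AKNS

end

/-! Fix `lam > 0` and write `p = σ q̄`. The small bounded solution `W` of the Riccati equation `W' =
-lam W + q - p W²` is the ratio of the two components of a solution of the AKNS linear system with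
spectral parameter `lam`. Both NLS and mKdV are zero-curvature conditions for that system, so the
time flow of the system, with matrix `((a, b), (c, -a))`, yields `W_t = b + 2aW - cW²` and `(pW)_t =
(cW - a)_x`. Hence `∫ p W` is conserved. The quadratic part of `σ ∫ p W` is `∫ q̄ (∂ + lam)⁻¹ q`,
whose real part is the integral of `lam / (lam² + ξ²)` against `|q̂|²`; the rest is quartic in `q`.

Everything is measured at the frequency scale `lam`, with weights `(lam² + ξ²)^s` for `q` and `(lam²
+ ξ²)^(1+s)` for `W`. Then `(∂ + lam)⁻¹` is an isometry from regularity `s` to regularity `1 + s`.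
For `s > -1/2` regularity `1 + s` is an algebra that also acts on regularity `s`, and each such
product has norm at most a constant times the square root of `lam^(-1-2s)`. So, when `lam^(-1-2s)
‖q‖²` is small, `W` comes from a contraction and the quartic error is controlled
(`IsFourierCurve.re_pair_le`).

Multiplying by `lam^(2s)` and integrating over `lam > lam₀` turns the quadratic part into a quantity
comparable with the squared norm of weight `(lam₀² + ξ²)^s`, while the error becomes `lam₀^(-1-2s)`
times fourth powers of that norm (`IsFourierCurve.superposed_le`). With `lam₀` a large multiple of
`(1 + ‖q(0)‖²)^(1/(1+2s))` the error is absorbed and a continuity argument bounds the norm at scale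
`lam₀` for all time. Returning to scale `1` multiplies the squared norm by at most `lam₀^(-2s)`,
which produces the exponent `|s|/(1-2|s|)` (`exists_apriori_bound`).

Line and circle are treated together: the frequencies form an additive group `G` with an invariant
measure and a homomorphism to `ℝ`. The two cases differ only in Parseval's identity, in the
vanishing of the integral of a derivative, and in the size of `∫ (lam² + ξ²)^(-1-s)`. -/

noncomputable section

open MeasureTheory Filter Topology Set Asymptotics

namespace AKNS

/-! ### Quadratic fixed-point equations in a Banach space. -/

section Riccati

variable {X : Type*} [NormedAddCommGroup X] [NormedSpace ℂ X]

/-- A small solution of the quadratic equation `W = a - T(W, W)`. -/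
theorem exists_quadratic_fixedPoint [CompleteSpace X] (a : X) (T : X →L[ℂ] X →L[ℂ] X) {K : ℝ}
    (hK : 0 ≤ K) (hT : ∀ u v, ‖T u v‖ ≤ K * ‖u‖ * ‖v‖) (ha : K * ‖a‖ ≤ 1 / 8) :
    ∃ W : X, ‖W‖ ≤ 2 * ‖a‖ ∧ W = a - T W W := by
  let f : X → X := fun W => a - T W W
  -- Since `K ‖a‖ ≤ 1/8`, on the ball of radius `2‖a‖` the quadratic term is at most `4K‖a‖² ≤
  -- ‖a‖/2` and the Lipschitz constant is at most `4K‖a‖ ≤ 1/2`.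
  have hmaps : MapsTo f (Metric.closedBall 0 (2 * ‖a‖)) (Metric.closedBall 0 (2 * ‖a‖)) := by
    intro W hW
    rw [mem_closedBall_zero_iff] at hW ⊢
    have h1 : ‖T W W‖ ≤ K * (2 * ‖a‖) * (2 * ‖a‖) := (hT W W).trans (by gcongr)
    have h2 : ‖f W‖ ≤ ‖a‖ + ‖T W W‖ := norm_sub_le _ _
    linarith [mul_le_mul_of_nonneg_right ha (norm_nonneg a), norm_nonneg a]
  have hlip : ∀ U ∈ Metric.closedBall (0 : X) (2 * ‖a‖), ∀ V ∈ Metric.closedBall (0 : X) (2 * ‖a‖),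
      dist (f U) (f V) ≤ (1 / 2 : ℝ) * dist U V := by
    intro U hU V hV
    rw [mem_closedBall_zero_iff] at hU hV
    have h1 : f U - f V = -(T (U - V) U + T V (U - V)) := by
      simp [f]
    rw [dist_eq_norm, dist_eq_norm, h1, norm_neg]
    have h2 : ‖T (U - V) U‖ ≤ K * ‖U - V‖ * (2 * ‖a‖) := (hT _ _).trans (by gcongr)
    have h3 : ‖T V (U - V)‖ ≤ K * (2 * ‖a‖) * ‖U - V‖ := (hT _ _).trans (by gcongr)
    have h4 := norm_add_le (T (U - V) U) (T V (U - V))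
    nlinarith [norm_nonneg (U - V)]
  have hc : ContractingWith (1 / 2 : NNReal) (hmaps.restrict f _ _) := by
    refine ⟨by norm_num, LipschitzWith.of_dist_le_mul ?_⟩
    rintro ⟨U, hU⟩ ⟨V, hV⟩
    exact (hlip U hU V hV).trans (by simp [Subtype.dist_eq])
  obtain ⟨W, hW, hfix, -⟩ := hc.exists_fixedPoint' (x := 0) Metric.isClosed_closedBall.isComplete
    hmaps (by simp) (edist_ne_top _ _)
  exact ⟨W, by simpa using hW, hfix.symm⟩

/-- Solutions of `W = a - T(W, W)` depend differentiably on a parameter. -/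
theorem hasDerivAt_of_quadratic_fixedPoint {a W P : ℝ → X} (S : X →L[ℂ] X →L[ℂ] X →L[ℂ] X)
    {t₀ : ℝ} {a' Z P' : X} {B K r : ℝ} (hK : 0 ≤ K)
    (hB : 0 ≤ B) (hS : ∀ p u v, ‖S p u v‖ ≤ B * ‖p‖ * ‖u‖ * ‖v‖)
    (hT₀ : ∀ u v, ‖S (P t₀) u v‖ ≤ K * ‖u‖ * ‖v‖) (hKr : K * r ≤ 1 / 4)
    (ha : HasDerivAt a a' t₀) (hT : HasDerivAt P P' t₀)
    (hW : ∀ᶠ t in 𝓝 t₀, W t = a t - S (P t) (W t) (W t)) (hWr : ∀ᶠ t in 𝓝 t₀, ‖W t‖ ≤ r)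
    (hZ : Z = a' - S P' (W t₀) (W t₀) - S (P t₀) Z (W t₀) - S (P t₀) (W t₀) Z) :
    HasDerivAt W Z t₀ := by
  have hr : 0 ≤ r := (norm_nonneg _).trans hWr.self_of_nhds
  have hW₀ := hW.self_of_nhds
  have hWr₀ := hWr.self_of_nhds
  -- The linearisation contains two terms in the unknown. Each costs a factor `1/4`, so together
  -- they are absorbed at the price of a factor `2`, first for continuity and then for the
  -- remainder.
  have half : ∀ u V : X, ‖V‖ ≤ r → ‖S (P t₀) u V‖ ≤ 1 / 4 * ‖u‖ ∧ ‖S (P t₀) V u‖ ≤ 1 / 4 * ‖u‖ := by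
    intro u V hV
    have h0 : K * ‖u‖ * ‖V‖ ≤ 1 / 4 * ‖u‖ := by
      calc K * ‖u‖ * ‖V‖ ≤ K * ‖u‖ * r := by gcongr
        _ = K * r * ‖u‖ := by ring
        _ ≤ _ := by gcongr
    exact ⟨(hT₀ u V).trans h0, (hT₀ V u).trans (by linarith [mul_right_comm K ‖V‖ ‖u‖])⟩
  -- Nothing is assumed about how `W t` is selected among the solutions: subtracting the equations
  -- at `t` and `t₀` shows that smallness alone forces continuity.
  have hcont : Tendsto (fun t => W t - W t₀) (𝓝 t₀) (𝓝 0) := by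
    have hg : Tendsto (fun t => 2 * (‖a t - a t₀‖ + B * ‖P t - P t₀‖ * r * r)) (𝓝 t₀) (𝓝 0) := by
      have h1 : ContinuousAt (fun t => 2 * (‖a t - a t₀‖ + B * ‖P t - P t₀‖ * r * r)) t₀ := by
        have := ha.continuousAt
        have := hT.continuousAt
        fun_prop
      have h2 := h1.tendsto
      simp only [sub_self, norm_zero, mul_zero, zero_mul, add_zero] at h2
      exact h2
    refine squeeze_zero_norm' ?_ hg
    filter_upwards [hW, hWr] with t h1 h2
    have hid : W t - W t₀ = (a t - a t₀) - S (P t - P t₀) (W t) (W t)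
        - S (P t₀) (W t - W t₀) (W t) - S (P t₀) (W t₀) (W t - W t₀) := by
      conv_lhs => rw [h1, hW₀]
      simp; abel
    have e1 : ‖S (P t - P t₀) (W t) (W t)‖ ≤ B * ‖P t - P t₀‖ * r * r :=
      (hS _ _ _).trans (by gcongr)
    have e2 := (half (W t - W t₀) _ h2).1
    have e3 := (half (W t - W t₀) _ hWr₀).2
    have e4 : ‖W t - W t₀‖ ≤ ‖a t - a t₀‖ + ‖S (P t - P t₀) (W t) (W t)‖
        + ‖S (P t₀) (W t - W t₀) (W t)‖ + ‖S (P t₀) (W t₀) (W t - W t₀)‖ := by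
      conv_lhs => rw [hid]
      exact (norm_sub_le _ _).trans (add_le_add_left ((norm_sub_le _ _).trans
        (add_le_add_left (norm_sub_le _ _) _)) _)
    linarith
  have hWc : Tendsto W (𝓝 t₀) (𝓝 (W t₀)) := by
    simpa using hcont.add_const (W t₀)
  rw [hasDerivAt_iff_isLittleO]
  rw [hasDerivAt_iff_isLittleO] at ha hT
  have o1 : (fun t => S (P t - P t₀ - (t - t₀) • P') (W t) (W t)) =o[𝓝 t₀] fun t => t - t₀ := by
    have hO : (fun t => S (P t - P t₀ - (t - t₀) • P') (W t) (W t)) =O[𝓝 t₀]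
        fun t => P t - P t₀ - (t - t₀) • P' := by
      refine IsBigO.of_bound (B * (r * r)) ?_
      filter_upwards [hWr] with t h2
      refine (hS _ _ _).trans ?_
      calc _ ≤ B * ‖P t - P t₀ - (t - t₀) • P'‖ * r * r := by gcongr
        _ = _ := by ring
    exact hO.trans_isLittleO hT
  have o2 : (fun t => (t - t₀) • (S P' (W t) (W t) - S P' (W t₀) (W t₀) + S (P t₀) Z (W t - W t₀)))
      =o[𝓝 t₀] fun t => t - t₀ := by
    have h1 : (fun t => (S P' (W t) (W t) - S P' (W t₀) (W t₀) + S (P t₀) Z (W t - W t₀)))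
        =o[𝓝 t₀] fun _ => (1 : ℝ) := by
      rw [isLittleO_one_iff]
      have h2 : Tendsto (fun t => S P' (W t) (W t)) (𝓝 t₀) (𝓝 (S P' (W t₀) (W t₀))) :=
        ((by fun_prop : Continuous fun w => S P' w w).tendsto _).comp hWc
      have h3 : Tendsto (fun t => S (P t₀) Z (W t - W t₀)) (𝓝 t₀) (𝓝 (S (P t₀) Z 0)) :=
        ((S (P t₀) Z).continuous.tendsto _).comp hcont
      simpa using (h2.sub_const (S P' (W t₀) (W t₀))).add h3
    simpa using (isBigO_refl (fun t : ℝ => t - t₀) (𝓝 t₀)).smul_isLittleO h1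
  have osum := (ha.sub o1).sub o2
  refine (IsBigO.of_bound 2 ?_).trans_isLittleO osum
  filter_upwards [hW, hWr] with t h1 h2
  set e := W t - W t₀ - (t - t₀) • Z with he
  -- The first-order remainder `e` solves the linearised equation with a source that is `o(t - t₀)`.
  have hid : e = (a t - a t₀ - (t - t₀) • a' - S (P t - P t₀ - (t - t₀) • P') (W t) (W t)
      - (t - t₀) • (S P' (W t) (W t) - S P' (W t₀) (W t₀) + S (P t₀) Z (W t - W t₀)))
      - S (P t₀) e (W t) - S (P t₀) (W t₀) e := by
    have : e = (a t - S (P t) (W t) (W t)) - (a t₀ - S (P t₀) (W t₀) (W t₀)) -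
        (t - t₀) • (a' - S P' (W t₀) (W t₀) - S (P t₀) Z (W t₀) - S (P t₀) (W t₀) Z) := by
      rw [← h1, ← hW₀, ← hZ]
    conv_lhs => rw [this]
    rw [he]
    simp only [map_sub, sub_apply, smul_apply, smul_sub,
      smul_add, ContinuousLinearMap.map_smul_of_tower]
    abel
  have e2 := (half e _ h2).1
  have e3 := (half e _ hWr₀).2
  have e4 := norm_sub_le ((a t - a t₀ - (t - t₀) • a' - S (P t - P t₀ - (t - t₀) • P') (W t) (W t)
      - (t - t₀) • (S P' (W t) (W t) - S P' (W t₀) (W t₀) + S (P t₀) Z (W t - W t₀)))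
      - S (P t₀) e (W t)) (S (P t₀) (W t₀) e)
  have e5 := norm_sub_le ((a t - a t₀ - (t - t₀) • a' - S (P t - P t₀ - (t - t₀) • P') (W t) (W t)
      - (t - t₀) • (S P' (W t) (W t) - S P' (W t₀) (W t₀) + S (P t₀) Z (W t - W t₀)))) (S (P t₀) e (W t))
  rw [← hid] at e4
  linarith

/-- A bounded solution of `d' = -lam d` on the whole line vanishes. -/
theorem eq_zero_of_hasDerivAt_neg_mul {lam : ℝ} (hlam : 0 < lam) {d : ℝ → ℂ} {C : ℝ}
    (hC : ∀ x, ‖d x‖ ≤ C) (hd : ∀ x, HasDerivAt d (-(lam : ℂ) * d x) x) (x : ℝ) : d x = 0 := by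
  -- `exp(lam y) d(y)` is constant, and boundedness of `d` makes it tend to zero as `y → -∞`.
  have hcst : ∀ y : ℝ, Complex.exp (lam * y) * d y = Complex.exp (lam * x) * d x := by
    have hder : ∀ y : ℝ, HasDerivAt (fun y : ℝ => Complex.exp (lam * y) * d y) 0 y := by
      intro y
      have h1 : HasDerivAt (fun y : ℝ => Complex.exp ((lam : ℂ) * (y : ℂ)))
          (Complex.exp (lam * y) * lam) y := by
        have := ((hasDerivAt_id y).ofReal_comp.const_mul (lam : ℂ)).cexp
        simpa using this
      have := h1.mul (hd y)
      convert! this using 1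
      ring
    intro y
    exact is_const_of_deriv_eq_zero (fun y => (hder y).differentiableAt) (fun y => (hder y).deriv) y x
  have hbound : ∀ y : ℝ, ‖Complex.exp (lam * x) * d x‖ ≤ Real.exp (lam * y) * C := by
    intro y
    rw [← hcst y, norm_mul, Complex.norm_exp]
    have : ((lam : ℂ) * (y : ℂ)).re = lam * y := by simp
    rw [this]
    gcongr
    exact hC y
  have hlim : Tendsto (fun y : ℝ => Real.exp (lam * y) * C) atBot (𝓝 0) := by
    have : Tendsto (fun y : ℝ => lam * y) atBot atBot := tendsto_id.const_mul_atBot hlam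
    simpa using (Real.tendsto_exp_atBot.comp this).mul_const C
  have h0 : ‖Complex.exp (lam * x) * d x‖ ≤ 0 :=
    ge_of_tendsto' hlim hbound
  have h1 := norm_le_zero_iff.1 h0
  simpa [Complex.exp_ne_zero] using h1

end Riccati

/-! ### The abstract Fourier algebra and the conservation argument. -/

/-- An algebra of bounded functions on the line described by their Fourier transforms. The
point evaluations are `ev`, the product is `mul`, the operator `(∂ + lam)⁻¹` is `res`,
and `pair` is the integral of the product against `ρ`. -/
structure FourierAlgebra (lam : ℝ) (ρ : Measure ℝ) (X : Type*) [NormedAddCommGroup X]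
    [NormedSpace ℂ X] where
  ev : ℝ → X →L[ℂ] ℂ
  mul : X →L[ℂ] X →L[ℂ] X
  res : X →L[ℂ] X
  pair : X →L[ℂ] X →L[ℂ] ℂ
  ev_mul : ∀ x F G, ev x (mul F G) = ev x F * ev x G
  continuous_ev : ∀ F, Continuous fun x => ev x F
  norm_ev_le : ∀ F, ∃ C, ∀ x, ‖ev x F‖ ≤ C
  ev_injective : ∀ F, (∀ x, ev x F = 0) → F = 0
  hasDerivAt_res : ∀ F x, HasDerivAt (fun y => ev y (res F)) (ev x F - lam * ev x (res F)) x
  -- Parseval combined with the vanishing of the integral of a total derivative; `J` plays the role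
  -- of the flux.
  pair_add_pair_eq_zero : ∀ F₁ W₁ F₂ W₂ J, Integrable (fun x => ev x F₁) ρ →
    Integrable (fun x => ev x F₂) ρ →
    (∀ x, HasDerivAt (fun y => ev y J) (ev x F₁ * ev x W₁ + ev x F₂ * ev x W₂) x) →
    pair F₁ W₁ + pair F₂ W₂ = 0

namespace FourierAlgebra

variable {lam : ℝ} {ρ : Measure ℝ} {X : Type*} [NormedAddCommGroup X] [NormedSpace ℂ X]
  (A : FourierAlgebra lam ρ X)

/-- The trilinear map `(P, U, V) ↦ (∂ + lam)⁻¹ (P U V)`. -/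
def tri : X →L[ℂ] X →L[ℂ] X →L[ℂ] X :=
  ((ContinuousLinearMap.compL ℂ X (X →L[ℂ] X) (X →L[ℂ] X)).flip A.mul).comp
    ((ContinuousLinearMap.compL ℂ X X X).comp
      (((ContinuousLinearMap.compL ℂ X X X) A.res).comp A.mul))

@[simp] theorem tri_apply (P U V : X) : A.tri P U V = A.res (A.mul P (A.mul U V)) := rfl

theorem norm_tri_le (P U V : X) :
    ‖A.tri P U V‖ ≤ ‖A.res‖ * ‖A.mul‖ * ‖A.mul‖ * ‖P‖ * ‖U‖ * ‖V‖ := by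
  calc ‖A.tri P U V‖ ≤ ‖A.res‖ * ‖A.mul P (A.mul U V)‖ := A.res.le_opNorm _
    _ ≤ ‖A.res‖ * (‖A.mul‖ * ‖P‖ * ‖A.mul U V‖) := by
      gcongr; exact A.mul.le_opNorm₂ _ _
    _ ≤ ‖A.res‖ * (‖A.mul‖ * ‖P‖ * (‖A.mul‖ * ‖U‖ * ‖V‖)) := by
      gcongr; exact A.mul.le_opNorm₂ _ _
    _ = _ := by ring

/-- A curve whose point evaluations are differentiable, with continuous derivative, is
differentiable. -/
theorem hasDerivAt_of_ev [CompleteSpace X] {Q Q' : ℝ → X} (hQ' : Continuous Q')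
    (h : ∀ x t, HasDerivAt (fun τ => A.ev x (Q τ)) (A.ev x (Q' t)) t) (t : ℝ) :
    HasDerivAt Q (Q' t) t := by
  let S : ℝ → X := fun t => ∫ τ in (0 : ℝ)..t, Q' τ
  have hS : ∀ t, HasDerivAt S (Q' t) t := fun t =>
    intervalIntegral.integral_hasDerivAt_right (hQ'.intervalIntegrable _ _)
      (hQ'.stronglyMeasurableAtFilter _ _) hQ'.continuousAt
  -- All evaluations of `Q - ∫ Q'` are constant in time, and evaluations separate points. Thus an
  -- equation known only pointwise in `x` becomes differentiability in norm.
  have hcst : ∀ t, Q t = S t + (Q 0 - S 0) := by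
    intro t
    have key : Q t - S t - (Q 0 - S 0) = 0 := by
      apply A.ev_injective
      intro x
      have hder : ∀ τ, HasDerivAt (fun τ => A.ev x (Q τ) - A.ev x (S τ)) 0 τ := by
        intro τ
        have h2 : HasDerivAt (fun τ => A.ev x (S τ)) (A.ev x (Q' τ)) τ :=
          ((A.ev x).restrictScalars ℝ).hasFDerivAt.comp_hasDerivAt τ (hS τ)
        have h3 := (h x τ).sub h2
        rwa [sub_self] at h3
      have := is_const_of_deriv_eq_zero (fun y => (hder y).differentiableAt)
        (fun y => (hder y).deriv) t 0
      simp only [map_sub]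
      rw [this]; simp
    rw [sub_eq_zero] at key
    rw [← key]; abel
  have : Q = fun t => S t + (Q 0 - S 0) := funext hcst
  rw [this]
  exact (hS t).add_const _

variable {Q P W : ℝ → X} {t₀ : ℝ} {Q' P' Z J : X} {K r : ℝ}

/-- Conservation of the pairing of `P` with the Riccati solution `W`, given the time derivative `Z`
of `W` and the flux `J`. -/
theorem hasDerivAt_pair_zero (hlam : 0 < lam) (hK : 0 ≤ K)
    (hT₀ : ∀ u v, ‖A.tri (P t₀) u v‖ ≤ K * ‖u‖ * ‖v‖) (hKr : K * r ≤ 1 / 4)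
    (hQ : HasDerivAt Q Q' t₀) (hP : HasDerivAt P P' t₀)
    (hW : ∀ᶠ t in 𝓝 t₀, W t = A.res (Q t) - A.tri (P t) (W t) (W t))
    (hWr : ∀ᶠ t in 𝓝 t₀, ‖W t‖ ≤ r)
    (hZ : ∀ x, HasDerivAt (fun y => A.ev y Z) (-lam * A.ev x Z + A.ev x Q'
      - A.ev x P' * A.ev x (W t₀) ^ 2 - 2 * A.ev x (P t₀) * A.ev x (W t₀) * A.ev x Z) x)
    (hJ : ∀ x, HasDerivAt (fun y => A.ev y J)
      (A.ev x P' * A.ev x (W t₀) + A.ev x (P t₀) * A.ev x Z) x)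
    (hP'i : Integrable (fun x => A.ev x P') ρ) (hPi : Integrable (fun x => A.ev x (P t₀)) ρ) :
    HasDerivAt (fun t => A.pair (P t) (W t)) 0 t₀ := by
  -- `Z` is known only through its differential equation in `x`. The right-hand side satisfies the
  -- same one up to a difference `d` with `d' = -lam d`, and a bounded such `d` vanishes.
  have hZeq : Z = A.res Q' - A.tri P' (W t₀) (W t₀) - A.tri (P t₀) Z (W t₀)
      - A.tri (P t₀) (W t₀) Z := by
    rw [← sub_eq_zero]
    apply A.ev_injective
    obtain ⟨C, hC⟩ := A.norm_ev_le (Z - (A.res Q' - A.tri P' (W t₀) (W t₀) - A.tri (P t₀) Z (W t₀)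
      - A.tri (P t₀) (W t₀) Z))
    refine eq_zero_of_hasDerivAt_neg_mul hlam hC fun x => ?_
    have h := (hZ x).sub ((((A.hasDerivAt_res Q' x).sub
      (A.hasDerivAt_res (A.mul P' (A.mul (W t₀) (W t₀))) x)).sub
      (A.hasDerivAt_res (A.mul (P t₀) (A.mul Z (W t₀))) x)).sub
      (A.hasDerivAt_res (A.mul (P t₀) (A.mul (W t₀) Z)) x))
    convert! h using 1
    · ext y; simp
    · simp only [map_sub, ev_mul, tri_apply]
      ring
  have hres : HasDerivAt (fun t => A.res (Q t)) (A.res Q') t₀ :=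
    (A.res.restrictScalars ℝ).hasFDerivAt.comp_hasDerivAt t₀ hQ
  have hWd : HasDerivAt W Z t₀ :=
    hasDerivAt_of_quadratic_fixedPoint A.tri hK (by positivity) A.norm_tri_le hT₀ hKr hres hP hW hWr hZeq
  have hfin := (A.pair.bilinearRestrictScalars ℝ).hasDerivAt_of_bilinear (fun _ => hP) fun _ => hWd
  have hsum : A.pair (P t₀) Z + A.pair P' (W t₀) = 0 := by
    rw [add_comm, A.pair_add_pair_eq_zero P' (W t₀) (P t₀) Z J hP'i hPi hJ]
  rw [← hsum]
  exact hfin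

end FourierAlgebra

end AKNS

end

/-! ### Conservation along the NLS and mKdV flows. -/

noncomputable section

open MeasureTheory Filter Topology Set Asymptotics

namespace AKNS

namespace FourierAlgebra

variable {lam : ℝ} {ρ : Measure ℝ} {X : Type*} [NormedAddCommGroup X] [NormedSpace ℂ X]
  (A : FourierAlgebra lam ρ X)

/-- `Q j` is a continuous curve, and `Q (j + 1)` is the spatial derivative of `Q j`. -/
structure IsJet (Q : ℕ → ℝ → X) : Prop where
  continuous : ∀ j, Continuous (Q j)
  hasDerivAt : ∀ j t x, HasDerivAt (fun y => A.ev y (Q j t)) (A.ev x (Q (j + 1) t)) x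
  integrable : ∀ j t, Integrable (fun x => A.ev x (Q j t)) ρ

theorem integrable_ev_mul {F : X} (hF : Integrable (fun x => A.ev x F) ρ) (G : X) :
    Integrable (fun x => A.ev x F * A.ev x G) ρ := by
  obtain ⟨C, hC⟩ := A.norm_ev_le G
  exact hF.mul_bdd (c := C) (A.continuous_ev G).aestronglyMeasurable (Eventually.of_forall hC)

/-- This is `∂ + lam` applied to the fixed-point equation. -/
theorem hasDerivAt_ev_of_riccati {q p w : X} (hw : w = A.res q - A.tri p w w) (x : ℝ) :
    HasDerivAt (fun y => A.ev y w) (-lam * A.ev x w + A.ev x q - A.ev x p * A.ev x w ^ 2) x := by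
  have h := (A.hasDerivAt_res q x).sub (A.hasDerivAt_res (A.mul p (A.mul w w)) x)
  have hfun : (fun y => A.ev y w) = (fun y => A.ev y (A.res q)) -
      fun y => A.ev y (A.res (A.mul p (A.mul w w))) := by
    ext y
    conv_lhs => rw [hw]
    simp
  rw [hfun]
  convert! h using 1
  have h2 : A.ev x w = A.ev x (A.res q) - A.ev x (A.res (A.mul p (A.mul w w))) := congrFun hfun x
  simp only [ev_mul]
  linear_combination (-(lam : ℂ)) * h2

/-- The coupled equations `q_t = -i q'' + 2i q² p`, `p_t = i p'' - 2i p² q`. -/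
def SolvesNLSPair (Q P : ℕ → ℝ → X) : Prop :=
  ∀ x t, HasDerivAt (fun τ => A.ev x (Q 0 τ))
      (-Complex.I * A.ev x (Q 2 t) + 2 * Complex.I * (A.ev x (Q 0 t) ^ 2 * A.ev x (P 0 t))) t ∧
    HasDerivAt (fun τ => A.ev x (P 0 τ))
      (Complex.I * A.ev x (P 2 t) - 2 * Complex.I * (A.ev x (P 0 t) ^ 2 * A.ev x (Q 0 t))) t

/-- The coupled equations `q_t = -q''' + 6 q p q'`, `p_t = -p''' + 6 q p p'`. -/
def SolvesMKdVPair (Q P : ℕ → ℝ → X) : Prop :=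
  ∀ x t, HasDerivAt (fun τ => A.ev x (Q 0 τ))
      (-A.ev x (Q 3 t) + 6 * (A.ev x (Q 0 t) * A.ev x (P 0 t) * A.ev x (Q 1 t))) t ∧
    HasDerivAt (fun τ => A.ev x (P 0 τ))
      (-A.ev x (P 3 t) + 6 * (A.ev x (Q 0 t) * A.ev x (P 0 t) * A.ev x (P 1 t))) t

variable {Q P : ℕ → ℝ → X} {W : ℝ → X} {t₀ K r : ℝ}

/-- In the time part of the AKNS pair, `b = -i q' + i lam q`, `c = i p' + i lam p` and `a = -i
lam²/2 + i q p`. The candidate for `W_t` is `b + 2aW - cW²` and the flux is `cW - a` without the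
constant `i lam²/2`, which has zero derivative. What remains is to check two polynomial identities
modulo the Riccati equation. -/
theorem hasDerivAt_pair_zero_of_NLS [CompleteSpace X] (hlam : 0 < lam) (hK : 0 ≤ K)
    (hQ : A.IsJet Q) (hP : A.IsJet P) (hsol : A.SolvesNLSPair Q P)
    (hT₀ : ∀ u v, ‖A.tri (P 0 t₀) u v‖ ≤ K * ‖u‖ * ‖v‖) (hKr : K * r ≤ 1 / 4)
    (hW : ∀ᶠ t in 𝓝 t₀, W t = A.res (Q 0 t) - A.tri (P 0 t) (W t) (W t))
    (hWr : ∀ᶠ t in 𝓝 t₀, ‖W t‖ ≤ r) :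
    HasDerivAt (fun t => A.pair (P 0 t) (W t)) 0 t₀ := by
  have cQ := hQ.continuous
  have cP := hP.continuous
  have c0 := cQ 0; have c2 := cQ 2; have d0 := cP 0; have d2 := cP 2
  have hQ' := A.hasDerivAt_of_ev (Q := Q 0)
    (Q' := fun t => -Complex.I • Q 2 t + (2 * Complex.I) • A.mul (A.mul (Q 0 t) (Q 0 t)) (P 0 t))
    (by fun_prop) (fun x t => by
      convert! (hsol x t).1 using 1; simp [ev_mul, pow_two]) t₀
  have hP' := A.hasDerivAt_of_ev (Q := P 0)
    (Q' := fun t => Complex.I • P 2 t - (2 * Complex.I) • A.mul (A.mul (P 0 t) (P 0 t)) (Q 0 t))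
    (by fun_prop) (fun x t => by
      convert! (hsol x t).2 using 1; simp [ev_mul, pow_two]) t₀
  have hw := A.hasDerivAt_ev_of_riccati hW.self_of_nhds
  have q0 := hQ.hasDerivAt 0 t₀; have q1 := hQ.hasDerivAt 1 t₀
  have p0 := hP.hasDerivAt 0 t₀; have p1 := hP.hasDerivAt 1 t₀
  refine A.hasDerivAt_pair_zero hlam hK hT₀ hKr hQ' hP' hW hWr
    (Z := -Complex.I • Q 1 t₀ + (Complex.I * lam) • Q 0 t₀
      + (-Complex.I * lam ^ 2) • W t₀ + (2 * Complex.I) • A.mul (A.mul (Q 0 t₀) (P 0 t₀)) (W t₀)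
      - A.mul (Complex.I • P 1 t₀ + (Complex.I * lam) • P 0 t₀) (A.mul (W t₀) (W t₀)))
    (J := A.mul (Complex.I • P 1 t₀ + (Complex.I * lam) • P 0 t₀) (W t₀)
      - Complex.I • A.mul (Q 0 t₀) (P 0 t₀))
    (fun x => ?_) (fun x => ?_) ?_ (hP.integrable 0 t₀)
  · have h := ((((((q1 x).const_mul (-Complex.I)).add ((q0 x).const_mul (Complex.I * lam))).add
      ((hw x).const_mul (-Complex.I * lam ^ 2))).add
      ((((q0 x).mul (p0 x)).mul (hw x)).const_mul (2 * Complex.I)))).sub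
      ((((p1 x).const_mul Complex.I).add ((p0 x).const_mul (Complex.I * lam))).mul
        ((hw x).mul (hw x)))
    convert! h using 1
    · ext y; simp [ev_mul]; ring
    · simp [ev_mul]; ring
  · have h := ((((p1 x).const_mul Complex.I).add ((p0 x).const_mul (Complex.I * lam))).mul
        (hw x)).sub (((q0 x).mul (p0 x)).const_mul Complex.I)
    convert! h using 1
    · ext y; simp [ev_mul]; ring
    · simp [ev_mul]; ring
  · have h := ((hP.integrable 2 t₀).const_mul Complex.I).sub ((A.integrable_ev_mul
      (hP.integrable 0 t₀) (A.mul (P 0 t₀) (Q 0 t₀))).const_mul (2 * Complex.I))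
    refine h.congr (Eventually.of_forall fun x => ?_)
    simp [ev_mul]; ring

/-- The same mechanism with the cubic member of the hierarchy: `b = -q'' + lam q' - lam² q + 2q²p`,
`c = -p'' - lam p' - lam² p + 2qp²`. The local `a` omits the constant `lam³/2`, which therefore
appears separately in `Z` and not in the flux. -/
theorem hasDerivAt_pair_zero_of_mKdV [CompleteSpace X] (hlam : 0 < lam) (hK : 0 ≤ K)
    (hQ : A.IsJet Q) (hP : A.IsJet P) (hsol : A.SolvesMKdVPair Q P)
    (hT₀ : ∀ u v, ‖A.tri (P 0 t₀) u v‖ ≤ K * ‖u‖ * ‖v‖) (hKr : K * r ≤ 1 / 4)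
    (hW : ∀ᶠ t in 𝓝 t₀, W t = A.res (Q 0 t) - A.tri (P 0 t) (W t) (W t))
    (hWr : ∀ᶠ t in 𝓝 t₀, ‖W t‖ ≤ r) :
    HasDerivAt (fun t => A.pair (P 0 t) (W t)) 0 t₀ := by
  have cQ := hQ.continuous
  have cP := hP.continuous
  have c0 := cQ 0; have c1 := cQ 1; have c3 := cQ 3
  have d0 := cP 0; have d1 := cP 1; have d3 := cP 3
  have hQ' := A.hasDerivAt_of_ev (Q := Q 0)
    (Q' := fun t => -Q 3 t + (6 : ℂ) • A.mul (A.mul (Q 0 t) (P 0 t)) (Q 1 t))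
    (by fun_prop) (fun x t => by
      convert! (hsol x t).1 using 1; simp [ev_mul]) t₀
  have hP' := A.hasDerivAt_of_ev (Q := P 0)
    (Q' := fun t => -P 3 t + (6 : ℂ) • A.mul (A.mul (Q 0 t) (P 0 t)) (P 1 t))
    (by fun_prop) (fun x t => by
      convert! (hsol x t).2 using 1; simp [ev_mul]) t₀
  have hw := A.hasDerivAt_ev_of_riccati hW.self_of_nhds
  have q0 := hQ.hasDerivAt 0 t₀; have q1 := hQ.hasDerivAt 1 t₀; have q2 := hQ.hasDerivAt 2 t₀
  have p0 := hP.hasDerivAt 0 t₀; have p1 := hP.hasDerivAt 1 t₀; have p2 := hP.hasDerivAt 2 t₀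
  have hb := fun x => ((((q2 x).const_mul (-1)).add ((q1 x).const_mul (lam : ℂ))).add
    ((q0 x).const_mul (-(lam : ℂ) ^ 2))).add
    ((((q0 x).mul (q0 x)).mul (p0 x)).const_mul (2 : ℂ))
  have hc := fun x => ((((p2 x).const_mul (-1)).add ((p1 x).const_mul (-(lam : ℂ)))).add
    ((p0 x).const_mul (-(lam : ℂ) ^ 2))).add
    ((((q0 x).mul (p0 x)).mul (p0 x)).const_mul (2 : ℂ))
  have ha := fun x => (((q0 x).mul (p0 x)).const_mul (-(lam : ℂ))).sub
    (((q0 x).mul (p1 x)).sub ((q1 x).mul (p0 x)))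
  let b := (-1 : ℂ) • Q 2 t₀ + (lam : ℂ) • Q 1 t₀ + (-(lam : ℂ) ^ 2) • Q 0 t₀
    + (2 : ℂ) • A.mul (A.mul (Q 0 t₀) (Q 0 t₀)) (P 0 t₀)
  let c := (-1 : ℂ) • P 2 t₀ + (-(lam : ℂ)) • P 1 t₀ + (-(lam : ℂ) ^ 2) • P 0 t₀
    + (2 : ℂ) • A.mul (A.mul (Q 0 t₀) (P 0 t₀)) (P 0 t₀)
  let a := (-(lam : ℂ)) • A.mul (Q 0 t₀) (P 0 t₀)
    - (A.mul (Q 0 t₀) (P 1 t₀) - A.mul (Q 1 t₀) (P 0 t₀))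
  refine A.hasDerivAt_pair_zero hlam hK hT₀ hKr hQ' hP' hW hWr
    (Z := b + ((lam : ℂ) ^ 3) • W t₀ + (2 : ℂ) • A.mul a (W t₀) - A.mul c (A.mul (W t₀) (W t₀)))
    (J := A.mul c (W t₀) - a)
    (fun x => ?_) (fun x => ?_) ?_ (hP.integrable 0 t₀)
  · have h := (((hb x).add ((hw x).const_mul ((lam : ℂ) ^ 3))).add
      (((ha x).mul (hw x)).const_mul (2 : ℂ))).sub ((hc x).mul ((hw x).mul (hw x)))
    convert! h using 1
    · ext y; simp [ev_mul, a, b, c]; ring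
    · simp [ev_mul, a, b, c]; ring
  · have h := ((hc x).mul (hw x)).sub (ha x)
    convert! h using 1
    · ext y; simp [ev_mul, a, c]; ring
    · simp [ev_mul, a, b, c]; ring
  · have h := (hP.integrable 3 t₀).neg.add ((A.integrable_ev_mul
      (hP.integrable 1 t₀) (A.mul (P 0 t₀) (Q 0 t₀))).const_mul 6)
    refine h.congr (Eventually.of_forall fun x => ?_)
    simp [ev_mul]; ring

end FourierAlgebra

end AKNS

end

/-! ### Frequency weights and convolution estimates. -/

noncomputable section

open MeasureTheory Filter Topology Set Asymptotics
open scoped ENNReal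

set_option linter.unusedSectionVars false

namespace AKNS

section Weights

variable {G : Type*} [AddCommGroup G] (c : G →+ ℝ) {lam : ℝ}

/-- The squared frequency weight `lam² + (2πc(ξ))²`. -/
def sqWeight (lam : ℝ) (ξ : G) : ℝ := lam ^ 2 + (2 * Real.pi * c ξ) ^ 2

/-- The weight `(lam² + (2πc(ξ))²)^a`. -/
def weight (lam a : ℝ) (ξ : G) : ℝ≥0∞ := ENNReal.ofReal (sqWeight c lam ξ ^ a)

variable {c}

theorem sqWeight_pos (hlam : 0 < lam) (ξ : G) : 0 < sqWeight c lam ξ := by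
  unfold sqWeight; positivity

theorem weight_ne_zero (hlam : 0 < lam) (a : ℝ) (ξ : G) : weight c lam a ξ ≠ 0 := by
  have := Real.rpow_pos_of_pos (sqWeight_pos (c := c) hlam ξ) a
  simp [weight, this]

theorem weight_ne_top (a : ℝ) (ξ : G) : weight c lam a ξ ≠ ⊤ := ENNReal.ofReal_ne_top

theorem weight_mul (hlam : 0 < lam) (a b : ℝ) (ξ : G) :
    weight c lam a ξ * weight c lam b ξ = weight c lam (a + b) ξ := by
  have h := sqWeight_pos (c := c) hlam ξ
  rw [weight, weight, weight, ← ENNReal.ofReal_mul (by positivity), ← Real.rpow_add h]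

theorem weight_zero (ξ : G) : weight c lam 0 ξ = 1 := by simp [weight]

theorem weight_neg_arg (a : ℝ) (ξ : G) : weight c lam a (-ξ) = weight c lam a ξ := by
  simp [weight, sqWeight]

theorem weight_sub_comm (a : ℝ) (ξ η : G) : weight c lam a (ξ - η) = weight c lam a (η - ξ) := by
  rw [← weight_neg_arg, neg_sub]

theorem weight_le_of_nonpos (hlam : 0 < lam) {a : ℝ} (ha : a ≤ 0) (ξ : G) :
    weight c lam a ξ ≤ ENNReal.ofReal (lam ^ (2 * a)) := by
  apply ENNReal.ofReal_le_ofReal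
  rw [Real.rpow_mul hlam.le, Real.rpow_two]
  exact Real.rpow_le_rpow_of_nonpos (by positivity) (le_add_of_nonneg_right (sq_nonneg _)) ha

/-- The squared weight at `ξ + η` is at most four times the larger of the two squared weights, and
`4 ^ a ≤ 4`. -/
theorem weight_add_le (hlam : 0 < lam) {a : ℝ} (ha : 0 ≤ a) (ha1 : a ≤ 1) (ξ η : G) :
    weight c lam a (ξ + η) ≤ 4 * (weight c lam a ξ + weight c lam a η) := by
  have h1 := sqWeight_pos (c := c) hlam ξ
  have h2 := sqWeight_pos (c := c) hlam η
  have h3 := sqWeight_pos (c := c) hlam (ξ + η)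
  have h4 : (4 : ℝ≥0∞) = ENNReal.ofReal 4 := by simp
  rw [weight, weight, weight, ← ENNReal.ofReal_add (by positivity) (by positivity), h4,
    ← ENNReal.ofReal_mul (by norm_num)]
  apply ENNReal.ofReal_le_ofReal
  have hle : sqWeight c lam (ξ + η) ≤ 4 * max (sqWeight c lam ξ) (sqWeight c lam η) := by
    have h5 : sqWeight c lam (ξ + η) ≤ 2 * (sqWeight c lam ξ + sqWeight c lam η) := by
      simp only [sqWeight, map_add]
      nlinarith [sq_nonneg (2 * Real.pi * c ξ - 2 * Real.pi * c η), sq_nonneg lam]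
    have := le_max_left (sqWeight c lam ξ) (sqWeight c lam η)
    have := le_max_right (sqWeight c lam ξ) (sqWeight c lam η)
    linarith
  have h6 : max (sqWeight c lam ξ) (sqWeight c lam η) ^ a
      ≤ sqWeight c lam ξ ^ a + sqWeight c lam η ^ a := by
    have := Real.rpow_nonneg h1.le a
    have := Real.rpow_nonneg h2.le a
    rcases max_choice (sqWeight c lam ξ) (sqWeight c lam η) with h | h <;> rw [h] <;> linarith
  have h7 : (4 : ℝ) ^ a ≤ 4 := by
    simpa using Real.rpow_le_rpow_of_exponent_le (by norm_num : (1 : ℝ) ≤ 4) ha1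
  calc sqWeight c lam (ξ + η) ^ a
      ≤ (4 * max (sqWeight c lam ξ) (sqWeight c lam η)) ^ a := Real.rpow_le_rpow h3.le hle ha
    _ = 4 ^ a * max (sqWeight c lam ξ) (sqWeight c lam η) ^ a :=
        Real.mul_rpow (by norm_num) (h1.le.trans (le_max_left _ _))
    _ ≤ 4 * (sqWeight c lam ξ ^ a + sqWeight c lam η ^ a) := by gcongr

/-- Both exponents being nonpositive, both weights can be moved to the point where the squared
weight is smaller. -/
theorem weight_mul_weight_le (hlam : 0 < lam) {a b : ℝ} (ha : a ≤ 0) (hb : b ≤ 0) (ξ η : G) :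
    weight c lam a ξ * weight c lam b η ≤ weight c lam (a + b) ξ + weight c lam (a + b) η := by
  have h1 := sqWeight_pos (c := c) hlam ξ
  have h2 := sqWeight_pos (c := c) hlam η
  rcases le_total (sqWeight c lam ξ) (sqWeight c lam η) with h | h
  · calc weight c lam a ξ * weight c lam b η ≤ weight c lam a ξ * weight c lam b ξ := by
          gcongr; exact ENNReal.ofReal_le_ofReal (Real.rpow_le_rpow_of_nonpos h1 h hb)
      _ ≤ _ := by rw [weight_mul hlam]; exact le_self_add
  · calc weight c lam a ξ * weight c lam b η ≤ weight c lam a η * weight c lam b η := by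
          gcongr; exact ENNReal.ofReal_le_ofReal (Real.rpow_le_rpow_of_nonpos h2 h ha)
      _ ≤ _ := by rw [weight_mul hlam]; exact le_add_self

variable [MeasurableSpace G]

theorem measurable_weight (hc : Measurable c) (a : ℝ) : Measurable (weight c lam a) := by
  unfold weight sqWeight
  fun_prop

end Weights

section Lintegral

/-- Cauchy–Schwarz. -/
theorem lintegral_mul_sq_le {α : Type*} [MeasurableSpace α] {μ : Measure α} {f g : α → ℝ≥0∞}
    (hf : AEMeasurable f μ) (hg : AEMeasurable g μ) :
    (∫⁻ a, f a * g a ∂μ) ^ 2 ≤ (∫⁻ a, f a ^ 2 ∂μ) * ∫⁻ a, g a ^ 2 ∂μ := by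
  have h := ENNReal.lintegral_mul_le_Lp_mul_Lq μ Real.HolderConjugate.two_two hf hg
  calc (∫⁻ a, f a * g a ∂μ) ^ 2
      ≤ ((∫⁻ a, f a ^ (2 : ℝ) ∂μ) ^ (1 / (2 : ℝ)) * (∫⁻ a, g a ^ (2 : ℝ) ∂μ) ^ (1 / (2 : ℝ))) ^ 2 := by
        gcongr; exact h
    _ = _ := by
        rw [mul_pow, ← ENNReal.rpow_natCast, ← ENNReal.rpow_natCast, ← ENNReal.rpow_mul,
          ← ENNReal.rpow_mul]
        norm_num

/-- Weighted Cauchy–Schwarz. -/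
theorem lintegral_mul_sq_le_of_weights {α : Type*} [MeasurableSpace α] {μ : Measure α}
    {f g w v : α → ℝ≥0∞} (hf : AEMeasurable f μ) (hg : AEMeasurable g μ) (hw : AEMeasurable w μ)
    (hv : AEMeasurable v μ) (hwv : ∀ a, w a * v a = 1) :
    (∫⁻ a, f a * g a ∂μ) ^ 2 ≤ (∫⁻ a, w a * f a ^ 2 ∂μ) * ∫⁻ a, v a * g a ^ 2 ∂μ := by
  have hsq : ∀ x : ℝ≥0∞, (x ^ (1 / 2 : ℝ)) ^ 2 = x := fun x => by
    rw [← ENNReal.rpow_natCast, ← ENNReal.rpow_mul]; norm_num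
  have h := lintegral_mul_sq_le ((hw.pow_const (1 / 2 : ℝ)).mul hf) ((hv.pow_const (1 / 2 : ℝ)).mul hg)
  refine le_trans (le_of_eq ?_) (h.trans (le_of_eq ?_))
  · congr 1
    refine lintegral_congr fun a => ?_
    have : w a ^ (1 / 2 : ℝ) * v a ^ (1 / 2 : ℝ) = 1 := by
      rw [← ENNReal.mul_rpow_of_nonneg _ _ (by norm_num), hwv, ENNReal.one_rpow]
    calc f a * g a = (w a ^ (1 / 2 : ℝ) * v a ^ (1 / 2 : ℝ)) * (f a * g a) := by rw [this, one_mul]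
      _ = _ := by simp only [Pi.mul_apply]; ring
  · congr 1 <;> exact lintegral_congr fun a => by simp only [Pi.mul_apply, mul_pow, hsq]

variable {G : Type*} [AddCommGroup G] [MeasurableSpace G] [MeasurableAdd₂ G] [MeasurableNeg G]
  {μ : Measure G} [SFinite μ] [μ.IsAddLeftInvariant] [μ.IsNegInvariant] {c : G →+ ℝ} {lam s : ℝ}

theorem aemeasurable_comp_sub {f : G → ℝ≥0∞} (hf : AEMeasurable f μ) (ξ : G) :
    AEMeasurable (fun t => f (ξ - t)) μ :=
  hf.comp_quasiMeasurePreserving (Measure.measurePreserving_sub_left μ ξ).quasiMeasurePreserving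

theorem aemeasurable_comp_sub_prod {f : G → ℝ≥0∞} (hf : AEMeasurable f μ) :
    AEMeasurable (fun p : G × G => f (p.1 - p.2)) (μ.prod μ) :=
  hf.comp_quasiMeasurePreserving (quasiMeasurePreserving_sub_of_right_invariant μ μ)

theorem lintegral_lintegral_mul_sub {f g : G → ℝ≥0∞} (hf : AEMeasurable f μ)
    (hg : AEMeasurable g μ) :
    ∫⁻ ξ, ∫⁻ t, f t * g (ξ - t) ∂μ ∂μ = (∫⁻ t, f t ∂μ) * ∫⁻ t, g t ∂μ := by
  have hm : AEMeasurable (fun p : G × G => f p.2 * g (p.1 - p.2)) (μ.prod μ) :=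
    hf.comp_snd.mul (aemeasurable_comp_sub_prod hg)
  rw [lintegral_lintegral_swap hm]
  have : ∀ t, ∫⁻ ξ, f t * g (ξ - t) ∂μ = f t * ∫⁻ ξ, g ξ ∂μ := fun t => by
    rw [lintegral_const_mul'', lintegral_sub_right_eq_self]
    exact hg.comp_quasiMeasurePreserving (measurePreserving_sub_right μ t).quasiMeasurePreserving
  simp_rw [this]
  exact lintegral_mul_const'' _ hf

/-- The weighted `L²` space of index `1 + s` is an algebra under convolution. -/
theorem lintegral_weight_convolution_le (hc : Measurable c) (hlam : 0 < lam) (hs₁ : -1 ≤ s)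
    (hs₂ : s ≤ 0) {f g : G → ℝ≥0∞} (hf : AEMeasurable f μ) (hg : AEMeasurable g μ) :
    ∫⁻ ξ, weight c lam (1 + s) ξ * (∫⁻ t, f t * g (ξ - t) ∂μ) ^ 2 ∂μ ≤
      8 * (∫⁻ ξ, weight c lam (-1 - s) ξ ∂μ) * (∫⁻ ξ, weight c lam (1 + s) ξ * f ξ ^ 2 ∂μ) *
        ∫⁻ ξ, weight c lam (1 + s) ξ * g ξ ^ 2 ∂μ := by
  set S := ∫⁻ ξ, weight c lam (-1 - s) ξ ∂μ with hS
  have mw : ∀ a, Measurable (weight c lam a) := fun a => measurable_weight hc a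
  have hinv : ∀ t : G, weight c lam (-1 - s) t * weight c lam (1 + s) t = 1 := fun t => by
    rw [weight_mul hlam, ← weight_zero (c := c) (lam := lam) t]; ring_nf
  -- Cauchy–Schwarz in `t` with the weights of both factors inserted leaves the convolution of the
  -- inverse weight with itself, to be compared with the inverse weight at `ξ`.
  have key : ∀ ξ, weight c lam (1 + s) ξ * (∫⁻ t, f t * g (ξ - t) ∂μ) ^ 2 ≤
      8 * S * ∫⁻ t, (weight c lam (1 + s) t * f t ^ 2) *
        (weight c lam (1 + s) (ξ - t) * g (ξ - t) ^ 2) ∂μ := by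
    intro ξ
    have hsub : Measurable fun t : G => ξ - t := measurable_const.sub measurable_id
    have hms : ∀ a, Measurable fun t => weight c lam a (ξ - t) := fun a => (mw a).comp hsub
    have h1 := lintegral_mul_sq_le_of_weights (μ := μ) (f := fun _ => 1)
      (g := fun t => f t * g (ξ - t))
      (w := fun t => weight c lam (-1 - s) t * weight c lam (-1 - s) (ξ - t))
      (v := fun t => weight c lam (1 + s) t * weight c lam (1 + s) (ξ - t))
      aemeasurable_const (hf.mul (aemeasurable_comp_sub hg ξ))
      ((mw _).mul ((mw _).comp hsub)).aemeasurable ((mw _).mul ((mw _).comp hsub)).aemeasurable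
      (fun t => by
        calc _ = (weight c lam (-1 - s) t * weight c lam (1 + s) t) *
              (weight c lam (-1 - s) (ξ - t) * weight c lam (1 + s) (ξ - t)) := by ring
          _ = 1 := by rw [hinv, hinv, one_mul])
    simp only [one_mul, one_pow, mul_one] at h1
    -- Splitting the weight at `ξ = t + (ξ - t)` cancels one of the two inverse weights in each
    -- term; both remaining integrals equal `S`, whence `8 = 4 + 4`.
    have h2 : weight c lam (1 + s) ξ *
        ∫⁻ t, weight c lam (-1 - s) t * weight c lam (-1 - s) (ξ - t) ∂μ ≤ 8 * S := by
      have hm : Measurable fun t => weight c lam (-1 - s) t * weight c lam (-1 - s) (ξ - t) :=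
        (mw _).mul ((mw _).comp hsub)
      rw [← lintegral_const_mul _ hm]
      calc _ ≤ ∫⁻ t, (4 * weight c lam (-1 - s) (ξ - t) + 4 * weight c lam (-1 - s) t) ∂μ := by
            refine lintegral_mono fun t => ?_
            have h3 := weight_add_le (c := c) hlam (a := 1 + s) (by linarith) (by linarith) t (ξ - t)
            rw [add_sub_cancel] at h3
            calc _ ≤ (4 * (weight c lam (1 + s) t + weight c lam (1 + s) (ξ - t))) *
                  (weight c lam (-1 - s) t * weight c lam (-1 - s) (ξ - t)) := by gcongr
              _ = 4 * (weight c lam (-1 - s) t * weight c lam (1 + s) t) *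
                    weight c lam (-1 - s) (ξ - t) +
                  4 * (weight c lam (-1 - s) (ξ - t) * weight c lam (1 + s) (ξ - t)) *
                    weight c lam (-1 - s) t := by ring
              _ = _ := by rw [hinv, hinv, mul_one]
        _ = 8 * S := by
            rw [lintegral_add_right _ ((mw _).const_mul _), lintegral_const_mul _ (mw _),
              lintegral_const_mul _ (hms _), lintegral_sub_left_eq_self, ← hS]
            ring
    calc _ ≤ weight c lam (1 + s) ξ *
          ((∫⁻ t, weight c lam (-1 - s) t * weight c lam (-1 - s) (ξ - t) ∂μ) *
          ∫⁻ t, weight c lam (1 + s) t * weight c lam (1 + s) (ξ - t) * (f t * g (ξ - t)) ^ 2 ∂μ) := by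
          gcongr
      _ ≤ 8 * S * ∫⁻ t, weight c lam (1 + s) t * weight c lam (1 + s) (ξ - t) *
            (f t * g (ξ - t)) ^ 2 ∂μ := by
          rw [← mul_assoc]; gcongr
      _ = _ := by
          congr 1
          exact lintegral_congr fun t => by ring
  have m1 : AEMeasurable (fun t => weight c lam (1 + s) t * f t ^ 2) μ :=
    (mw _).aemeasurable.mul (hf.pow_const 2)
  have m2 : AEMeasurable (fun t => weight c lam (1 + s) t * g t ^ 2) μ :=
    (mw _).aemeasurable.mul (hg.pow_const 2)
  refine (lintegral_mono key).trans (le_of_eq ?_)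
  rw [lintegral_const_mul'', lintegral_lintegral_mul_sub m1 m2]
  · ring
  exact (m1.comp_snd.mul (aemeasurable_comp_sub_prod m2)).lintegral_prod_right'

/-- Multiplication by a function of regularity `1 + s` maps regularity `s` to regularity `s`. -/
theorem lintegral_weight_convolution_le_of_neg (hc : Measurable c) (hlam : 0 < lam)
    (hs₁ : -(1 / 2 : ℝ) ≤ s) (hs₂ : s ≤ 0) {f g : G → ℝ≥0∞} (hf : AEMeasurable f μ)
    (hg : AEMeasurable g μ) :
    ∫⁻ ξ, weight c lam s ξ * (∫⁻ t, f t * g (ξ - t) ∂μ) ^ 2 ∂μ ≤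
      12 * (∫⁻ ξ, weight c lam (-1 - s) ξ ∂μ) * (∫⁻ ξ, weight c lam s ξ * f ξ ^ 2 ∂μ) *
        ∫⁻ ξ, weight c lam (1 + s) ξ * g ξ ^ 2 ∂μ := by
  set S := ∫⁻ ξ, weight c lam (-1 - s) ξ ∂μ with hS
  set N := ∫⁻ ξ, weight c lam (1 + s) ξ * g ξ ^ 2 ∂μ with hN
  have mw : ∀ a, Measurable (weight c lam a) := fun a => measurable_weight hc a
  have m2 : AEMeasurable (fun t => weight c lam (1 + s) t * g t ^ 2) μ :=
    (mw _).aemeasurable.mul (hg.pow_const 2)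
  -- Here the weight is spent on `g` alone, and the norm of `g` factors out by translation
  -- invariance. What is left is a Schur-type bound on a kernel acting on `f²`.
  have key : ∀ ξ, (∫⁻ t, f t * g (ξ - t) ∂μ) ^ 2 ≤
      (∫⁻ t, f t ^ 2 * weight c lam (-1 - s) (ξ - t) ∂μ) * N := by
    intro ξ
    have hsub : Measurable fun t : G => ξ - t := measurable_const.sub measurable_id
    have hms : ∀ a, Measurable fun t => weight c lam a (ξ - t) := fun a => (mw a).comp hsub
    have h1 := lintegral_mul_sq_le_of_weights (μ := μ) (f := f) (g := fun t => g (ξ - t))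
      (w := fun t => weight c lam (-1 - s) (ξ - t)) (v := fun t => weight c lam (1 + s) (ξ - t))
      hf (aemeasurable_comp_sub hg ξ) ((mw _).comp hsub).aemeasurable
      ((mw _).comp hsub).aemeasurable
      (fun t => by rw [weight_mul hlam, ← weight_zero (c := c) (lam := lam) (ξ - t)]; ring_nf)
    rw [lintegral_sub_left_eq_self (fun t => weight c lam (1 + s) t * g t ^ 2) ξ] at h1
    simpa only [mul_comm (weight c lam (-1 - s) (ξ - _))] using h1
  have inner : ∀ t, ∫⁻ ξ, weight c lam s ξ * weight c lam (-1 - s) (ξ - t) ∂μ ≤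
      12 * S * weight c lam s t := by
    intro t
    have hsub : Measurable fun ξ : G => ξ - t := measurable_id.sub measurable_const
    have hms : ∀ a, Measurable fun ξ => weight c lam a (ξ - t) := fun a => (mw a).comp hsub
    have hm : Measurable fun ξ => weight c lam s ξ * weight c lam (-1 - s) (ξ - t) :=
      (mw _).mul ((mw _).comp hsub)
    have h2 : weight c lam (-s) t * ∫⁻ ξ, weight c lam s ξ * weight c lam (-1 - s) (ξ - t) ∂μ ≤
        12 * S := by
      rw [← lintegral_const_mul _ hm]
      calc _ ≤ ∫⁻ ξ, (8 * weight c lam (-1 - s) (ξ - t) + 4 * weight c lam (-1 - s) ξ) ∂μ := by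
            refine lintegral_mono fun ξ => ?_
            have h3 := weight_add_le (c := c) hlam (a := -s) (by linarith) (by linarith) ξ (t - ξ)
            rw [add_sub_cancel, weight_sub_comm _ t ξ] at h3
            -- This is where `s ≥ -1/2` enters, as `-1 - 2s ≤ 0`. The first half of the splitting
            -- contributes `4S` and this half `4(S + S)`, whence `12`.
            have h4 := weight_mul_weight_le (c := c) hlam (a := s) (b := -1 - 2 * s) hs₂
              (by linarith) ξ (ξ - t)
            have e1 : s + (-1 - 2 * s) = -1 - s := by ring
            rw [e1] at h4
            have e2 : weight c lam (-s) ξ * weight c lam s ξ = 1 := by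
              rw [weight_mul hlam, neg_add_cancel, weight_zero]
            have e3 : weight c lam (-s) (ξ - t) * weight c lam (-1 - s) (ξ - t) =
                weight c lam (-1 - 2 * s) (ξ - t) := by
              rw [weight_mul hlam]; ring_nf
            calc _ ≤ (4 * (weight c lam (-s) ξ + weight c lam (-s) (ξ - t))) *
                  (weight c lam s ξ * weight c lam (-1 - s) (ξ - t)) := by gcongr
              _ = 4 * (weight c lam (-s) ξ * weight c lam s ξ) * weight c lam (-1 - s) (ξ - t) +
                  4 * (weight c lam s ξ *
                    (weight c lam (-s) (ξ - t) * weight c lam (-1 - s) (ξ - t))) := by ring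
              _ ≤ 4 * weight c lam (-1 - s) (ξ - t) +
                  4 * (weight c lam (-1 - s) ξ + weight c lam (-1 - s) (ξ - t)) := by
                rw [e2, e3, mul_one]; gcongr
              _ = _ := by ring
        _ = 12 * S := by
            rw [lintegral_add_right _ ((mw _).const_mul _), lintegral_const_mul _ (mw _),
              lintegral_const_mul _ (hms _), lintegral_sub_right_eq_self, ← hS]
            ring
    calc _ = weight c lam s t * (weight c lam (-s) t *
          ∫⁻ ξ, weight c lam s ξ * weight c lam (-1 - s) (ξ - t) ∂μ) := by
          rw [← mul_assoc, weight_mul hlam, add_neg_cancel, weight_zero, one_mul]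
      _ ≤ weight c lam s t * (12 * S) := by gcongr
      _ = _ := by ring
  have hmp : AEMeasurable (fun p : G × G => weight c lam s p.1 *
      (f p.2 ^ 2 * weight c lam (-1 - s) (p.1 - p.2))) (μ.prod μ) :=
    ((mw _).comp measurable_fst).aemeasurable.mul ((hf.pow_const 2).comp_snd.mul
      (aemeasurable_comp_sub_prod (mw _).aemeasurable))
  have hpt : ∀ ξ, AEMeasurable (fun t => f t ^ 2 * weight c lam (-1 - s) (ξ - t)) μ := fun ξ =>
    (hf.pow_const 2).mul (aemeasurable_comp_sub (mw _).aemeasurable ξ)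
  calc _ ≤ ∫⁻ ξ, (∫⁻ t, weight c lam s ξ * (f t ^ 2 * weight c lam (-1 - s) (ξ - t)) ∂μ) * N ∂μ := by
        refine lintegral_mono fun ξ => ?_
        rw [lintegral_const_mul'' _ (hpt ξ), mul_assoc]
        gcongr
        exact key ξ
    _ = (∫⁻ ξ, ∫⁻ t, weight c lam s ξ * (f t ^ 2 * weight c lam (-1 - s) (ξ - t)) ∂μ ∂μ) * N :=
        lintegral_mul_const'' _ hmp.lintegral_prod_right'
    _ = (∫⁻ t, f t ^ 2 * ∫⁻ ξ, weight c lam s ξ * weight c lam (-1 - s) (ξ - t) ∂μ ∂μ) * N := by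
        rw [lintegral_lintegral_swap hmp]
        congr 1
        refine lintegral_congr fun t => ?_
        have hm : Measurable fun ξ => weight c lam s ξ * weight c lam (-1 - s) (ξ - t) :=
          (mw _).mul ((mw _).comp (measurable_id.sub measurable_const))
        rw [← lintegral_const_mul _ hm]
        exact lintegral_congr fun ξ => by ring
    _ ≤ (∫⁻ t, 12 * S * (weight c lam s t * f t ^ 2) ∂μ) * N := by
        refine mul_le_mul' (lintegral_mono fun t => ?_) le_rfl
        calc _ ≤ f t ^ 2 * (12 * S * weight c lam s t) := by gcongr; exact inner t
          _ = _ := by ring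
    _ = _ := by
        rw [lintegral_const_mul'']
        exact (mw _).aemeasurable.mul (hf.pow_const 2)

end Lintegral

end AKNS

end

/-! ### The weighted Fourier space, point evaluation and the resolvent. -/

noncomputable section

open MeasureTheory Filter Topology Set Asymptotics
open scoped ENNReal

set_option linter.unusedSectionVars false

namespace AKNS

section WeightedSpace

variable {G : Type*} [AddCommGroup G] [MeasurableSpace G]

/-- The character of frequency `2πc(ξ)` at the point `x`. -/
def character (c : G →+ ℝ) (x : ℝ) (ξ : G) : ℂ := Complex.exp ((2 * Real.pi * c ξ * x : ℝ) * Complex.I)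

/-- The function on the line with Fourier transform `F`. -/
def synthesis (μ : Measure G) (c : G →+ ℝ) (F : G → ℂ) (x : ℝ) : ℂ := ∫ ξ, character c x ξ * F ξ ∂μ

/-- The multiplier of `(∂ + lam)⁻¹`. -/
def resolvent (c : G →+ ℝ) (lam : ℝ) (ξ : G) : ℂ := ((lam : ℂ) + (2 * Real.pi * c ξ : ℝ) * Complex.I)⁻¹

/-- Convolution of functions on the frequency group. -/
def conv (μ : Measure G) (F H : G → ℂ) (ξ : G) : ℂ := ∫ t, F t * H (ξ - t) ∂μ

/-- The parameters for which the weighted space is a convolution algebra. -/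
structure Admissible (μ : Measure G) (c : G →+ ℝ) (lam s : ℝ) : Prop where
  measurable : Measurable c
  pos : 0 < lam
  neg_half_le : -(1 / 2 : ℝ) ≤ s
  nonpos : s ≤ 0
  lintegral_ne_top : ∫⁻ ξ, weight c lam (-1 - s) ξ ∂μ ≠ ⊤

/-- The measure with density the weight of index `1 + s`. -/
abbrev weightedMeasure (μ : Measure G) (c : G →+ ℝ) (lam s : ℝ) : Measure G :=
  μ.withDensity (weight c lam (1 + s))

/-- Fourier transforms of functions of regularity `1 + s`. -/
abbrev WeightedSpace (μ : Measure G) (c : G →+ ℝ) (lam s : ℝ) := Lp ℂ 2 (weightedMeasure μ c lam s)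

variable {μ : Measure G} {c : G →+ ℝ} {lam s : ℝ}

@[simp] theorem norm_character (x : ℝ) (ξ : G) : ‖character c x ξ‖ = 1 :=
  Complex.norm_exp_ofReal_mul_I _

theorem character_add (x : ℝ) (ξ η : G) :
    character c x (ξ + η) = character c x ξ * character c x η := by
  simp only [character, ← Complex.exp_add, map_add]
  congr 1; push_cast; ring

theorem measurable_character (hc : Measurable c) (x : ℝ) : Measurable (character c x) := by
  unfold character; fun_prop

theorem measurable_resolvent (hc : Measurable c) : Measurable (resolvent c lam) := by
  unfold resolvent; fun_prop

theorem resolvent_denom_ne_zero (hlam : 0 < lam) (ξ : G) :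
    (lam : ℂ) + (2 * Real.pi * c ξ : ℝ) * Complex.I ≠ 0 := by
  intro h
  have := congrArg Complex.re h
  simp at this
  exact hlam.ne' this

theorem norm_resolvent_sq (ξ : G) : ‖resolvent c lam ξ‖ ^ 2 = (sqWeight c lam ξ)⁻¹ := by
  rw [resolvent, norm_inv, inv_pow, ← Complex.normSq_eq_norm_sq, Complex.normSq_add_mul_I, sqWeight]

theorem enorm_resolvent_sq (hlam : 0 < lam) (ξ : G) :
    ‖resolvent c lam ξ‖ₑ ^ 2 = weight c lam (-1) ξ := by
  have h := sqWeight_pos (c := c) hlam ξ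
  rw [weight, Real.rpow_neg_one, ← norm_resolvent_sq, ← ofReal_norm, ENNReal.ofReal_pow (norm_nonneg _)]

theorem norm_resolvent_le (hlam : 0 < lam) (ξ : G) : ‖resolvent c lam ξ‖ ≤ lam⁻¹ := by
  apply le_of_sq_le_sq _ (by positivity)
  rw [norm_resolvent_sq, inv_pow]
  gcongr
  exact le_add_of_nonneg_right (sq_nonneg _)

theorem eLpNorm_two_sq {α E : Type*} [MeasurableSpace α] [NormedAddCommGroup E] (ν : Measure α) (f : α → E) :
    eLpNorm f 2 ν ^ 2 = ∫⁻ x, ‖f x‖ₑ ^ 2 ∂ν := by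
  have := eLpNorm_nnreal_pow_eq_lintegral (f := f) (μ := ν) (p := 2) (by norm_num)
  simpa using this

theorem norm_le_of_enorm_sq_le {E₁ E₂ E₃ : Type*} [NormedAddCommGroup E₁] [NormedAddCommGroup E₂]
    [NormedAddCommGroup E₃] {x : E₁} {y : E₂} {z : E₃} {D : ℝ≥0∞} (hD : D ≠ ⊤)
    (h : ‖x‖ₑ ^ 2 ≤ D * ‖y‖ₑ ^ 2 * ‖z‖ₑ ^ 2) : ‖x‖ ≤ Real.sqrt D.toReal * ‖y‖ * ‖z‖ := by
  apply le_of_sq_le_sq _ (by positivity)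
  have h1 := ENNReal.toReal_mono (by finiteness) h
  rw [ENNReal.toReal_pow, toReal_enorm, ENNReal.toReal_mul, ENNReal.toReal_mul, ENNReal.toReal_pow,
    ENNReal.toReal_pow, toReal_enorm, toReal_enorm] at h1
  rwa [mul_pow, mul_pow, Real.sq_sqrt ENNReal.toReal_nonneg]

namespace Admissible

variable (h : Admissible μ c lam s)
include h

theorem ae_iff {p : G → Prop} : (∀ᵐ ξ ∂(weightedMeasure μ c lam s), p ξ) ↔ ∀ᵐ ξ ∂μ, p ξ :=
  ⟨fun hp => (withDensity_absolutelyContinuous' (measurable_weight h.measurable _).aemeasurable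
    (Eventually.of_forall fun ξ => weight_ne_zero h.pos _ ξ)).ae_le hp,
   fun hp => (withDensity_absolutelyContinuous _ _).ae_le hp⟩

theorem lintegral_eq (f : G → ℝ≥0∞) :
    ∫⁻ ξ, f ξ ∂(weightedMeasure μ c lam s) = ∫⁻ ξ, weight c lam (1 + s) ξ * f ξ ∂μ :=
  lintegral_withDensity_eq_lintegral_mul_non_measurable _ (measurable_weight h.measurable _)
    (Eventually.of_forall fun ξ => (weight_ne_top _ ξ).lt_top) f

theorem aestronglyMeasurable_iff {f : G → ℂ} :
    AEStronglyMeasurable f (weightedMeasure μ c lam s) ↔ AEStronglyMeasurable f μ :=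
  ⟨fun hf => hf.mono_ac (withDensity_absolutelyContinuous'
    (measurable_weight h.measurable _).aemeasurable
    (Eventually.of_forall fun ξ => weight_ne_zero h.pos _ ξ)),
   fun hf => hf.mono_ac (withDensity_absolutelyContinuous _ _)⟩

theorem memLp {f : G → ℂ} (hf : AEStronglyMeasurable f μ)
    (hfin : ∫⁻ ξ, weight c lam (1 + s) ξ * ‖f ξ‖ₑ ^ 2 ∂μ ≠ ⊤) :
    MemLp f 2 (weightedMeasure μ c lam s) := by
  refine ⟨h.aestronglyMeasurable_iff.2 hf, ?_⟩
  have h1 := eLpNorm_two_sq (weightedMeasure μ c lam s) f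
  rw [h.lintegral_eq] at h1
  by_contra hcon
  rw [not_lt_top_iff] at hcon
  rw [hcon] at h1
  exact hfin (by rw [← h1]; simp)

theorem enorm_toLp_sq {f : G → ℂ} (hf : MemLp f 2 (weightedMeasure μ c lam s)) :
    ‖hf.toLp f‖ₑ ^ 2 = ∫⁻ ξ, weight c lam (1 + s) ξ * ‖f ξ‖ₑ ^ 2 ∂μ := by
  rw [Lp.enorm_toLp, eLpNorm_two_sq, h.lintegral_eq]

theorem enorm_sq (F : WeightedSpace μ c lam s) :
    ‖F‖ₑ ^ 2 = ∫⁻ ξ, weight c lam (1 + s) ξ * ‖F ξ‖ₑ ^ 2 ∂μ := by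
  rw [Lp.enorm_def, eLpNorm_two_sq, h.lintegral_eq]

theorem aestronglyMeasurable (F : WeightedSpace μ c lam s) : AEStronglyMeasurable F μ :=
  h.aestronglyMeasurable_iff.1 (Lp.aestronglyMeasurable F)

theorem coeFn_toLp {f : G → ℂ} (hf : MemLp f 2 (weightedMeasure μ c lam s)) :
    hf.toLp f =ᵐ[μ] f := h.ae_iff.1 hf.coeFn_toLp

theorem coeFn_add (F H : WeightedSpace μ c lam s) : ⇑(F + H) =ᵐ[μ] fun ξ => F ξ + H ξ :=
  h.ae_iff.1 (Lp.coeFn_add F H)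

theorem coeFn_smul (a : ℂ) (F : WeightedSpace μ c lam s) : ⇑(a • F) =ᵐ[μ] fun ξ => a * F ξ :=
  h.ae_iff.1 (Lp.coeFn_smul a F)

theorem weight_mul_inv (a : ℝ) (ξ : G) : weight c lam a ξ * weight c lam (-a) ξ = 1 := by
  rw [weight_mul h.pos, add_neg_cancel, weight_zero]

/-- Integrability of the inverse weight embeds the weighted `L²` space in `L¹`, so that the
synthesised functions are bounded and continuous. -/
theorem lintegral_enorm_sq_le (F : WeightedSpace μ c lam s) :
    (∫⁻ ξ, ‖F ξ‖ₑ ∂μ) ^ 2 ≤ (∫⁻ ξ, weight c lam (-1 - s) ξ ∂μ) * ‖F‖ₑ ^ 2 := by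
  have h1 := lintegral_mul_sq_le_of_weights (μ := μ) (f := fun _ => 1) (g := fun ξ => ‖F ξ‖ₑ)
    (w := weight c lam (-1 - s)) (v := weight c lam (1 + s)) aemeasurable_const
    (h.aestronglyMeasurable F).enorm (measurable_weight h.measurable _).aemeasurable
    (measurable_weight h.measurable _).aemeasurable
    (fun ξ => by have := h.weight_mul_inv (-1 - s) ξ; rwa [neg_sub, sub_neg_eq_add, add_comm] at this)
  rw [h.enorm_sq]
  simpa using h1

theorem integrable (F : WeightedSpace μ c lam s) : Integrable F μ := by
  refine ⟨h.aestronglyMeasurable F, ?_⟩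
  rw [HasFiniteIntegral]
  have h1 := (h.lintegral_enorm_sq_le F).trans_lt
    (ENNReal.mul_lt_top h.lintegral_ne_top.lt_top (by finiteness))
  by_contra hcon
  rw [not_lt_top_iff] at hcon
  rw [hcon] at h1
  simp at h1

/-- The weight of index `1 + s` is bounded below. Unweighted `L²` membership makes the convolution
integral converge at every frequency, not just almost every one. -/
theorem memLp_two (F : WeightedSpace μ c lam s) : MemLp F 2 μ := by
  refine ⟨h.aestronglyMeasurable F, ?_⟩
  have h1 : eLpNorm F 2 μ ^ 2 ≤ ENNReal.ofReal (lam ^ (2 * (-1 - s))) * ‖F‖ₑ ^ 2 := by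
    rw [eLpNorm_two_sq, h.enorm_sq, ← lintegral_const_mul' _ _ ENNReal.ofReal_ne_top]
    refine lintegral_mono fun ξ => ?_
    have h2 := h.weight_mul_inv (-1 - s) ξ
    rw [neg_sub, sub_neg_eq_add, add_comm s 1] at h2
    calc ‖F ξ‖ₑ ^ 2 = weight c lam (-1 - s) ξ * (weight c lam (1 + s) ξ * ‖F ξ‖ₑ ^ 2) := by
          rw [← mul_assoc, h2, one_mul]
      _ ≤ _ := by
          gcongr
          exact weight_le_of_nonpos h.pos (by linarith [h.neg_half_le]) ξ
  by_contra hcon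
  rw [not_lt_top_iff] at hcon
  rw [hcon] at h1
  have h3 := h1.trans_lt (ENNReal.mul_lt_top (by finiteness) (by finiteness))
  simp at h3

theorem integrable_character_mul {F : G → ℂ} (hF : Integrable F μ) (x : ℝ) :
    Integrable (fun ξ => character c x ξ * F ξ) μ :=
  hF.bdd_mul (c := 1) (measurable_character h.measurable x).aestronglyMeasurable
    (Eventually.of_forall fun ξ => (norm_character x ξ).le)

theorem norm_synthesis_le (F : WeightedSpace μ c lam s) (x : ℝ) :
    ‖synthesis μ c F x‖ ≤ Real.sqrt (∫⁻ ξ, weight c lam (-1 - s) ξ ∂μ).toReal * ‖F‖ := by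
  have h1 : ‖synthesis μ c F x‖ₑ ≤ ∫⁻ ξ, ‖F ξ‖ₑ ∂μ := by
    refine (enorm_integral_le_lintegral_enorm _).trans (lintegral_mono fun ξ => ?_)
    rw [enorm_mul, ← ofReal_norm (character c x ξ), norm_character]; simp
  have h2 : ‖synthesis μ c F x‖ₑ ^ 2 ≤
      (∫⁻ ξ, weight c lam (-1 - s) ξ ∂μ) * ‖F‖ₑ ^ 2 * ‖(1 : ℝ)‖ₑ ^ 2 := by
    simpa using (pow_le_pow_left₀ zero_le h1 2).trans (h.lintegral_enorm_sq_le F)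
  simpa using norm_le_of_enorm_sq_le h.lintegral_ne_top h2

/-- Point evaluation of the synthesised function. -/
def ev (x : ℝ) : WeightedSpace μ c lam s →L[ℂ] ℂ :=
  LinearMap.mkContinuous
    { toFun := fun F => synthesis μ c F x
      map_add' := fun F H => by
        rw [synthesis, synthesis, synthesis, ← integral_add
          (h.integrable_character_mul (h.integrable F) x)
          (h.integrable_character_mul (h.integrable H) x)]
        refine integral_congr_ae ?_
        filter_upwards [h.coeFn_add F H] with ξ hξ
        rw [hξ, mul_add]
      map_smul' := fun a F => by
        rw [synthesis, synthesis, RingHom.id_apply, smul_eq_mul, ← integral_const_mul]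
        refine integral_congr_ae ?_
        filter_upwards [h.coeFn_smul a F] with ξ hξ
        rw [hξ]; ring }
    _ (fun F => h.norm_synthesis_le F x)

theorem ev_apply (x : ℝ) (F : WeightedSpace μ c lam s) : h.ev x F = synthesis μ c F x := rfl

theorem continuous_synthesis {F : G → ℂ} (hF : Integrable F μ) : Continuous (synthesis μ c F) := by
  refine continuous_of_dominated (bound := fun ξ => ‖F ξ‖)
    (fun x => (h.integrable_character_mul hF x).aestronglyMeasurable)
    (fun x => Eventually.of_forall fun ξ => by simp) hF.norm
    (Eventually.of_forall fun ξ => ?_)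
  unfold character
  fun_prop

theorem memLp_resolvent_mul (F : WeightedSpace μ c lam s) :
    MemLp (fun ξ => resolvent c lam ξ * F ξ) 2 (weightedMeasure μ c lam s) :=
  (Lp.memLp F).of_le_mul (c := lam⁻¹)
    ((h.aestronglyMeasurable_iff.2 (measurable_resolvent h.measurable).aestronglyMeasurable).mul
      (Lp.aestronglyMeasurable F))
    (Eventually.of_forall fun ξ => by
      rw [norm_mul]; gcongr; exact norm_resolvent_le h.pos ξ)

/-- The operator `(∂ + lam)⁻¹`. -/
def res : WeightedSpace μ c lam s →L[ℂ] WeightedSpace μ c lam s :=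
  LinearMap.mkContinuous
    { toFun := fun F => (h.memLp_resolvent_mul F).toLp _
      map_add' := fun F H => by
        rw [← MemLp.toLp_add]
        refine MemLp.toLp_congr _ _ ?_
        filter_upwards [Lp.coeFn_add F H] with ξ hξ
        simp only [hξ, Pi.add_apply, mul_add]
      map_smul' := fun a F => by
        rw [RingHom.id_apply, ← MemLp.toLp_const_smul]
        refine MemLp.toLp_congr _ _ ?_
        filter_upwards [Lp.coeFn_smul a F] with ξ hξ
        simp only [hξ, Pi.smul_apply, smul_eq_mul]
        ring }
    lam⁻¹ (fun F => by
      refine Lp.norm_le_mul_norm_of_ae_le_mul ?_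
      filter_upwards [(h.memLp_resolvent_mul F).coeFn_toLp] with ξ hξ
      simp only [LinearMap.coe_mk, AddHom.coe_mk]
      rw [hξ, norm_mul]
      gcongr
      exact norm_resolvent_le h.pos ξ)

theorem coeFn_res (F : WeightedSpace μ c lam s) :
    h.res F =ᵐ[μ] fun ξ => resolvent c lam ξ * F ξ :=
  h.coeFn_toLp (h.memLp_resolvent_mul F)

/-- The norm of `(∂ + lam)⁻¹ F` is the norm of `F` of regularity `s`. -/
theorem enorm_res_sq (F : WeightedSpace μ c lam s) :
    ‖h.res F‖ₑ ^ 2 = ∫⁻ ξ, weight c lam s ξ * ‖F ξ‖ₑ ^ 2 ∂μ := by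
  rw [h.enorm_sq]
  refine lintegral_congr_ae ?_
  filter_upwards [h.coeFn_res F] with ξ hξ
  rw [hξ, enorm_mul, mul_pow, enorm_resolvent_sq h.pos, ← mul_assoc, weight_mul h.pos]
  ring_nf

theorem hasDerivAt_ev_res (F : WeightedSpace μ c lam s) (x : ℝ) :
    HasDerivAt (fun y => h.ev y (h.res F)) (h.ev x F - lam * h.ev x (h.res F)) x := by
  have hint := h.integrable F
  have hrint := h.integrable (h.res F)
  have hfun : (fun y => h.ev y (h.res F)) =
      fun y => ∫ ξ, character c y ξ * (resolvent c lam ξ * F ξ) ∂μ := by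
    ext y
    refine integral_congr_ae ?_
    filter_upwards [h.coeFn_res F] with ξ hξ
    rw [hξ]
  have hrm : AEStronglyMeasurable (fun ξ => resolvent c lam ξ * F ξ) μ :=
    (measurable_resolvent h.measurable).aestronglyMeasurable.mul hint.aestronglyMeasurable
  have hri : Integrable (fun ξ => resolvent c lam ξ * F ξ) μ := hrint.congr (h.coeFn_res F)
  have hd := hasDerivAt_integral_of_dominated_loc_of_deriv_le (μ := μ) (x₀ := x) (s := univ)
    (F := fun y ξ => character c y ξ * (resolvent c lam ξ * F ξ))
    (F' := fun y ξ => character c y ξ * (F ξ - lam * (resolvent c lam ξ * F ξ)))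
    (bound := fun ξ => ‖F ξ - lam * (resolvent c lam ξ * F ξ)‖) univ_mem
    (Eventually.of_forall fun y => (h.integrable_character_mul hri y).aestronglyMeasurable)
    (h.integrable_character_mul hri x)
    (h.integrable_character_mul (hint.sub (hri.const_mul _)) x).aestronglyMeasurable
    (Eventually.of_forall fun ξ y _ => by simp) (hint.sub (hri.const_mul _)).norm
    (Eventually.of_forall fun ξ y _ => by
      have h1 : HasDerivAt (fun y : ℝ => character c y ξ)
          (character c y ξ * ((2 * Real.pi * c ξ : ℝ) * Complex.I)) y := by
        have h2 := (((hasDerivAt_id y).const_mul (2 * Real.pi * c ξ)).ofReal_comp.mul_const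
          Complex.I).cexp
        simpa [character] using h2
      have h3 := h1.mul_const (resolvent c lam ξ * F ξ)
      convert! h3 using 1
      have h4 := mul_inv_cancel₀ (resolvent_denom_ne_zero (c := c) h.pos ξ)
      rw [← resolvent] at h4
      linear_combination (-character c y ξ * F ξ) * h4)
  rw [hfun]
  convert! hd.2 using 1
  rw [h.ev_apply, h.ev_apply, synthesis, synthesis, ← integral_const_mul, ← integral_sub
    (h.integrable_character_mul hint x) ((h.integrable_character_mul hrint x).const_mul _)]
  refine integral_congr_ae ?_
  filter_upwards [h.coeFn_res F] with ξ hξ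
  rw [hξ]; ring

end Admissible

end WeightedSpace

end AKNS

end

/-! ### Multiplication, duality pairing and the resulting Fourier algebra. -/

noncomputable section

open MeasureTheory Filter Topology Set Asymptotics
open scoped ENNReal

set_option linter.unusedSectionVars false

namespace AKNS

section WeightedAlgebra

variable {G : Type*} [AddCommGroup G] [MeasurableSpace G] [MeasurableAdd₂ G] [MeasurableNeg G]
  {μ : Measure G} [SFinite μ] [μ.IsAddLeftInvariant] [μ.IsNegInvariant] {c : G →+ ℝ} {lam s : ℝ}

theorem ae_comp_sub {p : G → Prop} (hp : ∀ᵐ t ∂μ, p t) (ξ : G) : ∀ᵐ t ∂μ, p (ξ - t) :=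
  (Measure.measurePreserving_sub_left μ ξ).quasiMeasurePreserving.ae hp

theorem ae_comp_neg {p : G → Prop} (hp : ∀ᵐ t ∂μ, p t) : ∀ᵐ t ∂μ, p (-t) :=
  (Measure.measurePreserving_neg μ).quasiMeasurePreserving.ae hp

theorem enorm_conv_le (F H : G → ℂ) (ξ : G) :
    ‖conv μ F H ξ‖ₑ ≤ ∫⁻ t, ‖F t‖ₑ * ‖H (ξ - t)‖ₑ ∂μ := by
  refine (enorm_integral_le_lintegral_enorm _).trans (le_of_eq ?_)
  simp only [enorm_mul]

theorem aestronglyMeasurable_conv {F H : G → ℂ} (hF : AEStronglyMeasurable F μ)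
    (hH : AEStronglyMeasurable H μ) : AEStronglyMeasurable (conv μ F H) μ :=
  (hF.convolution_integrand (ContinuousLinearMap.mul ℂ ℂ) hH).integral_prod_right'

theorem conv_congr {F F' H H' : G → ℂ} (hF : F =ᵐ[μ] F') (hH : H =ᵐ[μ] H') :
    conv μ F H = conv μ F' H' := by
  ext ξ
  refine integral_congr_ae ?_
  filter_upwards [hF, ae_comp_sub hH ξ] with t h1 h2
  rw [h1, h2]

namespace Admissible

variable (h : Admissible μ c lam s)
include h

theorem integrable_mul_sub (F H : WeightedSpace μ c lam s) (ξ : G) :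
    Integrable (fun t => F t * H (ξ - t)) μ :=
  (h.memLp_two F).integrable_mul
    ((h.memLp_two H).comp_measurePreserving (Measure.measurePreserving_sub_left μ ξ))

theorem lintegral_conv_le (F H : WeightedSpace μ c lam s) :
    ∫⁻ ξ, weight c lam (1 + s) ξ * ‖conv μ F H ξ‖ₑ ^ 2 ∂μ ≤
      8 * (∫⁻ ξ, weight c lam (-1 - s) ξ ∂μ) * ‖F‖ₑ ^ 2 * ‖H‖ₑ ^ 2 := by
  rw [h.enorm_sq, h.enorm_sq]
  refine le_trans (lintegral_mono fun ξ => ?_) (lintegral_weight_convolution_le h.measurable h.pos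
    (by linarith [h.neg_half_le]) h.nonpos (h.aestronglyMeasurable F).enorm
    (h.aestronglyMeasurable H).enorm)
  gcongr
  exact enorm_conv_le _ _ _

theorem memLp_conv (F H : WeightedSpace μ c lam s) :
    MemLp (conv μ F H) 2 (weightedMeasure μ c lam s) :=
  h.memLp (aestronglyMeasurable_conv (h.aestronglyMeasurable F) (h.aestronglyMeasurable H))
    (ne_top_of_le_ne_top (ENNReal.mul_ne_top (ENNReal.mul_ne_top
      (ENNReal.mul_ne_top (by norm_num) h.lintegral_ne_top) (by finiteness)) (by finiteness))
      (h.lintegral_conv_le F H))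

/-- Multiplication of functions, as convolution of Fourier transforms. -/
def mul : WeightedSpace μ c lam s →L[ℂ] WeightedSpace μ c lam s →L[ℂ] WeightedSpace μ c lam s :=
  LinearMap.mkContinuous₂
    (LinearMap.mk₂ ℂ (fun F H => (h.memLp_conv F H).toLp _)
      (fun F F' H => by
        rw [← MemLp.toLp_add]
        refine MemLp.toLp_congr _ _ (Eventually.of_forall fun ξ => ?_)
        rw [conv_congr (h.coeFn_add F F') EventuallyEq.rfl, Pi.add_apply, conv, conv, conv,
          ← integral_add (h.integrable_mul_sub F H ξ) (h.integrable_mul_sub F' H ξ)]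
        simp only [add_mul])
      (fun a F H => by
        rw [← MemLp.toLp_const_smul]
        refine MemLp.toLp_congr _ _ (Eventually.of_forall fun ξ => ?_)
        rw [conv_congr (h.coeFn_smul a F) EventuallyEq.rfl, Pi.smul_apply, smul_eq_mul, conv, conv,
          ← integral_const_mul]
        simp only [mul_assoc])
      (fun F H H' => by
        rw [← MemLp.toLp_add]
        refine MemLp.toLp_congr _ _ (Eventually.of_forall fun ξ => ?_)
        rw [conv_congr EventuallyEq.rfl (h.coeFn_add H H'), Pi.add_apply, conv, conv, conv,
          ← integral_add (h.integrable_mul_sub F H ξ) (h.integrable_mul_sub F H' ξ)]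
        simp only [mul_add])
      (fun a F H => by
        rw [← MemLp.toLp_const_smul]
        refine MemLp.toLp_congr _ _ (Eventually.of_forall fun ξ => ?_)
        rw [conv_congr EventuallyEq.rfl (h.coeFn_smul a H), Pi.smul_apply, smul_eq_mul, conv, conv,
          ← integral_const_mul]
        simp only [mul_left_comm]))
    (Real.sqrt (8 * ∫⁻ ξ, weight c lam (-1 - s) ξ ∂μ).toReal)
    (fun F H => norm_le_of_enorm_sq_le
      (ENNReal.mul_ne_top (by norm_num) h.lintegral_ne_top)
      (by
        simp only [LinearMap.mk₂_apply]
        rw [h.enorm_toLp_sq]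
        exact h.lintegral_conv_le F H))

theorem coeFn_mul (F H : WeightedSpace μ c lam s) : h.mul F H =ᵐ[μ] conv μ F H :=
  h.coeFn_toLp (h.memLp_conv F H)

/-- The constant `8` of the algebra estimate is relaxed to `12`, so that it coincides with the
constant in `norm_res_mul_le`. -/
theorem norm_mul_le (F H : WeightedSpace μ c lam s) :
    ‖h.mul F H‖ ≤ Real.sqrt (12 * ∫⁻ ξ, weight c lam (-1 - s) ξ ∂μ).toReal * ‖F‖ * ‖H‖ := by
  refine norm_le_of_enorm_sq_le (ENNReal.mul_ne_top (by norm_num) h.lintegral_ne_top) ?_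
  have h1 : ‖h.mul F H‖ₑ ^ 2 = _ := h.enorm_toLp_sq (h.memLp_conv F H)
  rw [h1]
  refine (h.lintegral_conv_le F H).trans ?_
  gcongr
  norm_num

/-- By `enorm_res_sq`, composing with `res` measures regularity `s`; this is the action of
regularity `1 + s` on regularity `s`. -/
theorem norm_res_mul_le (F H : WeightedSpace μ c lam s) :
    ‖h.res (h.mul F H)‖ ≤
      Real.sqrt (12 * ∫⁻ ξ, weight c lam (-1 - s) ξ ∂μ).toReal * ‖h.res F‖ * ‖H‖ := by
  refine norm_le_of_enorm_sq_le (ENNReal.mul_ne_top (by norm_num) h.lintegral_ne_top) ?_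
  rw [h.enorm_res_sq, h.enorm_res_sq, h.enorm_sq]
  refine le_trans (lintegral_mono_ae ?_) (lintegral_weight_convolution_le_of_neg h.measurable h.pos
    h.neg_half_le h.nonpos (h.aestronglyMeasurable F).enorm (h.aestronglyMeasurable H).enorm)
  filter_upwards [h.coeFn_mul F H] with ξ hξ
  rw [hξ]
  gcongr
  exact enorm_conv_le _ _ _

/-- A character is multiplicative, so it distributes over the two factors of a convolution, and the
integral of a convolution of integrable functions is the product of the integrals. -/
theorem ev_mul (x : ℝ) (F H : WeightedSpace μ c lam s) :
    h.ev x (h.mul F H) = h.ev x F * h.ev x H := by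
  have h1 : ∀ ξ, character c x ξ * conv μ F H ξ =
      conv μ (fun ξ => character c x ξ * F ξ) (fun ξ => character c x ξ * H ξ) ξ := fun ξ => by
    rw [conv, conv, ← integral_const_mul]
    refine integral_congr_ae (Eventually.of_forall fun t => ?_)
    have := character_add (c := c) x t (ξ - t)
    rw [add_sub_cancel] at this
    simp only [this]
    ring
  have h2 := integral_convolution (μ := μ) (ν := μ) (ContinuousLinearMap.mul ℂ ℂ)
    (h.integrable_character_mul (h.integrable F) x) (h.integrable_character_mul (h.integrable H) x)
  rw [ContinuousLinearMap.mul_apply'] at h2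
  rw [h.ev_apply, h.ev_apply, h.ev_apply, synthesis, synthesis, synthesis, ← h2]
  refine integral_congr_ae ?_
  filter_upwards [h.coeFn_mul F H] with ξ hξ
  rw [hξ, h1]
  rfl

theorem integrable_neg_mul (F H : WeightedSpace μ c lam s) :
    Integrable (fun ξ => F (-ξ) * H ξ) μ :=
  ((h.memLp_two F).comp_measurePreserving (Measure.measurePreserving_neg μ)).integrable_mul
    (h.memLp_two H)

/-- Duality between regularities `s` and `-s`. Since `-s ≤ 1 + s`, passing from `-s` to `1 + s`
gains the factor `lam^(-1-2s)`. -/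
theorem norm_integral_neg_mul_le (F H : WeightedSpace μ c lam s) :
    ‖∫ ξ, F (-ξ) * H ξ ∂μ‖ ≤ lam ^ (-1 - 2 * s) * ‖h.res F‖ * ‖H‖ := by
  have h1 : ‖∫ ξ, F (-ξ) * H ξ ∂μ‖ₑ ≤ ∫⁻ ξ, ‖F (-ξ)‖ₑ * ‖H ξ‖ₑ ∂μ := by
    refine (enorm_integral_le_lintegral_enorm _).trans (le_of_eq ?_)
    simp only [enorm_mul]
  have hFm : AEStronglyMeasurable (fun ξ => F (-ξ)) μ :=
    (h.aestronglyMeasurable F).comp_measurePreserving (Measure.measurePreserving_neg μ)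
  have h2 := lintegral_mul_sq_le_of_weights (μ := μ) (w := weight c lam s) (v := weight c lam (-s))
    hFm.enorm (h.aestronglyMeasurable H).enorm (measurable_weight h.measurable _).aemeasurable
    (measurable_weight h.measurable _).aemeasurable (fun ξ => h.weight_mul_inv s ξ)
  have h3 : ∫⁻ ξ, weight c lam s ξ * ‖F (-ξ)‖ₑ ^ 2 ∂μ = ‖h.res F‖ₑ ^ 2 := by
    rw [h.enorm_res_sq, ← lintegral_neg_eq_self (fun ξ => weight c lam s ξ * ‖F ξ‖ₑ ^ 2)]
    simp only [weight_neg_arg]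
  have h4 : ∫⁻ ξ, weight c lam (-s) ξ * ‖H ξ‖ₑ ^ 2 ∂μ ≤
      ENNReal.ofReal (lam ^ (2 * (-1 - 2 * s))) * ‖H‖ₑ ^ 2 := by
    rw [h.enorm_sq, ← lintegral_const_mul' _ _ ENNReal.ofReal_ne_top]
    refine lintegral_mono fun ξ => ?_
    calc weight c lam (-s) ξ * ‖H ξ‖ₑ ^ 2
        = weight c lam (-1 - 2 * s) ξ * (weight c lam (1 + s) ξ * ‖H ξ‖ₑ ^ 2) := by
          rw [← mul_assoc, weight_mul h.pos]; ring_nf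
      _ ≤ _ := by
          gcongr
          exact weight_le_of_nonpos h.pos (by linarith [h.neg_half_le]) ξ
  have h5 : ‖∫ ξ, F (-ξ) * H ξ ∂μ‖ₑ ^ 2 ≤
      ENNReal.ofReal (lam ^ (2 * (-1 - 2 * s))) * ‖h.res F‖ₑ ^ 2 * ‖H‖ₑ ^ 2 := by
    calc _ ≤ _ := (pow_le_pow_left₀ zero_le h1 2).trans h2
      _ ≤ ‖h.res F‖ₑ ^ 2 * (ENNReal.ofReal (lam ^ (2 * (-1 - 2 * s))) * ‖H‖ₑ ^ 2) := by
          rw [h3]; gcongr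
      _ = _ := by ring
  have h6 := norm_le_of_enorm_sq_le ENNReal.ofReal_ne_top h5
  have hl := h.pos
  rwa [ENNReal.toReal_ofReal (by positivity), mul_comm 2, Real.rpow_mul hl.le, Real.rpow_two,
    Real.sqrt_sq (by positivity)] at h6

/-- The bilinear pairing `∫ F(-ξ) H(ξ)`. -/
def pair : WeightedSpace μ c lam s →L[ℂ] WeightedSpace μ c lam s →L[ℂ] ℂ :=
  LinearMap.mkContinuous₂
    (LinearMap.mk₂ ℂ (fun F H => ∫ ξ, F (-ξ) * H ξ ∂μ)
      (fun F F' H => by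
        rw [← integral_add (h.integrable_neg_mul F H) (h.integrable_neg_mul F' H)]
        refine integral_congr_ae ?_
        filter_upwards [ae_comp_neg (h.coeFn_add F F')] with ξ hξ
        rw [hξ, add_mul])
      (fun a F H => by
        rw [smul_eq_mul, ← integral_const_mul]
        refine integral_congr_ae ?_
        filter_upwards [ae_comp_neg (h.coeFn_smul a F)] with ξ hξ
        rw [hξ, mul_assoc])
      (fun F H H' => by
        rw [← integral_add (h.integrable_neg_mul F H) (h.integrable_neg_mul F H')]
        refine integral_congr_ae ?_
        filter_upwards [h.coeFn_add H H'] with ξ hξ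
        rw [hξ, mul_add])
      (fun a F H => by
        rw [smul_eq_mul, ← integral_const_mul]
        refine integral_congr_ae ?_
        filter_upwards [h.coeFn_smul a H] with ξ hξ
        rw [hξ, mul_left_comm]))
    (lam ^ (-1 - 2 * s) * ‖h.res‖)
    (fun F H => (h.norm_integral_neg_mul_le F H).trans (by
      have := h.pos
      rw [mul_assoc (lam ^ (-1 - 2 * s)) ‖h.res‖]
      gcongr
      exact h.res.le_opNorm F))

theorem pair_apply (F H : WeightedSpace μ c lam s) : h.pair F H = ∫ ξ, F (-ξ) * H ξ ∂μ := rfl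

end Admissible

variable (μ c) in
/-- The two facts about Fourier synthesis that the argument uses: Parseval's identity with respect
to a measure `ρ` on the line, and the vanishing of the `ρ`-integral of a derivative. -/
structure IsParseval (ρ : Measure ℝ) : Prop where
  parseval : ∀ F H : G → ℂ, Integrable F μ → Integrable H μ → Integrable (synthesis μ c F) ρ →
    ∫ ξ, F (-ξ) * H ξ ∂μ = ∫ x, synthesis μ c F x * synthesis μ c H x ∂ρ
  integral_deriv : ∀ (J : G → ℂ) (g : ℝ → ℂ), Integrable J μ → Continuous g →
    (∀ x, HasDerivAt (synthesis μ c J) (g x) x) → Integrable g ρ → ∫ x, g x ∂ρ = 0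

variable {ρ : Measure ℝ}

namespace Admissible

/-- The weighted space as an algebra of functions on the line. -/
def fourierAlgebra (h : Admissible μ c lam s) (hp : IsParseval μ c ρ) :
    FourierAlgebra lam ρ (WeightedSpace μ c lam s) where
  ev := h.ev
  mul := h.mul
  res := h.res
  pair := h.pair
  ev_mul := h.ev_mul
  continuous_ev F := h.continuous_synthesis (h.integrable F)
  norm_ev_le F := ⟨_, h.norm_synthesis_le F⟩
  ev_injective F hF := by
    have hzero : synthesis μ c F = fun _ => 0 := funext hF
    -- Parseval tested against the transform of the complex conjugate function gives `∫ |F|² = 0`.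
    have hconj : Integrable (fun ξ => (starRingEnd ℂ) (F (-ξ))) μ :=
      (Complex.conjLIE.integrable_comp_iff.2 ((Measure.measurePreserving_neg
        μ).integrable_comp_of_integrable (h.integrable F)))
    have h1 := hp.parseval F _ (h.integrable F) hconj (by rw [hzero]; exact integrable_zero _ _ _)
    rw [hzero] at h1
    simp only [zero_mul, integral_zero, Complex.mul_conj, Complex.normSq_eq_norm_sq] at h1
    rw [integral_neg_eq_self (fun ξ => ((‖F ξ‖ ^ 2 : ℝ) : ℂ)) μ, integral_complex_ofReal,
      Complex.ofReal_eq_zero, integral_eq_zero_iff_of_nonneg (fun ξ => by positivity)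
      ((memLp_two_iff_integrable_sq_norm (h.aestronglyMeasurable F)).1 (h.memLp_two F))] at h1
    rw [Lp.eq_zero_iff_ae_eq_zero]
    refine h.ae_iff.2 ?_
    filter_upwards [h1] with ξ hξ
    simpa using hξ
  hasDerivAt_res := h.hasDerivAt_ev_res
  pair_add_pair_eq_zero F₁ W₁ F₂ W₂ J h₁ h₂ hJ := by
    have bdd : ∀ F W : WeightedSpace μ c lam s, Integrable (fun x => h.ev x F) ρ →
        Integrable (fun x => h.ev x F * h.ev x W) ρ := fun F W hF =>
      hF.mul_bdd (c := _) (h.continuous_synthesis (h.integrable W)).aestronglyMeasurable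
        (Eventually.of_forall (h.norm_synthesis_le W))
    have cont : ∀ F : WeightedSpace μ c lam s, Continuous fun x => h.ev x F := fun F =>
      h.continuous_synthesis (h.integrable F)
    rw [h.pair_apply, h.pair_apply, hp.parseval _ _ (h.integrable F₁) (h.integrable W₁) h₁,
      hp.parseval _ _ (h.integrable F₂) (h.integrable W₂) h₂]
    simp only [← h.ev_apply]
    rw [← integral_add (bdd F₁ W₁ h₁) (bdd F₂ W₂ h₂)]
    exact hp.integral_deriv J _ (h.integrable J)
      (((cont F₁).mul (cont W₁)).add ((cont F₂).mul (cont W₂))) hJ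
      ((bdd F₁ W₁ h₁).add (bdd F₂ W₂ h₂))

end Admissible

end WeightedAlgebra

end AKNS

end

/-! ### Complex conjugation, and solutions as curves in the weighted space. -/

noncomputable section

open MeasureTheory Filter Topology Set Asymptotics
open scoped ENNReal ComplexConjugate

set_option linter.unusedSectionVars false

namespace AKNS

section Conservation

variable {G : Type*} [AddCommGroup G] [MeasurableSpace G] [MeasurableAdd₂ G] [MeasurableNeg G]
  {μ : Measure G} [SFinite μ] [μ.IsAddLeftInvariant] [μ.IsNegInvariant] {c : G →+ ℝ} {lam s : ℝ}

namespace Admissible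

section Conj

variable (h : Admissible μ c lam s)
include h

theorem memLp_conj (F : WeightedSpace μ c lam s) :
    MemLp (fun ξ => conj (F (-ξ))) 2 (weightedMeasure μ c lam s) := by
  refine h.memLp ?_ ?_
  · exact Complex.continuous_conj.comp_aestronglyMeasurable
      ((h.aestronglyMeasurable F).comp_measurePreserving (Measure.measurePreserving_neg μ))
  · simp only [RCLike.enorm_conj]
    rw [← lintegral_neg_eq_self]
    simp only [neg_neg, weight_neg_arg]
    rw [← h.enorm_sq]
    finiteness

/-- Complex conjugation of functions, acting on Fourier transforms. -/
def conjugate (F : WeightedSpace μ c lam s) : WeightedSpace μ c lam s :=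
  (h.memLp_conj F).toLp _

theorem coeFn_conjugate (F : WeightedSpace μ c lam s) :
    h.conjugate F =ᵐ[μ] fun ξ => conj (F (-ξ)) := h.coeFn_toLp (h.memLp_conj F)

theorem ev_conjugate (x : ℝ) (F : WeightedSpace μ c lam s) :
    h.ev x (h.conjugate F) = conj (h.ev x F) := by
  rw [h.ev_apply, h.ev_apply, synthesis, synthesis, ← integral_conj,
    ← integral_neg_eq_self (fun ξ => conj (character c x ξ * F ξ))]
  refine integral_congr_ae ?_
  filter_upwards [h.coeFn_conjugate F] with ξ hξ
  rw [hξ, map_mul]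
  congr 1
  simp only [character, map_neg, ← Complex.exp_conj, map_mul, Complex.conj_I, Complex.conj_ofReal]
  congr 1
  push_cast; ring

theorem norm_conjugate_sub (F H : WeightedSpace μ c lam s) :
    ‖h.conjugate F - h.conjugate H‖ = ‖F - H‖ := by
  have h1 : ‖h.conjugate F - h.conjugate H‖ₑ ^ 2 = ‖F - H‖ₑ ^ 2 := by
    rw [h.enorm_sq, h.enorm_sq,
      ← lintegral_neg_eq_self (fun ξ => weight c lam (1 + s) ξ * ‖(F - H) ξ‖ₑ ^ 2)]
    refine lintegral_congr_ae ?_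
    filter_upwards [h.coeFn_conjugate F, h.coeFn_conjugate H, h.ae_iff.1 (Lp.coeFn_sub (h.conjugate F)
      (h.conjugate H)), ae_comp_neg (h.ae_iff.1 (Lp.coeFn_sub F H))] with ξ h1 h2 h3 h4
    rw [h3, h4, Pi.sub_apply, Pi.sub_apply, h1, h2, ← map_sub, RCLike.enorm_conj, weight_neg_arg]
  have h2 := congrArg ENNReal.toReal h1
  simp only [ENNReal.toReal_pow, toReal_enorm] at h2
  exact (sq_eq_sq₀ (norm_nonneg _) (norm_nonneg _)).1 h2

theorem continuous_conjugate : Continuous h.conjugate :=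
  (Isometry.of_dist_eq fun F H => by rw [dist_eq_norm, dist_eq_norm, h.norm_conjugate_sub]).continuous

theorem norm_res_conjugate (F : WeightedSpace μ c lam s) :
    ‖h.res (h.conjugate F)‖ = ‖h.res F‖ := by
  have h1 : ‖h.res (h.conjugate F)‖ₑ ^ 2 = ‖h.res F‖ₑ ^ 2 := by
    rw [h.enorm_res_sq, h.enorm_res_sq,
      ← lintegral_neg_eq_self (fun ξ => weight c lam s ξ * ‖F ξ‖ₑ ^ 2)]
    refine lintegral_congr_ae ?_
    filter_upwards [h.coeFn_conjugate F] with ξ h1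
    rw [h1, RCLike.enorm_conj, weight_neg_arg]
  have h2 := congrArg ENNReal.toReal h1
  simp only [ENNReal.toReal_pow, toReal_enorm] at h2
  exact (sq_eq_sq₀ (norm_nonneg _) (norm_nonneg _)).1 h2

/-- The leading term of the conserved quantity. -/
theorem re_pair_conjugate_res (F : WeightedSpace μ c lam s) :
    ENNReal.ofReal (h.pair (h.conjugate F) (h.res F)).re =
      ∫⁻ ξ, ENNReal.ofReal lam * weight c lam (-1) ξ * ‖F ξ‖ₑ ^ 2 ∂μ ∧
    0 ≤ (h.pair (h.conjugate F) (h.res F)).re := by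
  have hl := h.pos
  have hae : ∀ᵐ ξ ∂μ, RCLike.re (h.conjugate F (-ξ) * h.res F ξ) =
      lam * (sqWeight c lam ξ)⁻¹ * ‖F ξ‖ ^ 2 := by
    filter_upwards [ae_comp_neg (h.coeFn_conjugate F), h.coeFn_res F] with ξ h1 h2
    rw [h1, h2, neg_neg]
    have h3 : conj (F ξ) * (resolvent c lam ξ * F ξ) =
        ((‖F ξ‖ ^ 2 : ℝ) : ℂ) * resolvent c lam ξ := by
      rw [← Complex.normSq_eq_norm_sq, Complex.normSq_eq_conj_mul_self]; ring
    rw [h3, RCLike.re_eq_complex_re, Complex.re_ofReal_mul, resolvent, Complex.inv_re,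
      Complex.normSq_add_mul_I, sqWeight]
    simp
    ring
  have hre : (h.pair (h.conjugate F) (h.res F)).re =
      ∫ ξ, lam * (sqWeight c lam ξ)⁻¹ * ‖F ξ‖ ^ 2 ∂μ := by
    rw [h.pair_apply, ← RCLike.re_eq_complex_re, ← integral_re (h.integrable_neg_mul _ _)]
    exact integral_congr_ae hae
  have hint : Integrable (fun ξ => lam * (sqWeight c lam ξ)⁻¹ * ‖F ξ‖ ^ 2) μ :=
    (h.integrable_neg_mul (h.conjugate F) (h.res F)).re.congr hae
  have hnn : ∀ ξ, 0 ≤ lam * (sqWeight c lam ξ)⁻¹ * ‖F ξ‖ ^ 2 := fun ξ => by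
    have := sqWeight_pos (c := c) hl ξ
    positivity
  rw [hre]
  refine ⟨?_, integral_nonneg hnn⟩
  rw [ofReal_integral_eq_lintegral_ofReal hint (Eventually.of_forall hnn)]
  refine lintegral_congr fun ξ => ?_
  have := sqWeight_pos (c := c) hl ξ
  rw [ENNReal.ofReal_mul (by positivity), ENNReal.ofReal_mul hl.le, weight, Real.rpow_neg_one,
    ENNReal.ofReal_pow (norm_nonneg _), ofReal_norm]

end Conj

end Admissible

variable (μ c s) in
/-- Fourier transforms `F j t` of the spatial derivatives of a smooth curve `q`, depending
continuously on time. -/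
structure IsFourierCurve (ρ : Measure ℝ) (q : ℝ → ℝ → ℂ) (F : ℕ → ℝ → G → ℂ) : Prop where
  memLp : ∀ lam, 0 < lam → ∀ j t, MemLp (F j t) 2 (weightedMeasure μ c lam s)
  continuous : ∀ lam (hl : 0 < lam) j, Continuous fun t => (memLp lam hl j t).toLp (F j t)
  synthesis_eq : ∀ j t x, synthesis μ c (F j t) x = iteratedDeriv j (q t) x
  contDiff : ∀ t, ContDiff ℝ ∞ (q t)
  integrable : ∀ j t, Integrable (iteratedDeriv j (q t)) ρ

/-- `q` solves mKdV, written for complex-valued `q` with real values. -/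
def SolvesMKdVComplex (σ : ℝ) (q : ℝ → ℝ → ℂ) : Prop :=
  (∀ t x, conj (q t x) = q t x) ∧ ∀ t x : ℝ, HasDerivAt (fun τ => q τ x)
    (-iteratedDeriv 3 (q t) x + 6 * σ * q t x ^ 2 * iteratedDeriv 1 (q t) x) t

variable {ρ : Measure ℝ} {q : ℝ → ℝ → ℂ} {F : ℕ → ℝ → G → ℂ} {σ : ℝ}

theorem conj_iteratedDeriv {f : ℝ → ℂ} (hf : ContDiff ℝ ∞ f) (j : ℕ) (x : ℝ) :
    iteratedDeriv j (fun y => conj (f y)) x = conj (iteratedDeriv j f x) := by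
  induction j generalizing x with
  | zero => simp
  | succ j ih =>
    rw [iteratedDeriv_succ, iteratedDeriv_succ, funext ih]
    have hd : HasDerivAt (iteratedDeriv j f) (deriv (iteratedDeriv j f) x) x :=
      (hf.differentiable_iteratedDeriv j (by exact_mod_cast WithTop.coe_lt_top _) x).hasDerivAt
    exact (Complex.conjCLE.toContinuousLinearMap.hasFDerivAt.comp_hasDerivAt x hd).deriv

theorem hasDerivAt_iteratedDeriv {f : ℝ → ℂ} (hf : ContDiff ℝ ∞ f) (j : ℕ) (x : ℝ) :
    HasDerivAt (iteratedDeriv j f) (iteratedDeriv (j + 1) f x) x := by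
  rw [iteratedDeriv_succ]
  exact (hf.differentiable_iteratedDeriv j (by exact_mod_cast WithTop.coe_lt_top _) x).hasDerivAt

namespace IsFourierCurve

variable (hF : IsFourierCurve μ c s ρ q F) (h : Admissible μ c lam s) (hp : IsParseval μ c ρ)
include hF h

/-- The curve in the weighted space. -/
def lift (j : ℕ) (t : ℝ) : WeightedSpace μ c lam s := (hF.memLp lam h.pos j t).toLp (F j t)

theorem ev_lift (j : ℕ) (t x : ℝ) : h.ev x (hF.lift h j t) = iteratedDeriv j (q t) x := by
  rw [← hF.synthesis_eq, h.ev_apply, synthesis, synthesis]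
  refine integral_congr_ae ?_
  filter_upwards [h.coeFn_toLp (hF.memLp lam h.pos j t)] with ξ hξ
  rw [lift, hξ]

theorem ev_conj_lift (j : ℕ) (t x : ℝ) :
    h.ev x ((σ : ℂ) • h.conjugate (hF.lift h j t)) = σ * conj (iteratedDeriv j (q t) x) := by
  rw [map_smul, h.ev_conjugate, hF.ev_lift h, smul_eq_mul]

theorem isJet : (h.fourierAlgebra hp).IsJet (hF.lift h) where
  continuous := hF.continuous lam h.pos
  hasDerivAt j t x := by
    change HasDerivAt (fun y => h.ev y (hF.lift h j t)) (h.ev x (hF.lift h (j + 1) t)) x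
    simp only [hF.ev_lift h]
    exact hasDerivAt_iteratedDeriv (hF.contDiff t) j x
  integrable j t := by
    change Integrable (fun x => h.ev x (hF.lift h j t)) ρ
    simp only [hF.ev_lift h]
    exact hF.integrable j t

theorem isJet_conj : (h.fourierAlgebra hp).IsJet
    (fun j t => (σ : ℂ) • h.conjugate (hF.lift h j t)) where
  continuous j := (h.continuous_conjugate.comp (hF.continuous lam h.pos j)).const_smul (σ : ℂ)
  hasDerivAt j t x := by
    change HasDerivAt (fun y => h.ev y _) (h.ev x _) x
    simp only [hF.ev_conj_lift h]
    have := hasDerivAt_iteratedDeriv (hF.contDiff t) j x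
    exact (Complex.conjCLE.toContinuousLinearMap.hasFDerivAt.comp_hasDerivAt x this).const_mul _
  integrable j t := by
    change Integrable (fun x => h.ev x _) ρ
    simp only [hF.ev_conj_lift h]
    exact (Complex.conjLIE.integrable_comp_iff.2 (hF.integrable j t)).const_mul _

/-- With `p = σ q̄` one has `q² p = σ|q|² q`, and the equation for `p` is `σ` times the conjugate of
the one for `q`. No restriction on `σ` is needed yet. -/
theorem solvesNLSPair (hq : SolvesNLS σ q) : (h.fourierAlgebra hp).SolvesNLSPair (hF.lift h)
    (fun j t => (σ : ℂ) • h.conjugate (hF.lift h j t)) := by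
  intro x t
  have h1 := hq t x
  have h2 : ((‖q t x‖ ^ 2 : ℝ) : ℂ) = q t x * conj (q t x) := by
    rw [Complex.mul_conj, Complex.normSq_eq_norm_sq]
  have h3 := (Complex.conjCLE.toContinuousLinearMap.hasFDerivAt.comp_hasDerivAt t h1).const_mul (σ : ℂ)
  constructor
  · change HasDerivAt (fun τ => h.ev x _) (_ * h.ev x _ + _ * (h.ev x _ ^ 2 * h.ev x _)) t
    simp only [hF.ev_lift h, hF.ev_conj_lift h, iteratedDeriv_zero]
    convert! h1 using 1
    rw [h2]; ring
  · change HasDerivAt (fun τ => h.ev x _) (_ * h.ev x _ - _ * (h.ev x _ ^ 2 * h.ev x _)) t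
    simp only [hF.ev_lift h, hF.ev_conj_lift h, iteratedDeriv_zero]
    convert! h3 using 1
    have h4 : conj (2 : ℂ) = 2 := map_ofNat _ 2
    rw [h2]
    simp [h4]
    ring

/-- For real `q` conjugation acts trivially on all spatial derivatives, so `p = σ q` and the second
equation is a multiple of the first. -/
theorem solvesMKdVPair (hq : SolvesMKdVComplex σ q) : (h.fourierAlgebra hp).SolvesMKdVPair (hF.lift h)
    (fun j t => (σ : ℂ) • h.conjugate (hF.lift h j t)) := by
  intro x t
  have hreal : ∀ j x, conj (iteratedDeriv j (q t) x) = iteratedDeriv j (q t) x := by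
    intro j x
    rw [← conj_iteratedDeriv (hF.contDiff t)]
    congr 1
    exact funext fun y => hq.1 t y
  have h1 := hq.2 t x
  constructor
  · change HasDerivAt (fun τ => h.ev x _) (-h.ev x _ + 6 * (h.ev x _ * h.ev x _ * h.ev x _)) t
    simp only [hF.ev_lift h, hF.ev_conj_lift h, iteratedDeriv_zero, hq.1]
    convert! h1 using 1
    ring
  · change HasDerivAt (fun τ => h.ev x _) (-h.ev x _ + 6 * (h.ev x _ * h.ev x _ * h.ev x _)) t
    simp only [hF.ev_lift h, hF.ev_conj_lift h, iteratedDeriv_zero, hq.1, hreal]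
    convert! h1.const_mul (σ : ℂ) using 1
    ring

end IsFourierCurve

end Conservation

end AKNS

end

/-! ### Almost conservation at one frequency scale. -/

noncomputable section

open MeasureTheory Filter Topology Set Asymptotics
open scoped ENNReal ComplexConjugate

set_option linter.unusedSectionVars false

namespace AKNS

section AlmostConservation

variable {G : Type*} [AddCommGroup G] [MeasurableSpace G] [MeasurableAdd₂ G] [MeasurableNeg G]
  {μ : Measure G} [SFinite μ] [μ.IsAddLeftInvariant] [μ.IsNegInvariant] {c : G →+ ℝ} {lam s : ℝ}
  {ρ : Measure ℝ} {q : ℝ → ℝ → ℂ} {F : ℕ → ℝ → G → ℂ} {σ : ℝ}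

/-- `U V` is formed in the algebra of regularity `1 + s` and then acts on `P`, which is measured
only in regularity `s`. Each product contributes the square root of the same constant. -/
theorem norm_tri_le_of_admissible (h : Admissible μ c lam s) (hp : IsParseval μ c ρ)
    (P U V : WeightedSpace μ c lam s) :
    ‖(h.fourierAlgebra hp).tri P U V‖ ≤
      ((12 * ∫⁻ ξ, weight c lam (-1 - s) ξ ∂μ).toReal * ‖h.res P‖) * ‖U‖ * ‖V‖ := by
  set D := (12 * ∫⁻ ξ, weight c lam (-1 - s) ξ ∂μ).toReal
  have hD : 0 ≤ D := ENNReal.toReal_nonneg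
  calc ‖h.res (h.mul P (h.mul U V))‖ ≤ Real.sqrt D * ‖h.res P‖ * ‖h.mul U V‖ := h.norm_res_mul_le _ _
    _ ≤ Real.sqrt D * ‖h.res P‖ * (Real.sqrt D * ‖U‖ * ‖V‖) := by
        gcongr; exact h.norm_mul_le U V
    _ = (Real.sqrt D * Real.sqrt D * ‖h.res P‖) * ‖U‖ * ‖V‖ := by ring
    _ = _ := by rw [Real.mul_self_sqrt hD]

/-- This is the quartic remainder of the conserved quantity; the factor `4` comes from `‖W‖ ≤ 2m`
used twice. -/
theorem norm_pair_tri_le (h : Admissible μ c lam s) (hp : IsParseval μ c ρ)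
    {P W : WeightedSpace μ c lam s} {m : ℝ} (hP : ‖h.res P‖ = m) (hW : ‖W‖ ≤ 2 * m) :
    ‖h.pair P ((h.fourierAlgebra hp).tri P W W)‖ ≤
      4 * (12 * ∫⁻ ξ, weight c lam (-1 - s) ξ ∂μ).toReal * lam ^ (-1 - 2 * s) * m ^ 4 := by
  have hl := h.pos
  set D := (12 * ∫⁻ ξ, weight c lam (-1 - s) ξ ∂μ).toReal
  have hD : 0 ≤ D := ENNReal.toReal_nonneg
  have hm : 0 ≤ m := hP ▸ norm_nonneg _
  calc _ ≤ lam ^ (-1 - 2 * s) * ‖h.res P‖ * ‖(h.fourierAlgebra hp).tri P W W‖ :=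
        h.norm_integral_neg_mul_le _ _
    _ ≤ lam ^ (-1 - 2 * s) * m * ((D * m) * (2 * m) * (2 * m)) := by
        rw [hP]
        gcongr
        refine (norm_tri_le_of_admissible h hp P W W).trans ?_
        rw [hP]
        gcongr
    _ = _ := by ring

/-- As long as the solution is small at the frequency scale `lam`, the leading term of the conserved
quantity is conserved up to a quartic error. -/
theorem IsFourierCurve.re_pair_le (hF : IsFourierCurve μ c s ρ q F) (h : Admissible μ c lam s)
    (hp : IsParseval μ c ρ) (hσ : σ = 1 ∨ σ = -1) (hq : SolvesNLS σ q ∨ SolvesMKdVComplex σ q) {T : ℝ}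
    (hsmall : ∀ t ∈ uIcc 0 T, (12 * ∫⁻ ξ, weight c lam (-1 - s) ξ ∂μ).toReal *
      ‖h.res (hF.lift h 0 t)‖ ^ 2 < 1 / 16) :
    (h.pair (h.conjugate (hF.lift h 0 T)) (h.res (hF.lift h 0 T))).re ≤
      (h.pair (h.conjugate (hF.lift h 0 0)) (h.res (hF.lift h 0 0))).re +
      4 * (12 * ∫⁻ ξ, weight c lam (-1 - s) ξ ∂μ).toReal * lam ^ (-1 - 2 * s) *
        (‖h.res (hF.lift h 0 T)‖ ^ 4 + ‖h.res (hF.lift h 0 0)‖ ^ 4) := by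
  set D := (12 * ∫⁻ ξ, weight c lam (-1 - s) ξ ∂μ).toReal with hDdef
  have hD : 0 ≤ D := ENNReal.toReal_nonneg
  have hσσ : (σ : ℂ) * σ = 1 := by rcases hσ with rfl | rfl <;> norm_num
  have hσn : ‖(σ : ℂ)‖ = 1 := by rcases hσ with rfl | rfl <;> simp
  let A := h.fourierAlgebra hp
  let Q : ℝ → WeightedSpace μ c lam s := hF.lift h 0
  let P : ℕ → ℝ → WeightedSpace μ c lam s := fun j t => (σ : ℂ) • h.conjugate (hF.lift h j t)
  have hresP : ∀ t, ‖h.res (P 0 t)‖ = ‖h.res (Q t)‖ := fun t => by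
    simp only [P, Q, map_smul, norm_smul, hσn, one_mul, h.norm_res_conjugate]
  let U : Set ℝ := {t | D * ‖h.res (Q t)‖ ^ 2 < 1 / 16}
  have hcont : Continuous fun t => ‖h.res (Q t)‖ :=
    (h.res.continuous.comp (hF.continuous lam h.pos 0)).norm
  have hUo : IsOpen U := isOpen_lt (by fun_prop) continuous_const
  -- Outside `U` the value of `W` is irrelevant. Inside `U` it is an arbitrary choice at each time;
  -- its differentiability follows later from smallness.
  have hex : ∀ t, ∃ W, t ∈ U → ‖W‖ ≤ 2 * ‖h.res (Q t)‖ ∧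
      W = A.res (Q t) - A.tri (P 0 t) W W := by
    intro t
    by_cases ht : t ∈ U
    · obtain ⟨W, hW⟩ := exists_quadratic_fixedPoint (h.res (Q t)) (A.tri (P 0 t))
        (K := D * ‖h.res (P 0 t)‖) (by positivity) (norm_tri_le_of_admissible h hp (P 0 t)) (by
          have h1 : D * ‖h.res (Q t)‖ ^ 2 < 1 / 16 := ht
          rw [hresP]; nlinarith)
      exact ⟨W, fun _ => hW⟩
    · exact ⟨0, fun h => absurd h ht⟩
  choose W hW using hex
  have hder : ∀ t ∈ U, HasDerivAt (fun t => A.pair (P 0 t) (W t)) 0 t := by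
    intro t ht
    have ht' : D * ‖h.res (Q t)‖ ^ 2 < 1 / 16 := ht
    have hUn : ∀ᶠ τ in 𝓝 t, τ ∈ U := hUo.mem_nhds ht
    -- The radius must exceed `2‖res Q‖` strictly to remain valid for nearby times. Taking `4‖res
    -- Q‖` requires `4D‖res Q‖² ≤ 1/4`, the origin of the threshold `1/16`; if the norm vanishes,
    -- any radius will do.
    obtain ⟨r, hr1, hr2⟩ : ∃ r, 2 * ‖h.res (Q t)‖ < r ∧ D * ‖h.res (P 0 t)‖ * r ≤ 1 / 4 := by
      rw [hresP]
      rcases (norm_nonneg (h.res (Q t))).eq_or_lt with h0 | h0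
      · exact ⟨1, by rw [← h0]; norm_num, by rw [← h0]; norm_num⟩
      · exact ⟨4 * ‖h.res (Q t)‖, by linarith, by nlinarith⟩
    have hWr : ∀ᶠ τ in 𝓝 t, ‖W τ‖ ≤ r := by
      have h1 : ∀ᶠ τ in 𝓝 t, 2 * ‖h.res (Q τ)‖ < r :=
        (continuous_const.mul hcont).continuousAt.eventually (gt_mem_nhds hr1)
      filter_upwards [h1, hUn] with τ h2 h3
      exact (hW τ h3).1.trans h2.le
    have hWeq : ∀ᶠ τ in 𝓝 t, W τ = A.res (Q τ) - A.tri (P 0 τ) (W τ) (W τ) := by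
      filter_upwards [hUn] with τ h3 using (hW τ h3).2
    rcases hq with hq | hq
    · exact A.hasDerivAt_pair_zero_of_NLS h.pos (by positivity) (hF.isJet h hp) (hF.isJet_conj h hp)
        (hF.solvesNLSPair h hp hq) (norm_tri_le_of_admissible h hp (P 0 t)) hr2 hWeq hWr
    · exact A.hasDerivAt_pair_zero_of_mKdV h.pos (by positivity) (hF.isJet h hp) (hF.isJet_conj h hp)
        (hF.solvesMKdVPair h hp hq) (norm_tri_le_of_admissible h hp (P 0 t)) hr2 hWeq hWr
  have hcst : A.pair (P 0 T) (W T) = A.pair (P 0 0) (W 0) := by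
    have h1 := (convex_uIcc (0 : ℝ) T).norm_image_sub_le_of_norm_hasDerivWithin_le (C := 0)
      (f := fun t => A.pair (P 0 t) (W t)) (f' := fun _ => 0)
      (fun t ht => (hder t (hsmall t ht)).hasDerivWithinAt) (fun t _ => by simp)
      left_mem_uIcc right_mem_uIcc
    rw [zero_mul, norm_le_zero_iff, sub_eq_zero] at h1
    exact h1
  -- Pairing `P` with the fixed-point equation separates the quadratic part from the quartic one,
  -- and `σ² = 1` removes the sign.
  have hlead : ∀ t ∈ U, h.pair (h.conjugate (Q t)) (h.res (Q t)) =
      σ * A.pair (P 0 t) (W t) + σ * h.pair (P 0 t) (A.tri (P 0 t) (W t) (W t)) := by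
    intro t ht
    have h1 : h.pair (P 0 t) (h.res (Q t)) = h.pair (P 0 t) (W t) +
        h.pair (P 0 t) (A.tri (P 0 t) (W t) (W t)) := by
      rw [← map_add]
      congr 1
      exact (sub_eq_iff_eq_add.1 (hW t ht).2.symm)
    have h2 : h.pair (P 0 t) (h.res (Q t)) = σ * h.pair (h.conjugate (Q t)) (h.res (Q t)) := by
      simp only [P, map_smul, smul_apply, smul_eq_mul]
      rfl
    change _ = σ * h.pair (P 0 t) (W t) + _
    rw [← mul_add, ← h1, h2, ← mul_assoc, hσσ, one_mul]
  have herr : ∀ t ∈ U, ‖(σ : ℂ) * h.pair (P 0 t) (A.tri (P 0 t) (W t) (W t))‖ ≤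
      4 * D * lam ^ (-1 - 2 * s) * ‖h.res (Q t)‖ ^ 4 := by
    intro t ht
    rw [norm_mul, hσn, one_mul]
    exact norm_pair_tri_le h hp (hresP t) (hW t ht).1
  have hT := hsmall T right_mem_uIcc
  have h0 := hsmall 0 left_mem_uIcc
  have e1 := congrArg Complex.re (hlead T hT)
  have e2 := congrArg Complex.re (hlead 0 h0)
  rw [Complex.add_re] at e1 e2
  rw [hcst] at e1
  have b1 := (Complex.re_le_norm _).trans (herr T hT)
  have b2 := ((neg_le_abs _).trans (Complex.abs_re_le_norm _)).trans (herr 0 h0)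
  change (h.pair (h.conjugate (Q T)) (h.res (Q T))).re ≤
    (h.pair (h.conjugate (Q 0)) (h.res (Q 0))).re + 4 * D * lam ^ (-1 - 2 * s) *
      (‖h.res (Q T)‖ ^ 4 + ‖h.res (Q 0)‖ ^ 4)
  rw [mul_add]
  linarith

end AlmostConservation

end AKNS

end

/-! ### Superposition of scales and a continuity argument. -/

noncomputable section

open MeasureTheory Filter Topology Set Asymptotics
open scoped ENNReal ComplexConjugate

set_option linter.unusedSectionVars false

namespace AKNS

theorem lintegral_Ioi_rpow {a b : ℝ} (ha : a < -1) (hb : 0 < b) :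
    ∫⁻ x in Ioi b, ENNReal.ofReal (x ^ a) = ENNReal.ofReal (b ^ (a + 1) / (-(a + 1))) := by
  rw [← ofReal_integral_eq_lintegral_ofReal (integrableOn_Ioi_rpow_of_lt ha hb)
    ((ae_restrict_mem measurableSet_Ioi).mono fun x hx =>
      Real.rpow_nonneg (hb.le.trans (le_of_lt hx)) a), integral_Ioi_rpow_of_lt ha hb, div_neg, neg_div]

theorem lintegral_Ioc_rpow {a b : ℝ} (ha : -1 < a) (hb : 0 ≤ b) :
    ∫⁻ x in Ioc 0 b, ENNReal.ofReal (x ^ a) = ENNReal.ofReal (b ^ (a + 1) / (a + 1)) := by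
  rw [← ofReal_integral_eq_lintegral_ofReal
    ((intervalIntegrable_iff_integrableOn_Ioc_of_le hb).1 (intervalIntegral.intervalIntegrable_rpow' ha))
    ((ae_restrict_mem measurableSet_Ioc).mono fun x hx => Real.rpow_nonneg hx.1.le a),
    ← intervalIntegral.integral_of_le hb, integral_rpow (Or.inl ha),
    Real.zero_rpow (by linarith), sub_zero]

theorem sqrt_rpow_two_mul {x : ℝ} (hx : 0 ≤ x) (s : ℝ) : Real.sqrt x ^ (2 * s) = x ^ s := by
  rw [Real.rpow_mul (Real.sqrt_nonneg x), Real.rpow_two, Real.sq_sqrt hx]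

/-- Superposing the weights `lam / (lam² + y²)` produces the weight `(lam₀² + y²)^s`: lower bound. -/
theorem le_lintegral_kernel {s : ℝ} (hs : s < 0) {lam₀ : ℝ} (h0 : 0 < lam₀) (y : ℝ) :
    ENNReal.ofReal (1 / (4 * -s)) * ENNReal.ofReal ((lam₀ ^ 2 + y ^ 2) ^ s) ≤
      ∫⁻ lam in Ioi lam₀, ENNReal.ofReal (lam ^ (2 * s)) *
        (ENNReal.ofReal lam * ENNReal.ofReal ((lam ^ 2 + y ^ 2) ^ (-1 : ℝ))) := by
  set L := Real.sqrt (lam₀ ^ 2 + y ^ 2) with hL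
  have hL0 : lam₀ ≤ L := Real.le_sqrt_of_sq_le (le_add_of_nonneg_right (sq_nonneg y))
  have hLp : 0 < L := h0.trans_le hL0
  have hs0 : 0 < -s := by linarith
  -- Only `lam > L` is kept; there `lam² + y² ≤ 2 lam²`, so the integrand is at least half of
  -- `lam^(2s-1)`.
  calc ENNReal.ofReal (1 / (4 * -s)) * ENNReal.ofReal ((lam₀ ^ 2 + y ^ 2) ^ s)
      = ENNReal.ofReal (1 / 2) * ∫⁻ x in Ioi L, ENNReal.ofReal (x ^ (2 * s - 1)) := by
        rw [lintegral_Ioi_rpow (by linarith) hLp, ← ENNReal.ofReal_mul (by positivity),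
          ← ENNReal.ofReal_mul (by positivity), sub_add_cancel, hL, sqrt_rpow_two_mul (by positivity)]
        congr 1
        field_simp
        norm_num
    _ = ∫⁻ x in Ioi L, ENNReal.ofReal (1 / 2) * ENNReal.ofReal (x ^ (2 * s - 1)) := by
        rw [lintegral_const_mul' _ _ ENNReal.ofReal_ne_top]
    _ ≤ ∫⁻ lam in Ioi L, ENNReal.ofReal (lam ^ (2 * s)) *
        (ENNReal.ofReal lam * ENNReal.ofReal ((lam ^ 2 + y ^ 2) ^ (-1 : ℝ))) := by
        refine setLIntegral_mono' measurableSet_Ioi fun x hx => ?_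
        have hx' : L < x := hx
        have hx0 : 0 < x := hLp.trans hx'
        rw [← ENNReal.ofReal_mul (by positivity), ← ENNReal.ofReal_mul hx0.le,
          ← ENNReal.ofReal_mul (by positivity)]
        apply ENNReal.ofReal_le_ofReal
        have hy : y ^ 2 ≤ x ^ 2 := by
          have h1 : L ^ 2 = lam₀ ^ 2 + y ^ 2 := Real.sq_sqrt (by positivity)
          nlinarith
        rw [Real.rpow_sub hx0, Real.rpow_one, Real.rpow_neg_one]
        have h2 : x * (x ^ 2 + y ^ 2)⁻¹ ≥ 1 / 2 * x⁻¹ := by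
          rw [ge_iff_le, ← div_eq_mul_inv, ← div_eq_mul_inv, div_le_div_iff₀ (by positivity) (by positivity)]
          nlinarith
        calc 1 / 2 * (x ^ (2 * s) / x) = x ^ (2 * s) * (1 / 2 * x⁻¹) := by ring
          _ ≤ _ := by gcongr
    _ ≤ _ := lintegral_mono_set (Ioi_subset_Ioi hL0)

/-- Superposing the weights `lam / (lam² + y²)` produces the weight `(lam₀² + y²)^s`: upper bound. -/
theorem lintegral_kernel_le {s : ℝ} (hs₁ : -1 < s) (hs : s < 0) {lam₀ : ℝ} (h0 : 0 < lam₀) (y : ℝ) :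
    ∫⁻ lam in Ioi lam₀, ENNReal.ofReal (lam ^ (2 * s)) *
        (ENNReal.ofReal lam * ENNReal.ofReal ((lam ^ 2 + y ^ 2) ^ (-1 : ℝ))) ≤
      ENNReal.ofReal (1 / (2 * s + 2) + 1 / (2 * -s)) * ENNReal.ofReal ((lam₀ ^ 2 + y ^ 2) ^ s) := by
  set L := Real.sqrt (lam₀ ^ 2 + y ^ 2) with hL
  have hL0 : lam₀ ≤ L := Real.le_sqrt_of_sq_le (le_add_of_nonneg_right (sq_nonneg y))
  have hLp : 0 < L := h0.trans_le hL0
  have hL2 : L ^ 2 = lam₀ ^ 2 + y ^ 2 := Real.sq_sqrt (by positivity)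
  have hs0 : 0 < -s := by linarith
  have hs2 : 0 < 2 * s + 2 := by linarith
  -- Below `L` the denominator is at least `lam₀² + y² = L²`; above `L` it is at least `lam²`.
  have hunion : Ioi lam₀ = Ioc lam₀ L ∪ Ioi L := (Ioc_union_Ioi_eq_Ioi hL0).symm
  have hLs : L ^ (2 * s) = (lam₀ ^ 2 + y ^ 2) ^ s := sqrt_rpow_two_mul (by positivity) s
  have h1 : ∫⁻ lam in Ioc lam₀ L, ENNReal.ofReal (lam ^ (2 * s)) *
        (ENNReal.ofReal lam * ENNReal.ofReal ((lam ^ 2 + y ^ 2) ^ (-1 : ℝ))) ≤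
      ENNReal.ofReal (1 / (2 * s + 2) * L ^ (2 * s)) := by
    calc _ ≤ ∫⁻ x in Ioc lam₀ L, ENNReal.ofReal ((L ^ 2)⁻¹) * ENNReal.ofReal (x ^ (2 * s + 1)) := by
          refine setLIntegral_mono' measurableSet_Ioc fun x hx => ?_
          have hx0 : 0 < x := h0.trans hx.1
          rw [← ENNReal.ofReal_mul hx0.le, ← ENNReal.ofReal_mul (p := x ^ (2 * s)) (by positivity),
            ← ENNReal.ofReal_mul (p := (L ^ 2)⁻¹) (by positivity)]
          apply ENNReal.ofReal_le_ofReal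
          rw [Real.rpow_add hx0, Real.rpow_one, Real.rpow_neg_one]
          have h3 : (x ^ 2 + y ^ 2)⁻¹ ≤ (L ^ 2)⁻¹ := by
            rw [hL2]
            gcongr
            exact hx.1.le
          calc _ ≤ x ^ (2 * s) * (x * (L ^ 2)⁻¹) := by gcongr
            _ = _ := by ring
      _ ≤ ∫⁻ x in Ioc 0 L, ENNReal.ofReal ((L ^ 2)⁻¹) * ENNReal.ofReal (x ^ (2 * s + 1)) :=
          lintegral_mono_set (Ioc_subset_Ioc_left h0.le)
      _ = _ := by
          rw [lintegral_const_mul' _ _ ENNReal.ofReal_ne_top, lintegral_Ioc_rpow (by linarith) hLp.le,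
            ← ENNReal.ofReal_mul (by positivity)]
          congr 1
          have h4 : L ^ (2 * s + 1 + 1) = L ^ (2 * s) * L ^ 2 := by
            rw [← Real.rpow_two L, ← Real.rpow_add hLp]; ring_nf
          rw [h4, show 2 * s + 1 + 1 = 2 * s + 2 by ring]
          field_simp
  have h2 : ∫⁻ lam in Ioi L, ENNReal.ofReal (lam ^ (2 * s)) *
        (ENNReal.ofReal lam * ENNReal.ofReal ((lam ^ 2 + y ^ 2) ^ (-1 : ℝ))) ≤
      ENNReal.ofReal (1 / (2 * -s) * L ^ (2 * s)) := by
    calc _ ≤ ∫⁻ x in Ioi L, ENNReal.ofReal (x ^ (2 * s - 1)) := by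
          refine setLIntegral_mono' measurableSet_Ioi fun x hx => ?_
          have hx0 : 0 < x := hLp.trans hx
          rw [← ENNReal.ofReal_mul hx0.le, ← ENNReal.ofReal_mul (by positivity)]
          apply ENNReal.ofReal_le_ofReal
          rw [Real.rpow_sub hx0, Real.rpow_one, Real.rpow_neg_one]
          have h3 : (x ^ 2 + y ^ 2)⁻¹ ≤ (x ^ 2)⁻¹ := by
            gcongr; exact le_add_of_nonneg_right (sq_nonneg y)
          calc _ ≤ x ^ (2 * s) * (x * (x ^ 2)⁻¹) := by gcongr
            _ = _ := by field_simp
      _ = _ := by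
          rw [lintegral_Ioi_rpow (by linarith) hLp, sub_add_cancel]
          congr 1
          field_simp
  rw [hunion]
  calc _ ≤ _ := lintegral_union_le _ _ _
    _ ≤ _ := add_le_add h1 h2
    _ = _ := by
        rw [← ENNReal.ofReal_add (by positivity) (by positivity), ← ENNReal.ofReal_mul (by positivity),
          hLs]
        congr 1
        ring

/-- A continuity argument. -/
theorem le_of_continuous_of_bootstrap {g : ℝ → ℝ} (hg : Continuous g) {ε : ℝ} (hε : 0 < ε)
    (h0 : g 0 ≤ ε / 2) (h : ∀ T, (∀ t ∈ uIcc 0 T, g t < ε) → g T ≤ ε / 2) (T : ℝ) : g T ≤ ε / 2 := by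
  -- Times are written as `T * u` with `u ∈ [0, 1]`, which handles both signs of `T` at once.
  have himg : ∀ u : ℝ, 0 ≤ u → ∀ t ∈ uIcc 0 (T * u), ∃ v ∈ Icc 0 u, t = T * v := by
    intro u hu t ht
    have h1 := Set.image_const_mul_uIcc T 0 u
    rw [mul_zero, uIcc_of_le hu] at h1
    rw [← h1] at ht
    obtain ⟨v, hv, rfl⟩ := ht
    exact ⟨v, hv, rfl⟩
  have hc : Continuous fun u => g (T * u) := hg.comp (continuous_const_mul T)
  by_cases hK : (Icc (0 : ℝ) 1 ∩ {u | 3 * ε / 4 ≤ g (T * u)}).Nonempty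
  · exfalso
    obtain ⟨u₀, ⟨⟨hu₀, hu₁⟩, hgu⟩, hmin⟩ := (isCompact_Icc.inter_right
      (isClosed_le continuous_const hc)).exists_isLeast hK
    have hlt : ∀ v ∈ Icc 0 u₀, v ≠ u₀ → g (T * v) < 3 * ε / 4 := by
      intro v hv hne
      by_contra hcon
      exact hne (le_antisymm hv.2 (hmin ⟨⟨hv.1, hv.2.trans hu₁⟩, not_lt.1 hcon⟩))
    obtain ⟨u, hu, hgu'⟩ := intermediate_value_Icc hu₀ hc.continuousOn
      (show 5 * ε / 8 ∈ Icc (g (T * 0)) (g (T * u₀)) from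
        ⟨by rw [mul_zero]; linarith, by simp only [mem_ofPred_eq] at hgu; linarith⟩)
    simp only at hgu'
    have hne : u ≠ u₀ := by
      rintro rfl
      simp only [mem_ofPred_eq] at hgu
      linarith
    have := h (T * u) fun t ht => by
      obtain ⟨v, hv, rfl⟩ := himg u hu.1 t ht
      have := hlt v ⟨hv.1, hv.2.trans hu.2⟩ (fun hvu => hne (le_antisymm hu.2 (hvu ▸ hv.2)))
      linarith
    linarith
  · refine h T fun t ht => ?_
    obtain ⟨v, hv, rfl⟩ := himg 1 zero_le_one t (by rwa [mul_one])
    by_contra hcon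
    exact hK ⟨v, hv, by simp only [mem_ofPred_eq]; linarith⟩

end AKNS

end

/-! ### The a priori bound in terms of Fourier transforms. -/

noncomputable section

open MeasureTheory Filter Topology Set Asymptotics
open scoped ENNReal ComplexConjugate

set_option linter.unusedSectionVars false

namespace AKNS

section Apriori

variable {G : Type*} [AddCommGroup G] [MeasurableSpace G] [MeasurableAdd₂ G] [MeasurableNeg G]
  {μ : Measure G} [SFinite μ] [μ.IsAddLeftInvariant] [μ.IsNegInvariant] {c : G →+ ℝ} {s : ℝ}
  {ρ : Measure ℝ}

/-- The squared norm of regularity `s` at frequency scale `lam`. -/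
def sqNorm (μ : Measure G) (c : G →+ ℝ) (s lam : ℝ) (f : G → ℂ) : ℝ≥0∞ :=
  ∫⁻ ξ, weight c lam s ξ * ‖f ξ‖ₑ ^ 2 ∂μ

theorem weight_antitone {lam lam' : ℝ} (h0 : 0 < lam) (h1 : lam ≤ lam') {a : ℝ} (ha : a ≤ 0) (ξ : G) :
    weight c lam' a ξ ≤ weight c lam a ξ := by
  apply ENNReal.ofReal_le_ofReal
  refine Real.rpow_le_rpow_of_nonpos (sqWeight_pos h0 ξ) ?_ ha
  unfold sqWeight
  gcongr

theorem sqNorm_antitone {lam lam' : ℝ} (h0 : 0 < lam) (h1 : lam ≤ lam') (hs : s ≤ 0) (f : G → ℂ) :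
    sqNorm μ c s lam' f ≤ sqNorm μ c s lam f :=
  lintegral_mono fun ξ => by gcongr; exact weight_antitone h0 h1 hs ξ

/-- For `lam ≥ 1`, `lam² + y² ≤ lam² (1 + y²)`, and the exponent `s` reverses the inequality. This
is the cost of returning to the original norm. -/
theorem sqNorm_one_le {lam : ℝ} (h1 : 1 ≤ lam) (hs : s ≤ 0) (f : G → ℂ) :
    sqNorm μ c s 1 f ≤ ENNReal.ofReal (lam ^ (-(2 * s))) * sqNorm μ c s lam f := by
  have h0 : 0 < lam := by linarith
  rw [sqNorm, sqNorm, ← lintegral_const_mul' _ _ ENNReal.ofReal_ne_top]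
  refine lintegral_mono fun ξ => ?_
  rw [← mul_assoc]
  gcongr
  have hw := sqWeight_pos (c := c) h0 ξ
  rw [weight, weight, ← ENNReal.ofReal_mul (by positivity)]
  apply ENNReal.ofReal_le_ofReal
  have h2 : lam ^ (-(2 * s)) = (lam ^ 2)⁻¹ ^ s := by
    rw [Real.inv_rpow (by positivity), ← Real.rpow_two, ← Real.rpow_mul h0.le, Real.rpow_neg h0.le]
  rw [h2, ← Real.mul_rpow (by positivity) hw.le]
  refine Real.rpow_le_rpow_of_nonpos (by positivity) ?_ hs
  unfold sqWeight
  rw [inv_mul_le_iff₀ (by positivity)]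
  have h3 : 1 ≤ lam ^ 2 := one_le_pow₀ h1
  nlinarith [mul_nonneg (sub_nonneg.2 h3) (sq_nonneg (2 * Real.pi * c ξ))]

theorem measurable_weight_prod (hc : Measurable c) (a : ℝ) :
    Measurable fun p : ℝ × G => weight c p.1 a p.2 := by
  unfold weight sqWeight
  fun_prop

/-- Tonelli moves the integral over scales inside, where the pointwise kernel estimates apply. -/
theorem kernel_bounds (hs₁ : -1 < s) (hs₂ : s < 0) {lam₀ : ℝ} (h0 : 0 < lam₀) (hc : Measurable c)
    {f : G → ℂ} (hf : AEStronglyMeasurable f μ) :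
    ENNReal.ofReal (1 / (4 * -s)) * sqNorm μ c s lam₀ f ≤
      ∫⁻ lam in Ioi lam₀, ENNReal.ofReal (lam ^ (2 * s)) *
        ∫⁻ ξ, ENNReal.ofReal lam * weight c lam (-1) ξ * ‖f ξ‖ₑ ^ 2 ∂μ ∧
    ∫⁻ lam in Ioi lam₀, ENNReal.ofReal (lam ^ (2 * s)) *
        ∫⁻ ξ, ENNReal.ofReal lam * weight c lam (-1) ξ * ‖f ξ‖ₑ ^ 2 ∂μ ≤
      ENNReal.ofReal (1 / (2 * s + 2) + 1 / (2 * -s)) * sqNorm μ c s lam₀ f := by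
  have heq : ∫⁻ lam in Ioi lam₀, ENNReal.ofReal (lam ^ (2 * s)) *
        ∫⁻ ξ, ENNReal.ofReal lam * weight c lam (-1) ξ * ‖f ξ‖ₑ ^ 2 ∂μ =
      ∫⁻ ξ, (∫⁻ lam in Ioi lam₀, ENNReal.ofReal (lam ^ (2 * s)) *
        (ENNReal.ofReal lam * weight c lam (-1) ξ)) * ‖f ξ‖ₑ ^ 2 ∂μ := by
    simp_rw [← lintegral_const_mul' _ _ ENNReal.ofReal_ne_top]
    have hm : Measurable fun p : ℝ × G => ENNReal.ofReal (p.1 ^ (2 * s)) *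
        (ENNReal.ofReal p.1 * weight c p.1 (-1) p.2) :=
      (by fun_prop : Measurable fun p : ℝ × G => ENNReal.ofReal (p.1 ^ (2 * s))).mul
        ((by fun_prop : Measurable fun p : ℝ × G => ENNReal.ofReal p.1).mul
          (measurable_weight_prod hc (-1)))
    rw [lintegral_lintegral_swap]
    · refine lintegral_congr fun ξ => ?_
      rw [← lintegral_mul_const]
      · exact lintegral_congr fun lam => by ring
      · exact hm.comp (measurable_id.prodMk measurable_const)
    · have h2 := hm.aemeasurable.mul ((hf.enorm.pow_const 2).comp_snd
        (μ := (volume.restrict (Ioi lam₀) : Measure ℝ)))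
      refine h2.congr (Eventually.of_forall fun p => ?_)
      simp only [Pi.mul_apply, Function.uncurry]
      ring
  rw [heq]
  constructor
  · rw [sqNorm, ← lintegral_const_mul' _ _ ENNReal.ofReal_ne_top]
    refine lintegral_mono fun ξ => ?_
    rw [← mul_assoc]
    gcongr
    exact le_lintegral_kernel hs₂ h0 _
  · rw [sqNorm, ← lintegral_const_mul' _ _ ENNReal.ofReal_ne_top]
    refine lintegral_mono fun ξ => ?_
    rw [← mul_assoc]
    gcongr
    exact lintegral_kernel_le hs₁ hs₂ h0 _

variable {q : ℝ → ℝ → ℂ} {F : ℕ → ℝ → G → ℂ} {σ B : ℝ}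

theorem admissible_of_bound (hc : Measurable c) (hs₁ : -(1 / 2 : ℝ) < s) (hs₂ : s < 0)
    (hB : ∀ lam : ℝ, 1 ≤ lam → ∫⁻ ξ, weight c lam (-1 - s) ξ ∂μ ≤ ENNReal.ofReal (B * lam ^ (-1 - 2 * s)))
    {lam : ℝ} (h1 : 1 ≤ lam) : Admissible μ c lam s :=
  ⟨hc, by linarith, hs₁.le, hs₂.le, ne_top_of_le_ne_top ENNReal.ofReal_ne_top (hB lam h1)⟩

namespace IsFourierCurve

theorem enorm_res_lift_sq (hF : IsFourierCurve μ c s ρ q F) {lam : ℝ} (h : Admissible μ c lam s)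
    (t : ℝ) : ‖h.res (hF.lift h 0 t)‖ₑ ^ 2 = sqNorm μ c s lam (F 0 t) := by
  rw [h.enorm_res_sq, sqNorm]
  refine lintegral_congr_ae ?_
  filter_upwards [h.coeFn_toLp (hF.memLp lam h.pos 0 t)] with ξ hξ
  rw [lift, hξ]

theorem sqNorm_ne_top (hF : IsFourierCurve μ c s ρ q F) {lam : ℝ} (h : Admissible μ c lam s)
    (t : ℝ) : sqNorm μ c s lam (F 0 t) ≠ ⊤ := by
  rw [← hF.enorm_res_lift_sq h]; finiteness

theorem norm_res_lift_sq (hF : IsFourierCurve μ c s ρ q F) {lam : ℝ} (h : Admissible μ c lam s)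
    (t : ℝ) : ‖h.res (hF.lift h 0 t)‖ ^ 2 = (sqNorm μ c s lam (F 0 t)).toReal := by
  rw [← hF.enorm_res_lift_sq h, ENNReal.toReal_pow, toReal_enorm]

theorem continuous_sqNorm (hF : IsFourierCurve μ c s ρ q F) {lam : ℝ} (h : Admissible μ c lam s) :
    Continuous fun t => (sqNorm μ c s lam (F 0 t)).toReal := by
  simp_rw [← hF.norm_res_lift_sq h]
  exact ((h.res.continuous.comp (hF.continuous lam h.pos 0)).norm).pow 2

/-- Almost conservation with the constant made explicit: the pairing and the two products each
contribute a factor `lam^(-1-2s)`, hence `lam^(-2-4s)`, and `48 = 4 · 12`. -/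
theorem lead_le (hF : IsFourierCurve μ c s ρ q F) (hp : IsParseval μ c ρ) (hB₀ : 0 ≤ B)
    {lam : ℝ} (h : Admissible μ c lam s)
    (hB : ∫⁻ ξ, weight c lam (-1 - s) ξ ∂μ ≤ ENNReal.ofReal (B * lam ^ (-1 - 2 * s)))
    (hσ : σ = 1 ∨ σ = -1) (hq : SolvesNLS σ q ∨ SolvesMKdVComplex σ q) {T : ℝ}
    (hsmall : ∀ t ∈ uIcc 0 T,
      12 * B * lam ^ (-1 - 2 * s) * (sqNorm μ c s lam (F 0 t)).toReal < 1 / 16) :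
    ∫⁻ ξ, ENNReal.ofReal lam * weight c lam (-1) ξ * ‖F 0 T ξ‖ₑ ^ 2 ∂μ ≤
      ∫⁻ ξ, ENNReal.ofReal lam * weight c lam (-1) ξ * ‖F 0 0 ξ‖ₑ ^ 2 ∂μ +
      ENNReal.ofReal (48 * B * lam ^ (-2 - 4 * s) * ((sqNorm μ c s lam (F 0 T)).toReal ^ 2 +
        (sqNorm μ c s lam (F 0 0)).toReal ^ 2)) := by
  have hl := h.pos
  have hD : (12 * ∫⁻ ξ, weight c lam (-1 - s) ξ ∂μ).toReal ≤ 12 * B * lam ^ (-1 - 2 * s) := by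
    refine ENNReal.toReal_le_of_le_ofReal (by positivity) ?_
    rw [mul_assoc, ENNReal.ofReal_mul (by norm_num)]
    gcongr
    simp
  have hlead : ∀ t, ENNReal.ofReal (h.pair (h.conjugate (hF.lift h 0 t)) (h.res (hF.lift h 0 t))).re =
      ∫⁻ ξ, ENNReal.ofReal lam * weight c lam (-1) ξ * ‖F 0 t ξ‖ₑ ^ 2 ∂μ := by
    intro t
    rw [(h.re_pair_conjugate_res _).1]
    refine lintegral_congr_ae ?_
    filter_upwards [h.coeFn_toLp (hF.memLp lam h.pos 0 t)] with ξ hξ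
    rw [lift, hξ]
  rw [← hlead, ← hlead, ← ENNReal.ofReal_add (h.re_pair_conjugate_res _).2 (by positivity)]
  apply ENNReal.ofReal_le_ofReal
  refine (hF.re_pair_le h hp hσ hq (T := T) fun t ht => ?_).trans ?_
  · refine lt_of_le_of_lt ?_ (hsmall t ht)
    rw [hF.norm_res_lift_sq h]
    gcongr
  · have h4 : ∀ t, ‖h.res (hF.lift h 0 t)‖ ^ 4 = (sqNorm μ c s lam (F 0 t)).toReal ^ 2 := fun t => by
      rw [← hF.norm_res_lift_sq h]; ring
    rw [h4, h4]
    refine add_le_add le_rfl (mul_le_mul_of_nonneg_right ?_ (by positivity))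
    calc _ ≤ 4 * (12 * B * lam ^ (-1 - 2 * s)) * lam ^ (-1 - 2 * s) :=
          mul_le_mul_of_nonneg_right (mul_le_mul_of_nonneg_left hD (by norm_num)) (by positivity)
      _ = 48 * B * (lam ^ (-1 - 2 * s) * lam ^ (-1 - 2 * s)) := by ring
      _ = _ := by rw [← Real.rpow_add hl]; ring_nf

/-- The estimate obtained by superposing all scales `lam > lam₀`. -/
theorem superposed_le (hF : IsFourierCurve μ c s ρ q F) (hp : IsParseval μ c ρ) (hc : Measurable c)
    (hs₁ : -(1 / 2 : ℝ) < s) (hs₂ : s < 0) (hB₀ : 0 ≤ B)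
    (hB : ∀ lam : ℝ, 1 ≤ lam → ∫⁻ ξ, weight c lam (-1 - s) ξ ∂μ ≤ ENNReal.ofReal (B * lam ^ (-1 - 2 * s)))
    (hσ : σ = 1 ∨ σ = -1) (hq : SolvesNLS σ q ∨ SolvesMKdVComplex σ q) {lam₀ : ℝ} (h1 : 1 ≤ lam₀) {T : ℝ}
    (hsmall : ∀ t ∈ uIcc 0 T,
      12 * B * (lam₀ ^ (-1 - 2 * s) * (sqNorm μ c s lam₀ (F 0 t)).toReal) < 1 / 16) :
    1 / (4 * -s) * (sqNorm μ c s lam₀ (F 0 T)).toReal ≤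
      (1 / (2 * s + 2) + 1 / (2 * -s)) * (sqNorm μ c s lam₀ (F 0 0)).toReal +
      48 * B / (1 + 2 * s) * lam₀ ^ (-1 - 2 * s) * ((sqNorm μ c s lam₀ (F 0 T)).toReal ^ 2 +
        (sqNorm μ c s lam₀ (F 0 0)).toReal ^ 2) := by
  have hadm := fun {lam : ℝ} (hl : 1 ≤ lam) => admissible_of_bound hc hs₁ hs₂ hB hl
  have h0 : 0 < lam₀ := by linarith
  set m : ℝ → ℝ := fun t => (sqNorm μ c s lam₀ (F 0 t)).toReal with hm
  -- The norms decrease with the scale, so smallness at `lam₀` passes to all larger `lam`, and every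
  -- error term is bounded by norms at `lam₀`.
  have hmono : ∀ t, ∀ lam, lam₀ ≤ lam → (sqNorm μ c s lam (F 0 t)).toReal ≤ m t := fun t lam hl =>
    ENNReal.toReal_mono (hF.sqNorm_ne_top (hadm h1) t) (sqNorm_antitone h0 hl hs₂.le _)
  have hfm : ∀ t, AEStronglyMeasurable (F 0 t) μ := fun t =>
    (hadm h1).aestronglyMeasurable_iff.1 (hF.memLp lam₀ h0 0 t).1
  have h2s : 0 < 1 + 2 * s := by linarith
  have hns : 0 < -s := by linarith
  have h2s2 : 0 < 2 * s + 2 := by linarith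
  have kT := (kernel_bounds (by linarith) hs₂ h0 hc (hfm T)).1
  have k0 := (kernel_bounds (by linarith) hs₂ h0 hc (hfm 0)).2
  have hmain : ∫⁻ lam in Ioi lam₀, ENNReal.ofReal (lam ^ (2 * s)) *
        ∫⁻ ξ, ENNReal.ofReal lam * weight c lam (-1) ξ * ‖F 0 T ξ‖ₑ ^ 2 ∂μ ≤
      (∫⁻ lam in Ioi lam₀, ENNReal.ofReal (lam ^ (2 * s)) *
        ∫⁻ ξ, ENNReal.ofReal lam * weight c lam (-1) ξ * ‖F 0 0 ξ‖ₑ ^ 2 ∂μ) +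
      ENNReal.ofReal (48 * B / (1 + 2 * s) * lam₀ ^ (-1 - 2 * s) * (m T ^ 2 + m 0 ^ 2)) := by
    -- The error carries `lam^(2s) · lam^(-2-4s) = lam^(-2-2s)`, integrable at infinity because `s >
    -- -1/2`.
    have herr : ∫⁻ lam in Ioi lam₀, ENNReal.ofReal (48 * B * (m T ^ 2 + m 0 ^ 2)) *
        ENNReal.ofReal (lam ^ (-2 - 2 * s)) =
        ENNReal.ofReal (48 * B / (1 + 2 * s) * lam₀ ^ (-1 - 2 * s) * (m T ^ 2 + m 0 ^ 2)) := by
      rw [lintegral_const_mul' _ _ ENNReal.ofReal_ne_top, lintegral_Ioi_rpow (by linarith) h0,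
        ← ENNReal.ofReal_mul (by positivity)]
      congr 1
      have e1 : -2 - 2 * s + 1 = -1 - 2 * s := by ring
      have e2 : -(-1 - 2 * s) = 1 + 2 * s := by ring
      rw [e1, e2]
      field_simp
    rw [← herr, ← lintegral_add_right]
    · refine setLIntegral_mono' measurableSet_Ioi fun lam hlam => ?_
      have hlam' : lam₀ < lam := hlam
      have hl1 : 1 ≤ lam := h1.trans hlam'.le
      have hl : 0 < lam := by linarith
      have hlead := hF.lead_le hp hB₀ (hadm hl1) (hB lam hl1) hσ hq (T := T) fun t ht => by
        refine lt_of_le_of_lt ?_ (hsmall t ht)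
        rw [mul_assoc]
        have h3 : lam ^ (-1 - 2 * s) ≤ lam₀ ^ (-1 - 2 * s) :=
          Real.rpow_le_rpow_of_nonpos h0 hlam'.le (by linarith)
        have h4 := hmono t lam hlam'.le
        gcongr
      calc _ ≤ ENNReal.ofReal (lam ^ (2 * s)) * _ := mul_le_mul_right hlead _
        _ ≤ _ := by
            rw [mul_add]
            refine add_le_add le_rfl ?_
            rw [← ENNReal.ofReal_mul (by positivity), ← ENNReal.ofReal_mul (by positivity)]
            apply ENNReal.ofReal_le_ofReal
            have e1 : lam ^ (-2 - 2 * s) = lam ^ (2 * s) * lam ^ (-2 - 4 * s) := by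
              rw [← Real.rpow_add hl]; ring_nf
            have h4 := hmono T lam hlam'.le
            have h5 := hmono 0 lam hlam'.le
            calc _ ≤ lam ^ (2 * s) * (48 * B * lam ^ (-2 - 4 * s) * (m T ^ 2 + m 0 ^ 2)) := by gcongr
              _ = _ := by rw [e1]; ring
    · fun_prop
  have hfin := kT.trans (hmain.trans (add_le_add_left k0 _))
  rw [← ENNReal.ofReal_toReal (hF.sqNorm_ne_top (hadm h1) T),
    ← ENNReal.ofReal_toReal (hF.sqNorm_ne_top (hadm h1) 0), ← ENNReal.ofReal_mul (by positivity),
    ← ENNReal.ofReal_mul (by positivity), ← ENNReal.ofReal_add (by positivity) (by positivity),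
    ENNReal.ofReal_le_ofReal_iff (by positivity)] at hfin
  exact hfin

end IsFourierCurve

/-- The a priori bound in terms of Fourier transforms, with a constant that depends on the setting
only through the regularity `s` and the constant `B`. -/
theorem exists_apriori_bound (hs₁ : -(1 / 2 : ℝ) < s) (hs₂ : s < 0) (hp : IsParseval μ c ρ)
    (hc : Measurable c) (hB₀ : 0 ≤ B)
    (hB : ∀ lam : ℝ, 1 ≤ lam → ∫⁻ ξ, weight c lam (-1 - s) ξ ∂μ ≤ ENNReal.ofReal (B * lam ^ (-1 - 2 * s))) :
    ∃ C : ℝ, 0 < C ∧ ∀ (σ : ℝ) (q : ℝ → ℝ → ℂ) (F : ℕ → ℝ → G → ℂ), σ = 1 ∨ σ = -1 →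
      IsFourierCurve μ c s ρ q F → SolvesNLS σ q ∨ SolvesMKdVComplex σ q → ∀ t,
      GrowthBound C s (Real.sqrt (sqNorm μ c s 1 (F 0 0)).toReal)
        (Real.sqrt (sqNorm μ c s 1 (F 0 t)).toReal) := by
  have h2s : 0 < 1 + 2 * s := by linarith
  have hns : 0 < -s := by linarith
  have h2s2 : 0 < 2 * s + 2 := by linarith
  obtain ⟨c₁, hc₁⟩ : ∃ c₁, c₁ = 1 / (4 * -s) := ⟨_, rfl⟩
  obtain ⟨c₂, hc₂⟩ : ∃ c₂, c₂ = 1 / (2 * s + 2) + 1 / (2 * -s) := ⟨_, rfl⟩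
  obtain ⟨E, hE⟩ : ∃ E, E = 48 * B / (1 + 2 * s) := ⟨_, rfl⟩
  have hc₁p : 0 < c₁ := by rw [hc₁]; positivity
  have hc₂p : 0 < c₂ := by rw [hc₂]; positivity
  have hEp : 0 ≤ E := by rw [hE]; positivity
  -- The first condition is the smallness needed for the Riccati solution at every scale; the second
  -- lets the superposed error be absorbed into half of the leading term.
  obtain ⟨ε, hε, hε₁, hε₂⟩ : ∃ ε : ℝ, 0 < ε ∧ 12 * B * ε < 1 / 16 ∧ E * ε ≤ c₁ / 2 := by
    refine ⟨min (1 / (200 * (B + 1))) (c₁ / (2 * (E + 1))), by positivity, ?_, ?_⟩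
    · calc 12 * B * min (1 / (200 * (B + 1))) (c₁ / (2 * (E + 1)))
          ≤ 12 * B * (1 / (200 * (B + 1))) := by gcongr; exact min_le_left _ _
        _ < 1 / 16 := by
            rw [mul_one_div, div_lt_div_iff₀ (by positivity) (by norm_num)]; linarith
    · calc E * min (1 / (200 * (B + 1))) (c₁ / (2 * (E + 1)))
          ≤ E * (c₁ / (2 * (E + 1))) := by gcongr; exact min_le_right _ _
        _ ≤ c₁ / 2 := by
            rw [mul_div_assoc', div_le_div_iff₀ (by positivity) (by norm_num)]
            nlinarith
  obtain ⟨C₃, hC₃⟩ : ∃ C₃, C₃ = 2 * c₂ / c₁ + 1 := ⟨_, rfl⟩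
  have hC₃p : 1 ≤ C₃ := by
    rw [hC₃]; have : 0 < 2 * c₂ / c₁ := by positivity
    linarith
  -- Chosen so that growth by the factor `C₃` from `δ` reaches only `ε / 2`.
  obtain ⟨δ, hδ⟩ : ∃ δ, δ = ε / (2 * C₃) := ⟨_, rfl⟩
  have hδp : 0 < δ := by rw [hδ]; positivity
  obtain ⟨K, hK1, hK⟩ : ∃ K : ℝ, 1 ≤ K ∧ K ^ (-1 - 2 * s) ≤ δ := by
    refine ⟨max 1 (δ ^ (-(1 + 2 * s)⁻¹)), le_max_left _ _, ?_⟩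
    calc max 1 (δ ^ (-(1 + 2 * s)⁻¹)) ^ (-1 - 2 * s)
        ≤ (δ ^ (-(1 + 2 * s)⁻¹)) ^ (-1 - 2 * s) :=
          Real.rpow_le_rpow_of_nonpos (by positivity) (le_max_right _ _) (by linarith)
      _ = δ := by
          rw [← Real.rpow_mul hδp.le]
          have : -(1 + 2 * s)⁻¹ * (-1 - 2 * s) = 1 := by field_simp; ring
          rw [this, Real.rpow_one]
  have hK0 : 0 < K := by linarith
  refine ⟨K ^ (-s) * Real.sqrt C₃, by positivity, fun σ q F hσ hF hq t => ?_⟩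
  have hadm := fun {lam : ℝ} (hl : 1 ≤ lam) => admissible_of_bound hc hs₁ hs₂ hB hl
  set n := (sqNorm μ c s 1 (F 0 0)).toReal with hn
  have hn0 : 0 ≤ n := ENNReal.toReal_nonneg
  -- With this scale `lam₀^(-1-2s) = K^(-1-2s) / (1 + n)`, so the scale-invariant quantity `θ * n`
  -- is at most `δ` whatever the data.
  set lam₀ := K * (1 + n) ^ (1 + 2 * s)⁻¹ with hlam
  have h1n : 1 ≤ (1 + n) ^ (1 + 2 * s)⁻¹ := Real.one_le_rpow (by linarith) (by positivity)
  have hl1 : 1 ≤ lam₀ := one_le_mul_of_one_le_of_one_le hK1 h1n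
  have hl0 : 0 < lam₀ := by linarith
  set m : ℝ → ℝ := fun t => (sqNorm μ c s lam₀ (F 0 t)).toReal with hm
  have hmnn : ∀ t, 0 ≤ m t := fun t => ENNReal.toReal_nonneg
  set θ := lam₀ ^ (-1 - 2 * s) with hθ
  have hθp : 0 < θ := by positivity
  have hm0n : m 0 ≤ n := ENNReal.toReal_mono (hF.sqNorm_ne_top (hadm le_rfl) 0)
    (sqNorm_antitone one_pos hl1 hs₂.le _)
  have hθn : θ * n ≤ δ := by
    have e1 : θ = K ^ (-1 - 2 * s) * (1 + n)⁻¹ := by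
      rw [hθ, hlam, Real.mul_rpow hK0.le (by positivity), ← Real.rpow_mul (by positivity)]
      have : (1 + 2 * s)⁻¹ * (-1 - 2 * s) = -1 := by field_simp; ring
      rw [this, Real.rpow_neg_one]
    calc θ * n = K ^ (-1 - 2 * s) * ((1 + n)⁻¹ * n) := by rw [e1]; ring
      _ ≤ K ^ (-1 - 2 * s) * 1 := by
          gcongr
          rw [inv_mul_le_iff₀ (by positivity)]; linarith
      _ ≤ δ := by rwa [mul_one]
  have hδε : C₃ * δ = ε / 2 := by rw [hδ]; field_simp
  have hθm0 : θ * m 0 ≤ δ := (by gcongr : θ * m 0 ≤ θ * n).trans hθn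
  have hstep : ∀ T, (∀ t ∈ uIcc 0 T, θ * m t < ε) → m T ≤ C₃ * m 0 := by
    intro T hT
    have h3 := hF.superposed_le hp hc hs₁ hs₂ hB₀ hB hσ hq hl1 (T := T) fun t ht =>
      lt_of_le_of_lt (mul_le_mul_of_nonneg_left (hT t ht).le (by positivity)) hε₁
    rw [← hc₁, ← hc₂, ← hE] at h3
    change c₁ * m T ≤ c₂ * m 0 + E * θ * (m T ^ 2 + m 0 ^ 2) at h3
    have hb : ∀ t, θ * m t < ε → E * θ * m t ^ 2 ≤ c₁ / 2 * m t := fun t ht => by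
      calc E * θ * m t ^ 2 = E * (θ * m t) * m t := by ring
        _ ≤ E * ε * m t := by
            have := hmnn t
            gcongr
        _ ≤ c₁ / 2 * m t := by
            have := hmnn t
            gcongr
    have b1 := hb T (hT T right_mem_uIcc)
    have b2 := hb 0 (hT 0 left_mem_uIcc)
    -- The error is at most `c₁/2 · (m T + m 0)`: absorbing the first half and doubling gives `C₃ =
    -- 2c₂/c₁ + 1`.
    have h4 : c₁ * m T ≤ c₁ * (C₃ * m 0) := by
      have : c₁ * (C₃ * m 0) = 2 * c₂ * m 0 + c₁ * m 0 := by rw [hC₃]; field_simp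
      linarith
    exact le_of_mul_le_mul_left h4 hc₁p
  have hsmall := le_of_continuous_of_bootstrap (g := fun t => θ * m t)
    (continuous_const.mul (hF.continuous_sqNorm (hadm hl1))) hε
    (by
      nlinarith)
    (fun T hT => by
      calc θ * m T ≤ θ * (C₃ * m 0) := by gcongr; exact hstep T hT
        _ = C₃ * (θ * m 0) := by ring
        _ ≤ C₃ * δ := by gcongr
        _ = ε / 2 := hδε)
  have hmt : m t ≤ C₃ * n := (hstep t fun τ _ => (hsmall τ).trans_lt (by linarith)).trans (by gcongr)
  have hlast : (sqNorm μ c s 1 (F 0 t)).toReal ≤ lam₀ ^ (-(2 * s)) * (C₃ * n) := by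
    have h5 := ENNReal.toReal_mono (ENNReal.mul_ne_top ENNReal.ofReal_ne_top
      (hF.sqNorm_ne_top (hadm hl1) t)) (sqNorm_one_le (μ := μ) (c := c) hl1 hs₂.le (F 0 t))
    rw [ENNReal.toReal_mul, ENNReal.toReal_ofReal (by positivity)] at h5
    exact h5.trans (by gcongr)
  unfold GrowthBound
  rw [Real.sq_sqrt hn0, abs_of_neg hs₂]
  calc Real.sqrt (sqNorm μ c s 1 (F 0 t)).toReal ≤ Real.sqrt (lam₀ ^ (-(2 * s)) * (C₃ * n)) :=
        Real.sqrt_le_sqrt hlast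
    _ = lam₀ ^ (-s) * (Real.sqrt C₃ * Real.sqrt n) := by
        rw [Real.sqrt_mul (by positivity), Real.sqrt_mul (by linarith)]
        congr 1
        rw [show -(2 * s) = (-s) * 2 by ring, Real.rpow_mul hl0.le, Real.rpow_two,
          Real.sqrt_sq (by positivity)]
    _ = _ := by
        rw [hlam, Real.mul_rpow hK0.le (by positivity), ← Real.rpow_mul (by positivity)]
        -- The power `lam₀^(-s)`, with `lam₀` of order `(1 + n)^(1/(1+2s))`, gives the stated
        -- exponent.
        have : (1 + 2 * s)⁻¹ * -s = -s / (1 - 2 * -s) := by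
          rw [show 1 - 2 * -s = 1 + 2 * s by ring]; field_simp
        rw [this]
        ring

end Apriori

end AKNS

end

/-! ### The line: Fourier inversion, Parseval and the size of the weight integral. -/

noncomputable section

open MeasureTheory Filter Topology Set Asymptotics
open scoped ENNReal ComplexConjugate

set_option linter.unusedSectionVars false

namespace AKNS

open scoped FourierTransform

section Line

theorem synthesis_id_eq (F : ℝ → ℂ) : synthesis volume (AddMonoidHom.id ℝ) F = 𝓕⁻ F := by
  ext x
  rw [Real.fourierInv_eq']
  refine integral_congr_ae (Eventually.of_forall fun ξ => ?_)
  simp only [character, AddMonoidHom.id_apply, smul_eq_mul, RCLike.inner_apply, conj_trivial]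
  congr 3
  push_cast
  ring

theorem integral_fourierInv_mul_flip {F H : ℝ → ℂ} (hF : Integrable F) (hH : Integrable H) :
    ∫ x, 𝓕⁻ F x * H x = ∫ ξ, F ξ * 𝓕⁻ H ξ := by
  have h1 := VectorFourier.integral_fourierIntegral_smul_eq_flip (L := innerₗ ℝ) (μ := volume)
    (ν := volume) Real.continuous_fourierChar continuous_inner hF.comp_neg hH
  have h2 : ∫ ξ, F ξ * 𝓕⁻ H ξ = ∫ ξ, F (-ξ) * 𝓕⁻ H (-ξ) :=
    (integral_neg_eq_self (fun ξ => F ξ * 𝓕⁻ H ξ) volume).symm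
  rw [h2]
  simp_rw [Real.fourierInv_eq_fourier_neg H, neg_neg, Real.fourierInv_eq_fourier_comp_neg F]
  simpa using! h1

/-- `F` is merely integrable, so equality is tested against smooth compactly supported functions:
both inverse transforms are moved onto the test function, where Schwartz inversion applies. -/
theorem fourierInv_fourierInv_ae_eq {F : ℝ → ℂ} (hF : Integrable F) (hF' : Integrable (𝓕⁻ F)) :
    ∀ᵐ ξ, 𝓕⁻ (𝓕⁻ F) ξ = F (-ξ) := by
  have hcont : Continuous (𝓕⁻ (𝓕⁻ F)) := by
    have : Continuous (𝓕 (𝓕⁻ F)) :=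
      VectorFourier.fourierIntegral_continuous Real.continuous_fourierChar continuous_inner hF'
    have h2 : 𝓕⁻ (𝓕⁻ F) = fun x => 𝓕 (𝓕⁻ F) (-x) :=
      funext fun x => Real.fourierInv_eq_fourier_neg _ x
    rw [h2]
    exact this.comp continuous_neg
  refine ae_eq_of_integral_contDiff_smul_eq hcont.locallyIntegrable
    hF.comp_neg.locallyIntegrable fun g hg hgc => ?_
  let φ : 𝓢(ℝ, ℂ) := HasCompactSupport.toSchwartzMap (f := fun x => (g x : ℂ))
    (hgc.comp_left Complex.ofReal_zero) (Complex.ofRealCLM.contDiff.comp hg)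
  have hφ : ∀ x, φ x = g x := fun x => rfl
  have hinv : ∀ x, 𝓕⁻ (𝓕⁻ (φ : ℝ → ℂ)) x = φ (-x) := fun x => by
    rw [Real.fourierInv_eq_fourier_neg, ← SchwartzMap.fourierInv_coe, ← SchwartzMap.fourier_coe,
      FourierTransform.fourier_fourierInv_eq]
  have hint : Integrable (𝓕⁻ (φ : ℝ → ℂ)) := by
    rw [← SchwartzMap.fourierInv_coe]; exact SchwartzMap.integrable _
  calc ∫ x, g x • 𝓕⁻ (𝓕⁻ F) x = ∫ x, 𝓕⁻ (𝓕⁻ F) x * φ x := by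
        simp_rw [hφ, Complex.real_smul, mul_comm]
    _ = ∫ x, F x * 𝓕⁻ (𝓕⁻ (φ : ℝ → ℂ)) x := by
        rw [integral_fourierInv_mul_flip hF' φ.integrable, integral_fourierInv_mul_flip hF hint]
    _ = ∫ x, F (-x) * φ x := by
        simp_rw [hinv]
        rw [← integral_neg_eq_self]
        simp_rw [neg_neg]
    _ = _ := by simp_rw [hφ, Complex.real_smul, mul_comm]

theorem tendsto_fourierInv_cocompact (F : ℝ → ℂ) : Tendsto (𝓕⁻ F) (cocompact ℝ) (𝓝 0) := by
  have h2 : 𝓕⁻ F = 𝓕 fun x => F (-x) := funext fun x => by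
    rw [Real.fourierInv_eq_fourier_comp_neg]
  rw [h2]
  exact Real.zero_at_infty_fourier _

/-- Parseval is the flip identity after inversion. The integral of a derivative vanishes because, by
Riemann–Lebesgue, the synthesised function tends to zero at both ends. -/
theorem isParseval_line : IsParseval volume (AddMonoidHom.id ℝ) volume where
  parseval F H hF hH hF' := by
    simp_rw [synthesis_id_eq] at *
    calc ∫ ξ, F (-ξ) * H ξ = ∫ ξ, 𝓕⁻ (𝓕⁻ F) ξ * H ξ := integral_congr_ae <| by
          filter_upwards [fourierInv_fourierInv_ae_eq hF hF'] with ξ hξ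
          rw [hξ]
      _ = _ := integral_fourierInv_mul_flip hF' hH
  integral_deriv J g hJ hg hder hint := by
    rw [synthesis_id_eq] at hder
    have h := tendsto_fourierInv_cocompact J
    rw [cocompact_eq_atBot_atTop] at h
    rw [integral_of_hasDerivAt_of_tendsto hder hint (h.mono_left le_sup_left)
      (h.mono_left le_sup_right), sub_zero]

/-- The integral of the weight on the line scales like `lam ^ (-1 - 2 * s)`. -/
theorem lintegral_weight_line_le {s lam : ℝ} (hs₁ : -(1 / 2 : ℝ) < s) (hl : 0 < lam) :
    ∫⁻ ξ, weight (AddMonoidHom.id ℝ) lam (-1 - s) ξ ≤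
      ENNReal.ofReal ((2 + 2 / (1 + 2 * s)) * lam ^ (-1 - 2 * s)) := by
  have h2s : 0 < 1 + 2 * s := by linarith
  set w : ℝ → ℝ≥0∞ := fun ξ => weight (AddMonoidHom.id ℝ) lam (-1 - s) ξ with hw
  have hsq : ∀ r : ℝ, 0 < r → (r ^ 2) ^ (-1 - s) = r ^ (-2 - 2 * s) := fun r hr => by
    rw [← Real.rpow_two, ← Real.rpow_mul hr.le]; ring_nf
  have hle : ∀ r ξ : ℝ, 0 < r → r ^ 2 ≤ sqWeight (AddMonoidHom.id ℝ) lam ξ →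
      w ξ ≤ ENNReal.ofReal (r ^ (-2 - 2 * s)) := fun r ξ hr h => by
    rw [← hsq r hr]
    exact ENNReal.ofReal_le_ofReal (Real.rpow_le_rpow_of_nonpos (by positivity) h (by linarith))
  -- Up to `lam` the weight is bounded by its value at zero frequency; beyond `lam` it is bounded by
  -- `ξ^(-2-2s)`.
  have hhalf : ∫⁻ ξ in Ioi 0, w ξ ≤ ENNReal.ofReal ((1 + 1 / (1 + 2 * s)) * lam ^ (-1 - 2 * s)) := by
    rw [← Ioc_union_Ioi_eq_Ioi hl.le]
    refine (lintegral_union_le _ _ _).trans ?_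
    rw [add_mul, ENNReal.ofReal_add (by positivity) (by positivity)]
    refine add_le_add ?_ ?_
    · calc ∫⁻ ξ in Ioc 0 lam, w ξ ≤ ∫⁻ ξ in Ioc 0 lam, ENNReal.ofReal (lam ^ (-2 - 2 * s)) :=
            lintegral_mono fun ξ => hle lam ξ hl (le_add_of_nonneg_right (sq_nonneg _))
        _ = _ := by
            rw [setLIntegral_const, Real.volume_Ioc, sub_zero, ← ENNReal.ofReal_mul (by positivity),
              one_mul, ← Real.rpow_add_one hl.ne']
            ring_nf
    · calc ∫⁻ ξ in Ioi lam, w ξ ≤ ∫⁻ ξ in Ioi lam, ENNReal.ofReal (ξ ^ (-2 - 2 * s)) :=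
            setLIntegral_mono' measurableSet_Ioi fun ξ hξ => by
              have hξ' : lam < ξ := hξ
              have hpos : 0 < ξ := hl.trans hξ'
              refine hle ξ ξ hpos ?_
              have hpi : 1 ≤ 2 * Real.pi := by linarith [Real.pi_gt_three]
              have : ξ ≤ 2 * Real.pi * ξ := le_mul_of_one_le_left hpos.le hpi
              calc ξ ^ 2 ≤ (2 * Real.pi * ξ) ^ 2 := by gcongr
                _ ≤ _ := le_add_of_nonneg_left (sq_nonneg lam)
        _ = _ := by
            rw [lintegral_Ioi_rpow (by linarith) hl]
            have e1 : -2 - 2 * s + 1 = -1 - 2 * s := by ring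
            have e2 : -(-1 - 2 * s) = 1 + 2 * s := by ring
            rw [e1, e2]
            ring_nf
  have heven : ∀ ξ, w (-ξ) = w ξ := fun ξ => by
    simp only [hw, weight, sqWeight, map_neg, mul_neg, neg_sq]
  have hneg : ∫⁻ ξ in Iic 0, w ξ = ∫⁻ ξ in Ioi 0, w ξ := by
    rw [setLIntegral_congr (Iio_ae_eq_Iic (μ := volume) (a := (0 : ℝ))).symm,
      ← lintegral_indicator measurableSet_Iio, ← lintegral_neg_eq_self,
      ← lintegral_indicator measurableSet_Ioi]
    congr 1
    ext ξ
    simp only [indicator, mem_Iio, mem_Ioi, neg_lt_zero, heven]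
  rw [← setLIntegral_univ, ← Iic_union_Ioi (a := (0 : ℝ))]
  refine (lintegral_union_le _ _ _).trans ?_
  rw [hneg]
  refine (add_le_add hhalf hhalf).trans_eq ?_
  rw [← ENNReal.ofReal_add (by positivity) (by positivity)]
  ring_nf

end Line

end AKNS

end

/-! ### The line: Schwartz solutions and the Sobolev norm. -/

noncomputable section

open MeasureTheory Filter Topology Set Asymptotics
open scoped ENNReal ComplexConjugate

set_option linter.unusedSectionVars false

namespace AKNS

open scoped FourierTransform

theorem iteratedDeriv_ofReal {f : ℝ → ℝ} (hf : ContDiff ℝ ∞ f) (j : ℕ) (x : ℝ) :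
    iteratedDeriv j (fun y => (f y : ℂ)) x = ((iteratedDeriv j f x : ℝ) : ℂ) := by
  induction j generalizing x with
  | zero => simp
  | succ j ih =>
    rw [iteratedDeriv_succ, funext ih, iteratedDeriv_succ]
    exact ((hf.differentiable_iteratedDeriv j (by exact_mod_cast WithTop.coe_lt_top _)
      x).hasDerivAt.ofReal_comp).deriv

theorem SolvesMKdV.toComplex {σ : ℝ} {q : ℝ → ℝ → ℝ} (h : SolvesMKdV σ q)
    (hq : ∀ t, ContDiff ℝ ∞ (q t)) : SolvesMKdVComplex σ fun t x => (q t x : ℂ) := by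
  refine ⟨fun t x => Complex.conj_ofReal _, fun t x => ?_⟩
  simp only []
  rw [iteratedDeriv_ofReal (hq t), iteratedDeriv_ofReal (hq t), iteratedDeriv_one]
  convert (h t x).ofReal_comp using 1
  push_cast
  ring

section Line

/-- The density grows at most like `(1 + |ξ|)²`, so the exponent `4` leaves the integrable `(1 +
|ξ|)^(-2)`. Temperate growth embeds Schwartz space continuously in the weighted `L²` space. -/
theorem hasTemperateGrowth_weightedMeasure {s lam : ℝ} (hs₁ : -1 ≤ s) (hs₂ : s ≤ 0) (hl : 0 < lam) :
    (weightedMeasure volume (AddMonoidHom.id ℝ) lam s).HasTemperateGrowth := by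
  have hsq : Continuous (sqWeight (AddMonoidHom.id ℝ) lam) := by
    unfold sqWeight; simp only [AddMonoidHom.id_apply]; fun_prop
  have hpos : ∀ ξ, 0 < sqWeight (AddMonoidHom.id ℝ) lam ξ := sqWeight_pos hl
  have hpow : Continuous fun ξ => sqWeight (AddMonoidHom.id ℝ) lam ξ ^ (1 + s) :=
    hsq.rpow_const fun ξ => Or.inl (hpos ξ).ne'
  refine ⟨⟨4, ?_⟩⟩
  have hmw : Measurable (weight (AddMonoidHom.id ℝ) lam (1 + s)) := hpow.measurable.ennreal_ofReal
  rw [integrable_withDensity_iff_integrable_smul' hmw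
    (Eventually.of_forall fun ξ => ENNReal.ofReal_lt_top)]
  have hint : Integrable fun ξ : ℝ => (1 + ‖ξ‖) ^ (-(2 : ℝ)) :=
    integrable_one_add_norm (by simp)
  have hc4 : Continuous fun ξ : ℝ => (1 + ‖ξ‖) ^ (-((4 : ℕ) : ℝ)) :=
    (by fun_prop : Continuous fun ξ : ℝ => 1 + ‖ξ‖).rpow_const fun ξ => Or.inl (by positivity)
  refine (hint.const_mul (1 + lam ^ 2 + (2 * Real.pi) ^ 2)).mono' ?_ (Eventually.of_forall fun ξ => ?_)
  · simp only [weight, ENNReal.toReal_ofReal (Real.rpow_nonneg (hpos _).le _)]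
    exact (hpow.smul hc4).aestronglyMeasurable
  · have h1 : sqWeight (AddMonoidHom.id ℝ) lam ξ ^ (1 + s) ≤
        (1 + lam ^ 2 + (2 * Real.pi) ^ 2) * (1 + ‖ξ‖) ^ 2 := by
      calc sqWeight (AddMonoidHom.id ℝ) lam ξ ^ (1 + s)
          ≤ (1 + sqWeight (AddMonoidHom.id ℝ) lam ξ) ^ (1 + s) := by
            have := (hpos ξ).le
            exact Real.rpow_le_rpow this (by linarith) (by linarith)
        _ ≤ (1 + sqWeight (AddMonoidHom.id ℝ) lam ξ) ^ (1 : ℝ) :=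
            Real.rpow_le_rpow_of_exponent_le (by linarith [hpos ξ]) (by linarith)
        _ = 1 + lam ^ 2 + (2 * Real.pi) ^ 2 * ‖ξ‖ ^ 2 := by
            rw [Real.rpow_one, sqWeight, AddMonoidHom.id_apply, mul_pow, Real.norm_eq_abs, sq_abs]; ring
        _ ≤ _ := by
            have hn := norm_nonneg ξ
            have : 0 ≤ (1 + lam ^ 2) * (2 * ‖ξ‖ + ‖ξ‖ ^ 2) + (2 * Real.pi) ^ 2 * (1 + 2 * ‖ξ‖) := by
              positivity
            nlinarith
    rw [smul_eq_mul, norm_mul, weight, ENNReal.toReal_ofReal (Real.rpow_nonneg (hpos _).le _),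
      Real.norm_of_nonneg (Real.rpow_nonneg (hpos _).le _), Real.norm_of_nonneg (by positivity)]
    refine (mul_le_mul_of_nonneg_right h1 (by positivity)).trans_eq ?_
    rw [mul_assoc, ← Real.rpow_natCast (1 + ‖ξ‖) 2, ← Real.rpow_add (by positivity)]
    norm_num

/-- The iterated derivative of a Schwartz function. -/
abbrev schwartzDeriv (j : ℕ) (f : 𝓢(ℝ, ℂ)) : 𝓢(ℝ, ℂ) := (SchwartzMap.derivCLM ℂ ℂ)^[j] f

theorem schwartzDeriv_apply (j : ℕ) (f : 𝓢(ℝ, ℂ)) (x : ℝ) :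
    schwartzDeriv j f x = iteratedDeriv j f x := by
  induction j generalizing x with
  | zero => rw [iteratedDeriv_zero]; rfl
  | succ j ih =>
    rw [schwartzDeriv, Function.iterate_succ_apply', SchwartzMap.derivCLM_apply, iteratedDeriv_succ]
    congr 1
    exact funext ih

theorem isFourierCurve_line {s : ℝ} (hs₁ : -1 ≤ s) (hs₂ : s ≤ 0) {q : ℝ → 𝓢(ℝ, ℂ)}
    (hq : Continuous q) :
    IsFourierCurve volume (AddMonoidHom.id ℝ) s volume (fun t x => q t x)
      fun j t => (𝓕 (schwartzDeriv j (q t)) : 𝓢(ℝ, ℂ)) where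
  memLp lam hl j t :=
    have := hasTemperateGrowth_weightedMeasure hs₁ hs₂ hl
    SchwartzMap.memLp _ 2 _
  continuous lam hl j := by
    have := hasTemperateGrowth_weightedMeasure hs₁ hs₂ hl
    have h1 : Continuous fun t => (𝓕 (schwartzDeriv j (q t)) : 𝓢(ℝ, ℂ)) :=
      (FourierTransform.fourierCLM ℂ 𝓢(ℝ, ℂ)).continuous.comp
        (((SchwartzMap.derivCLM ℂ ℂ).continuous.iterate j).comp hq)
    exact (SchwartzMap.toLpCLM ℂ ℂ 2 (weightedMeasure volume (AddMonoidHom.id ℝ) lam s)).continuous.comp h1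
  synthesis_eq j t x := by
    rw [synthesis_id_eq, ← SchwartzMap.fourierInv_coe, FourierTransform.fourierInv_fourier_eq,
      schwartzDeriv_apply]
  contDiff t := (q t).smooth ⊤
  integrable j t := by
    have : iteratedDeriv j (fun x => q t x) = schwartzDeriv j (q t) :=
      funext fun x => (schwartzDeriv_apply j (q t) x).symm
    rw [this]
    exact (schwartzDeriv j (q t)).integrable

/-- Under `ξ = 2πη` the Jacobian cancels the square of the normalising factor `(2π)^(-1/2)`. -/
theorem sobolevLine_eq (s : ℝ) (f : 𝓢(ℝ, ℂ)) :
    sobolevLine s f =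
      Real.sqrt (sqNorm volume (AddMonoidHom.id ℝ) s 1 (𝓕 f : 𝓢(ℝ, ℂ))).toReal := by
  have hpi : 0 < 2 * Real.pi := by positivity
  have hF : ∀ η : ℝ, ‖fourierLine f (2 * Real.pi * η)‖ ^ 2 =
      (2 * Real.pi)⁻¹ * ‖(𝓕 f : 𝓢(ℝ, ℂ)) η‖ ^ 2 := by
    intro η
    rw [fourierLine, norm_mul, mul_pow, Complex.norm_real, Real.norm_of_nonneg (by positivity),
      div_pow, one_pow, Real.sq_sqrt hpi.le, one_div, SchwartzMap.fourier_coe,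
      Real.fourier_real_eq_integral_exp_smul]
    congr 3
    refine integral_congr_ae (μ := (volume : Measure ℝ)) (Eventually.of_forall fun x => ?_)
    simp only [smul_eq_mul]
    congr 2
    push_cast
    ring
  rw [sobolevLine]
  congr 1
  have hsub := Measure.integral_comp_mul_left
    (fun ξ : ℝ => (1 + ξ ^ 2) ^ s * ‖fourierLine f ξ‖ ^ 2) (2 * Real.pi)
  simp only [hF, abs_of_pos (inv_pos.2 hpi), smul_eq_mul] at hsub
  have h1 : ∫ ξ, (1 + ξ ^ 2) ^ s * ‖fourierLine f ξ‖ ^ 2 =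
      ∫ η, sqWeight (AddMonoidHom.id ℝ) 1 η ^ s * ‖(𝓕 f : 𝓢(ℝ, ℂ)) η‖ ^ 2 := by
    rw [← mul_right_inj' (inv_pos.2 hpi).ne', ← hsub, ← integral_const_mul]
    refine integral_congr_ae (Eventually.of_forall fun η => ?_)
    simp only [sqWeight, AddMonoidHom.id_apply, one_pow]
    ring
  have hcont : Continuous fun η => sqWeight (AddMonoidHom.id ℝ) 1 η ^ s :=
    (by unfold sqWeight; simp only [AddMonoidHom.id_apply]; fun_prop :
      Continuous (sqWeight (AddMonoidHom.id ℝ) 1)).rpow_const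
        fun ξ => Or.inl (sqWeight_pos one_pos ξ).ne'
  rw [h1, integral_eq_lintegral_of_nonneg_ae (Eventually.of_forall fun η =>
    mul_nonneg (Real.rpow_nonneg (sqWeight_pos one_pos η).le _) (sq_nonneg _))
    (hcont.mul ((𝓕 f : 𝓢(ℝ, ℂ)).continuous.norm.pow 2)).aestronglyMeasurable, sqNorm]
  congr 1
  refine lintegral_congr fun η => ?_
  rw [weight, ENNReal.ofReal_mul (Real.rpow_nonneg (sqWeight_pos one_pos η).le _),
    ENNReal.ofReal_pow (norm_nonneg _), ofReal_norm]

theorem exists_bound_line {s : ℝ} (hs₁ : -(1 / 2 : ℝ) < s) (hs₂ : s < 0) :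
    ∃ C : ℝ, 0 < C ∧ ∀ (σ : ℝ) (q : ℝ → 𝓢(ℝ, ℂ)), σ = 1 ∨ σ = -1 → Continuous q →
      SolvesNLS σ (fun t x => q t x) ∨ SolvesMKdVComplex σ (fun t x => q t x) → ∀ t,
      GrowthBound C s (sobolevLine s (q 0)) (sobolevLine s (q t)) := by
  have h2s : 0 < 1 + 2 * s := by linarith
  obtain ⟨C, hC, h⟩ := exists_apriori_bound (μ := volume) (c := AddMonoidHom.id ℝ) hs₁ hs₂
    isParseval_line measurable_id (B := 2 + 2 / (1 + 2 * s)) (by positivity)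
    fun lam hl => lintegral_weight_line_le hs₁ (by linarith)
  refine ⟨C, hC, fun σ q hσ hq hs t => ?_⟩
  rw [sobolevLine_eq, sobolevLine_eq]
  exact h σ _ _ hσ (isFourierCurve_line (by linarith) hs₂.le hq) hs t

end Line

end AKNS

end

/-! ### The circle: Parseval and the size of the weight sum. -/

noncomputable section

open MeasureTheory Filter Topology Set Asymptotics
open scoped ENNReal ComplexConjugate

set_option linter.unusedSectionVars false

namespace AKNS

theorem integral_mul_synthesis {G : Type*} [AddCommGroup G] [MeasurableSpace G] {μ : Measure G}
    [SFinite μ] {c : G →+ ℝ} (hc : Measurable c) {ρ : Measure ℝ} [SFinite ρ] {g : ℝ → ℂ} {H : G → ℂ}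
    (hg : Integrable g ρ) (hH : Integrable H μ) :
    ∫ x, g x * synthesis μ c H x ∂ρ = ∫ ξ, (∫ x, g x * character c x ξ ∂ρ) * H ξ ∂μ := by
  have hmeas : Measurable fun p : ℝ × G => character c p.1 p.2 := by
    unfold character; fun_prop
  have hint : Integrable (fun p : ℝ × G => g p.1 * (character c p.1 p.2 * H p.2)) (ρ.prod μ) := by
    have h := (hg.mul_prod hH).bdd_mul (c := 1) hmeas.aestronglyMeasurable
      (Eventually.of_forall fun p => by simp [norm_character])
    refine h.congr (Eventually.of_forall fun p => ?_)
    simp only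
    ring
  simp_rw [synthesis, ← integral_const_mul, ← integral_mul_const]
  rw [integral_integral_swap hint]
  simp_rw [mul_assoc]

section Circle

/-- The frequencies `n ↦ (n : ℝ)` of the circle. -/
abbrev intFrequency : ℤ →+ ℝ := Int.castAddHom ℝ

theorem measurable_intFrequency : Measurable intFrequency := measurable_of_countable _

theorem continuous_character_int (n : ℤ) : Continuous fun x => character intFrequency x n := by
  unfold character; fun_prop

theorem integral_character_mul_character (n m : ℤ) :
    ∫ x in Ioc (0 : ℝ) 1, character intFrequency x n * character intFrequency x m =
      if m = -n then 1 else 0 := by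
  rw [← intervalIntegral.integral_of_le zero_le_one]
  have h1 : ∀ x : ℝ, character intFrequency x n * character intFrequency x m =
      Complex.exp (((n + m : ℤ) : ℂ) * (2 * Real.pi * Complex.I) * x) := fun x => by
    simp only [character, ← Complex.exp_add, Int.coe_castAddHom]
    congr 1
    push_cast
    ring
  simp_rw [h1]
  split_ifs with h
  · simp [h]
  · have hk : ((n + m : ℤ) : ℂ) * (2 * Real.pi * Complex.I) ≠ 0 :=
      mul_ne_zero (by exact_mod_cast fun h' => h (by omega)) Complex.two_pi_I_ne_zero
    rw [integral_exp_mul_complex hk]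
    simp only [Complex.ofReal_one, mul_one, Complex.ofReal_zero, mul_zero, Complex.exp_zero,
      Complex.exp_int_mul_two_pi_mul_I, sub_self, zero_div]

theorem periodic_synthesis_int (J : ℤ → ℂ) :
    Function.Periodic (synthesis Measure.count intFrequency J) 1 := fun x => by
  refine integral_congr_ae (Eventually.of_forall fun n => ?_)
  have h : character intFrequency (x + 1) n = character intFrequency x n := by
    have : ((2 * Real.pi * intFrequency n * (x + 1) : ℝ) : ℂ) * Complex.I =
        (2 * Real.pi * intFrequency n * x : ℝ) * Complex.I + n * (2 * Real.pi * Complex.I) := by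
      simp only [Int.coe_castAddHom]; push_cast; ring
    rw [character, this, Complex.exp_add, Complex.exp_int_mul_two_pi_mul_I, mul_one, character]
  simp only [h]

/-- Fubini moves the synthesis of `H` outside, and orthogonality of characters recovers the
coefficient `F (-n)`. The integral of a derivative over a period vanishes by periodicity. -/
theorem isParseval_circle :
    IsParseval Measure.count intFrequency (volume.restrict (Ioc (0 : ℝ) 1)) where
  parseval F H hF hH hF' := by
    rw [integral_mul_synthesis measurable_intFrequency hF' hH]
    refine integral_congr_ae (Eventually.of_forall fun n => ?_)
    have h1 : ∫ x in Ioc (0 : ℝ) 1, synthesis Measure.count intFrequency F x * character intFrequency x n =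
        F (-n) := by
      simp_rw [mul_comm (synthesis Measure.count intFrequency F _)]
      rw [integral_mul_synthesis measurable_intFrequency
        ((continuous_character_int n).integrableOn_Ioc) hF]
      simp_rw [integral_character_mul_character, ite_mul, one_mul, zero_mul]
      have h2 : (fun m : ℤ => if m = -n then F m else 0) = indicator {-n} F := by
        ext m; simp [indicator]
      rw [h2, integral_indicator (measurableSet_singleton _), integral_singleton]
      simp [Measure.real]
    simp only [h1]
  integral_deriv J g _ hg hder _ := by
    rw [← intervalIntegral.integral_of_le zero_le_one,
      intervalIntegral.integral_eq_sub_of_hasDerivAt (fun x _ => hder x) (hg.intervalIntegrable _ _)]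
    have := periodic_synthesis_int J 0
    rw [zero_add] at this
    rw [this, sub_self]

theorem exists_lintegral_weight_int_le {s : ℝ} (hs₁ : -(1 / 2 : ℝ) < s) :
    ∃ B : ℝ, 0 ≤ B ∧ ∀ lam : ℝ, 1 ≤ lam →
      ∫⁻ n, weight intFrequency lam (-1 - s) n ∂Measure.count ≤
        ENNReal.ofReal (B * lam ^ (-1 - 2 * s)) := by
  have h2s : 0 < 1 + 2 * s := by linarith
  set K : ℝ := 2 + 2 * (2 * Real.pi) ^ 2 with hK
  have hKp : 0 < K := by positivity
  refine ⟨K ^ (1 + s) * (2 + 2 / (1 + 2 * s)), by positivity, fun lam hl => ?_⟩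
  have hl0 : 0 < lam := by linarith
  -- On `[n, n + 1)` one has `ξ² ≤ 2n² + 2`; since `lam ≥ 1`, the constant is absorbed by `lam²`,
  -- which gives `K`. The sum is then dominated by the integral on the line.
  have hcomp : ∀ (n : ℤ) (ξ : ℝ), ξ ∈ Ico (n : ℝ) (n + 1) →
      weight intFrequency lam (-1 - s) n ≤
        ENNReal.ofReal (K ^ (1 + s)) * weight (AddMonoidHom.id ℝ) lam (-1 - s) ξ := fun n ξ hξ => by
    have hn := sqWeight_pos (c := intFrequency) hl0 n
    have hx := sqWeight_pos (c := AddMonoidHom.id ℝ) hl0 ξ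
    rw [weight, weight, ← ENNReal.ofReal_mul (by positivity)]
    apply ENNReal.ofReal_le_ofReal
    have e1 : K ^ (1 + s) = K⁻¹ ^ (-1 - s) := by
      rw [Real.inv_rpow hKp.le, ← Real.rpow_neg hKp.le]; ring_nf
    rw [e1, ← Real.mul_rpow (by positivity) hx.le]
    refine Real.rpow_le_rpow_of_nonpos (by positivity) ?_ (by linarith)
    rw [inv_mul_le_iff₀ hKp]
    simp only [sqWeight, AddMonoidHom.id_apply, Int.coe_castAddHom, mul_pow _ ξ, mul_pow _ (n : ℝ)]
    have h1 : ξ ^ 2 ≤ 2 * (n : ℝ) ^ 2 + 2 := by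
      have h2 : (ξ - n) ^ 2 ≤ 1 := by
        have := hξ.1; have := hξ.2
        rw [sq_le_one_iff_abs_le_one, abs_le]; constructor <;> linarith
      nlinarith [sq_nonneg (ξ - 2 * n)]
    have h3 : 1 ≤ lam ^ 2 := one_le_pow₀ hl
    have h4 := mul_le_mul_of_nonneg_left h1 (sq_nonneg (2 * Real.pi))
    have h5 := mul_le_mul_of_nonneg_left h3 (sq_nonneg (2 * Real.pi))
    have h6 : 0 ≤ (2 * Real.pi) ^ 2 * (2 * Real.pi) ^ 2 * (n : ℝ) ^ 2 := by positivity
    rw [hK]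
    nlinarith
  rw [lintegral_count]
  calc ∑' n : ℤ, weight intFrequency lam (-1 - s) n
      ≤ ∑' n : ℤ, ∫⁻ ξ in Ico (n : ℝ) (n + 1),
          ENNReal.ofReal (K ^ (1 + s)) * weight (AddMonoidHom.id ℝ) lam (-1 - s) ξ := by
        refine ENNReal.tsum_le_tsum fun n => ?_
        calc weight intFrequency lam (-1 - s) n
            = ∫⁻ ξ in Ico (n : ℝ) (n + 1), weight intFrequency lam (-1 - s) n := by
              rw [setLIntegral_const, Real.volume_Ico]; simp
          _ ≤ _ := setLIntegral_mono' measurableSet_Ico (hcomp n)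
    _ = ENNReal.ofReal (K ^ (1 + s)) * ∫⁻ ξ, weight (AddMonoidHom.id ℝ) lam (-1 - s) ξ := by
        rw [← lintegral_iUnion (fun _ => measurableSet_Ico) (pairwise_disjoint_Ico_intCast ℝ),
          iUnion_Ico_intCast, setLIntegral_univ, lintegral_const_mul' _ _ ENNReal.ofReal_ne_top]
    _ ≤ ENNReal.ofReal (K ^ (1 + s)) *
          ENNReal.ofReal ((2 + 2 / (1 + 2 * s)) * lam ^ (-1 - 2 * s)) := by
        gcongr; exact lintegral_weight_line_le hs₁ hl0
    _ = _ := by rw [← ENNReal.ofReal_mul (by positivity), mul_assoc]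

end Circle

end AKNS

end

/-! ### The circle: smooth solutions, the Sobolev norm and the theorem. -/

noncomputable section

open MeasureTheory Filter Topology Set Asymptotics
open scoped ENNReal ComplexConjugate

set_option linter.unusedSectionVars false

namespace AKNS

section Circle

/-- The Fourier coefficients of a function on the circle, indexed by the integers. -/
def circleCoeff (f : ℝ → ℂ) (n : ℤ) : ℂ := fourierCircle f (2 * Real.pi * (n : ℝ))

theorem circleCoeff_eq (f : ℝ → ℂ) (n : ℤ) :
    circleCoeff f n = ∫ x in (0 : ℝ)..1, character intFrequency x (-n) * f x := by
  rw [circleCoeff, fourierCircle]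
  refine intervalIntegral.integral_congr fun x _ => ?_
  simp only [character, Int.coe_castAddHom]
  congr 2
  push_cast
  ring

theorem norm_circleCoeff_sub_le {f g : ℝ → ℂ} (hf : Continuous f) (hg : Continuous g) (n : ℤ) :
    ‖circleCoeff f n - circleCoeff g n‖ ≤ ∫ x in (0 : ℝ)..1, ‖f x - g x‖ := by
  have hc := continuous_character_int (-n)
  rw [circleCoeff_eq, circleCoeff_eq, ← intervalIntegral.integral_sub
    (Continuous.intervalIntegrable (by fun_prop) _ _) (Continuous.intervalIntegrable (by fun_prop) _ _)]
  refine (intervalIntegral.norm_integral_le_integral_norm zero_le_one).trans_eq ?_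
  refine intervalIntegral.integral_congr fun x _ => ?_
  simp only [← mul_sub, norm_mul, norm_character, one_mul]

theorem hasDerivAt_character_int (n : ℤ) (x : ℝ) :
    HasDerivAt (fun y => character intFrequency y n)
      ((2 * Real.pi * n * Complex.I) * character intFrequency x n) x := by
  have h1 : HasDerivAt (fun y : ℝ => ((2 * Real.pi * intFrequency n * y : ℝ) : ℂ) * Complex.I)
      ((2 * Real.pi * intFrequency n : ℝ) * Complex.I) x := by
    have := ((hasDerivAt_id x).const_mul (2 * Real.pi * intFrequency n)).ofReal_comp.mul_const Complex.I
    simpa using! this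
  have h2 : HasDerivAt (fun y => character intFrequency y n)
      (character intFrequency x n * ((2 * Real.pi * intFrequency n : ℝ) * Complex.I)) x := h1.cexp
  convert h2 using 1
  simp only [Int.coe_castAddHom]
  push_cast
  ring

theorem character_int_periodic (n : ℤ) :
    character intFrequency 1 n = character intFrequency 0 n := by
  have : ((2 * Real.pi * intFrequency n * 1 : ℝ) : ℂ) * Complex.I = n * (2 * Real.pi * Complex.I) := by
    simp only [Int.coe_castAddHom]; push_cast; ring
  rw [character, character, this, Complex.exp_int_mul_two_pi_mul_I]
  simp

theorem circleCoeff_deriv {f f' : ℝ → ℂ} (hper : f 1 = f 0) (hder : ∀ x, HasDerivAt f (f' x) x)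
    (hf' : Continuous f') (n : ℤ) :
    circleCoeff f' n = (2 * Real.pi * n * Complex.I) * circleCoeff f n := by
  rw [circleCoeff_eq, circleCoeff_eq, intervalIntegral.integral_mul_deriv_eq_deriv_mul
    (fun x _ => hasDerivAt_character_int (-n) x) (fun x _ => hder x)
    ((continuous_const.mul (continuous_character_int (-n))).intervalIntegrable _ _)
    (hf'.intervalIntegrable _ _), hper, character_int_periodic, sub_self, zero_sub,
    ← intervalIntegral.integral_const_mul, ← intervalIntegral.integral_neg]
  refine intervalIntegral.integral_congr fun x _ => ?_
  push_cast
  ring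

theorem periodic_iteratedDeriv {f : ℝ → ℂ} (hf : Function.Periodic f 1) (j : ℕ) :
    Function.Periodic (iteratedDeriv j f) 1 := by
  induction j with
  | zero => simpa using hf
  | succ j ih =>
    intro x
    rw [iteratedDeriv_succ, ← deriv_comp_add_const, funext ih]

/-- Two integrations by parts: multiplication by `1 + (2πn)²` is the action of `1 - ∂²`. It yields
quadratic decay of the coefficients. -/
theorem sqWeight_mul_circleCoeff {f : ℝ → ℂ} (hf : ContDiff ℝ ∞ f) (hper : Function.Periodic f 1)
    (j : ℕ) (n : ℤ) :
    (sqWeight intFrequency 1 n : ℂ) * circleCoeff (iteratedDeriv j f) n =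
      circleCoeff (iteratedDeriv j f) n - circleCoeff (iteratedDeriv (j + 2) f) n := by
  have hcont : ∀ k, Continuous (iteratedDeriv k f) := fun k =>
    hf.continuous_iteratedDeriv k (by exact_mod_cast le_top)
  have hp : ∀ k, iteratedDeriv k f 1 = iteratedDeriv k f 0 := fun k => by
    simpa using periodic_iteratedDeriv hper k 0
  rw [circleCoeff_deriv (hp (j + 1)) (hasDerivAt_iteratedDeriv hf (j + 1)) (hcont _),
    circleCoeff_deriv (hp j) (hasDerivAt_iteratedDeriv hf j) (hcont _), sqWeight]
  simp only [Int.coe_castAddHom]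
  push_cast
  linear_combination ((2 * Real.pi * n) ^ 2 * circleCoeff (iteratedDeriv j f) n) * Complex.I_sq

/-- Decay is stated for differences with a constant that tends to zero with the functions, so that
it gives continuity in time as well as membership in the weighted space. -/
theorem norm_circleCoeff_iteratedDeriv_sub_le {f g : ℝ → ℂ} (hf : ContDiff ℝ ∞ f)
    (hfp : Function.Periodic f 1) (hg : ContDiff ℝ ∞ g) (hgp : Function.Periodic g 1) (j : ℕ) (n : ℤ) :
    ‖circleCoeff (iteratedDeriv j f) n - circleCoeff (iteratedDeriv j g) n‖ ≤
      ((∫ x in (0 : ℝ)..1, ‖iteratedDeriv j f x - iteratedDeriv j g x‖) +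
        ∫ x in (0 : ℝ)..1, ‖iteratedDeriv (j + 2) f x - iteratedDeriv (j + 2) g x‖) *
        ‖(sqWeight intFrequency 1 n)⁻¹‖ := by
  have hw := sqWeight_pos (c := intFrequency) one_pos n
  have hcf : ∀ k, Continuous (iteratedDeriv k f) := fun k =>
    hf.continuous_iteratedDeriv k (by exact_mod_cast le_top)
  have hcg : ∀ k, Continuous (iteratedDeriv k g) := fun k =>
    hg.continuous_iteratedDeriv k (by exact_mod_cast le_top)
  rw [Real.norm_of_nonneg (inv_pos.2 hw).le, ← div_eq_mul_inv, le_div_iff₀ hw]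
  calc _ = ‖(sqWeight intFrequency 1 n : ℂ) *
        (circleCoeff (iteratedDeriv j f) n - circleCoeff (iteratedDeriv j g) n)‖ := by
        rw [norm_mul, Complex.norm_real, Real.norm_of_nonneg hw.le, mul_comm]
    _ = ‖(circleCoeff (iteratedDeriv j f) n - circleCoeff (iteratedDeriv j g) n) -
        (circleCoeff (iteratedDeriv (j + 2) f) n - circleCoeff (iteratedDeriv (j + 2) g) n)‖ := by
        rw [mul_sub, sqWeight_mul_circleCoeff hf hfp, sqWeight_mul_circleCoeff hg hgp]
        congr 1
        ring
    _ ≤ _ := (norm_sub_le _ _).trans (add_le_add (norm_circleCoeff_sub_le (hcf j) (hcg j) n)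
        (norm_circleCoeff_sub_le (hcf _) (hcg _) n))

theorem circleCoeff_zero : circleCoeff 0 = 0 := by
  ext n; simp [circleCoeff_eq]

theorem norm_circleCoeff_iteratedDeriv_le {f : ℝ → ℂ} (hf : ContDiff ℝ ∞ f)
    (hfp : Function.Periodic f 1) (j : ℕ) (n : ℤ) :
    ‖circleCoeff (iteratedDeriv j f) n‖ ≤
      ((∫ x in (0 : ℝ)..1, ‖iteratedDeriv j f x‖) +
        ∫ x in (0 : ℝ)..1, ‖iteratedDeriv (j + 2) f x‖) * ‖(sqWeight intFrequency 1 n)⁻¹‖ := by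
  have h := norm_circleCoeff_iteratedDeriv_sub_le hf hfp (contDiff_zero_fun (𝕜 := ℝ) (E := ℝ) (F := ℂ))
    (fun _ => rfl) j n
  have hz : ∀ k, iteratedDeriv k (fun _ : ℝ => (0 : ℂ)) = 0 := fun k => by
    ext x; simp
  simpa only [hz, circleCoeff_zero, Pi.zero_apply, sub_zero] using h

theorem lintegral_inv_sqWeight_ne_top :
    ∫⁻ n, weight intFrequency 1 (-1) n ∂Measure.count ≠ ⊤ := by
  obtain ⟨B, _, hB⟩ := exists_lintegral_weight_int_le (s := 0) (by norm_num)
  have := hB 1 le_rfl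
  rw [sub_zero] at this
  exact ne_top_of_le_ne_top ENNReal.ofReal_ne_top this

/-- The weight of index `1 + s` loses at most one power of the squared weight, and the remaining
inverse power is summable. This sequence dominates all coefficients of smooth functions. -/
theorem memLp_inv_sqWeight {s lam : ℝ} (hs₁ : -(1 / 2 : ℝ) < s) (hs₂ : s ≤ 0) (hl : 0 < lam) :
    MemLp (fun n : ℤ => (sqWeight intFrequency 1 n)⁻¹) 2
      (weightedMeasure Measure.count intFrequency lam s) := by
  have hmw : Measurable (weight intFrequency lam (1 + s)) := measurable_of_countable _
  refine ⟨(measurable_of_countable _).aestronglyMeasurable, ?_⟩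
  have h1 := eLpNorm_two_sq (weightedMeasure Measure.count intFrequency lam s)
    fun n : ℤ => (sqWeight intFrequency 1 n)⁻¹
  rw [lintegral_withDensity_eq_lintegral_mul _ hmw (measurable_of_countable _)] at h1
  have h2 : ∫⁻ n, (weight intFrequency lam (1 + s) * fun n => ‖(sqWeight intFrequency 1 n)⁻¹‖ₑ ^ 2) n
      ∂Measure.count ≤ ∫⁻ n, ENNReal.ofReal (2 + lam ^ 2) * weight intFrequency 1 (-1) n ∂Measure.count := by
    refine lintegral_mono fun n => ?_
    have hp := sqWeight_pos (c := intFrequency) hl n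
    have hp1 := sqWeight_pos (c := intFrequency) one_pos n
    rw [Pi.mul_apply, weight, weight, ← ENNReal.ofReal_mul (by positivity),
      ← ofReal_norm, ← ENNReal.ofReal_pow (norm_nonneg _), ← ENNReal.ofReal_mul (by positivity)]
    apply ENNReal.ofReal_le_ofReal
    rw [Real.rpow_neg_one, Real.norm_of_nonneg (by positivity), sq, ← mul_assoc]
    refine mul_le_mul_of_nonneg_right ?_ (by positivity)
    rw [← div_eq_mul_inv, div_le_iff₀ hp1]
    calc sqWeight intFrequency lam n ^ (1 + s)
        ≤ (1 + sqWeight intFrequency lam n) ^ (1 + s) := Real.rpow_le_rpow hp.le (by linarith) (by linarith)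
      _ ≤ (1 + sqWeight intFrequency lam n) ^ (1 : ℝ) :=
          Real.rpow_le_rpow_of_exponent_le (by linarith) (by linarith)
      _ ≤ _ := by
          rw [Real.rpow_one, sqWeight, sqWeight]
          nlinarith [mul_nonneg (sq_nonneg lam) (sq_nonneg (2 * Real.pi * intFrequency n)),
            sq_nonneg (2 * Real.pi * intFrequency n)]
  rw [lintegral_const_mul' _ _ ENNReal.ofReal_ne_top] at h2
  by_contra hcon
  rw [not_lt_top_iff] at hcon
  rw [hcon] at h1
  refine absurd (h1.trans_le h2) ?_
  have := ENNReal.mul_ne_top ENNReal.ofReal_ne_top lintegral_inv_sqWeight_ne_top (a := ENNReal.ofReal (2 + lam ^ 2))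
  simpa using this

theorem summable_inv_sqWeight : Summable fun n : ℤ => ‖(sqWeight intFrequency 1 n)⁻¹‖ := by
  have h := lintegral_inv_sqWeight_ne_top
  rw [lintegral_count] at h
  refine (ENNReal.summable_toReal h).congr fun n => ?_
  have hp1 := sqWeight_pos (c := intFrequency) one_pos n
  rw [weight, Real.rpow_neg_one, ENNReal.toReal_ofReal (inv_pos.2 hp1).le,
    Real.norm_of_nonneg (inv_pos.2 hp1).le]

theorem synthesis_circleCoeff {f : ℝ → ℂ} (hf : Continuous f) (hper : Function.Periodic f 1)
    (hsum : Summable fun n => ‖circleCoeff f n‖) (x : ℝ) :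
    synthesis Measure.count intFrequency (circleCoeff f) x = f x := by
  have : Fact ((0 : ℝ) < 1) := ⟨one_pos⟩
  let g : C(AddCircle (1 : ℝ), ℂ) :=
    ⟨hper.lift, continuous_coinduced_dom.2 hf⟩
  have hchar : ∀ (n : ℤ) (y : ℝ), fourier n (y : AddCircle (1 : ℝ)) = character intFrequency y n := by
    intro n y
    rw [fourier_coe_apply, character]
    simp only [Int.coe_castAddHom]
    congr 1
    push_cast
    ring
  have hcoef : fourierCoeff g = circleCoeff f := by
    ext n
    rw [fourierCoeff_eq_intervalIntegral g n 0, circleCoeff_eq]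
    simp only [zero_add, div_one, one_smul, hchar, smul_eq_mul]
    rfl
  have h := has_pointwise_sum_fourier_series_of_summable (f := g) (by rw [hcoef]; exact hsum.of_norm) x
  simp only [hcoef, hchar, smul_eq_mul] at h
  have hint : Integrable (fun n => character intFrequency x n * circleCoeff f n) Measure.count := by
    rw [integrable_count_iff]
    refine hsum.congr fun n => ?_
    rw [norm_mul, norm_character, one_mul]
  rw [synthesis, integral_countable hint]
  simp only [Measure.real, Measure.count_singleton, ENNReal.toReal_one, one_smul]
  rw [← show g x = f x from rfl, ← h.tsum_eq]
  exact tsum_congr fun n => mul_comm _ _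

theorem isFourierCurve_circle {s : ℝ} (hs₁ : -(1 / 2 : ℝ) < s) (hs₂ : s ≤ 0) {q : ℝ → ℝ → ℂ}
    (hq : IsSmoothCircleCurve q) :
    IsFourierCurve Measure.count intFrequency s (volume.restrict (Ioc (0 : ℝ) 1)) q
      fun j t => circleCoeff (iteratedDeriv j (q t)) := by
  have hcont : ∀ k t, Continuous (iteratedDeriv k (q t)) := fun k t =>
    (hq.smooth t).continuous_iteratedDeriv k (by exact_mod_cast le_top)
  have hmem : ∀ lam, 0 < lam → ∀ j t, MemLp (circleCoeff (iteratedDeriv j (q t))) 2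
      (weightedMeasure Measure.count intFrequency lam s) := fun lam hl j t =>
    (memLp_inv_sqWeight hs₁ hs₂ hl).of_le_mul (measurable_of_countable _).aestronglyMeasurable
      (Eventually.of_forall fun n => norm_circleCoeff_iteratedDeriv_le (hq.smooth t) (hq.periodic t) j n)
  refine ⟨hmem, fun lam hl j => ?_, fun j t x => ?_, hq.smooth, fun j t => (hcont j t).integrableOn_Ioc⟩
  · refine continuous_iff_continuousAt.2 fun t₀ => ?_
    set E := eLpNorm (fun n : ℤ => (sqWeight intFrequency 1 n)⁻¹) 2
      (weightedMeasure Measure.count intFrequency lam s) with hE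
    have hEt : E ≠ ⊤ := (memLp_inv_sqWeight hs₁ hs₂ hl).2.ne
    -- The distance in the weighted space is bounded by these integrals for orders `j` and `j + 2`;
    -- joint continuity of the derivatives sends them to zero.
    let D : ℕ → ℝ → ℝ := fun k t => ∫ x in (0 : ℝ)..1, ‖iteratedDeriv k (q t) x - iteratedDeriv k (q t₀) x‖
    have hD : ∀ k, Continuous (D k) := fun k =>
      intervalIntegral.continuous_parametric_intervalIntegral_of_continuous'
        (f := fun t x => ‖iteratedDeriv k (q t) x - iteratedDeriv k (q t₀) x‖)
        (((hq.continuous k).sub ((hcont k t₀).comp continuous_snd)).norm) 0 1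
    have hD0 : ∀ k t, 0 ≤ D k t := fun k t =>
      intervalIntegral.integral_nonneg zero_le_one fun x _ => norm_nonneg _
    have hDt : ∀ k, D k t₀ = 0 := fun k => by simp [D]
    rw [ContinuousAt, tendsto_iff_norm_sub_tendsto_zero]
    have hlim : Tendsto (fun t => (D j t + D (j + 2) t) * E.toReal) (𝓝 t₀) (𝓝 0) := by
      have h1 : Continuous fun t => (D j t + D (j + 2) t) * E.toReal :=
        ((hD j).add (hD (j + 2))).mul continuous_const
      simpa [hDt] using h1.tendsto t₀
    refine squeeze_zero (fun _ => norm_nonneg _) (fun t => ?_) hlim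
    rw [← MemLp.toLp_sub, Lp.norm_toLp]
    have h2 := eLpNorm_le_mul_eLpNorm_of_ae_le_mul (p := 2)
      (μ := weightedMeasure Measure.count intFrequency lam s) (Eventually.of_forall fun n =>
        norm_circleCoeff_iteratedDeriv_sub_le (hq.smooth t) (hq.periodic t) (hq.smooth t₀)
          (hq.periodic t₀) j n)
    refine (ENNReal.toReal_mono (ENNReal.mul_ne_top ENNReal.ofReal_ne_top hEt) h2).trans_eq ?_
    rw [ENNReal.toReal_mul, ENNReal.toReal_ofReal (add_nonneg (hD0 _ _) (hD0 _ _))]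
  · refine synthesis_circleCoeff (hcont j t) (periodic_iteratedDeriv (hq.periodic t) j) ?_ x
    exact Summable.of_nonneg_of_le (fun _ => norm_nonneg _)
      (norm_circleCoeff_iteratedDeriv_le (hq.smooth t) (hq.periodic t) j)
      (summable_inv_sqWeight.mul_left _)

/-- No regularity of `f` is needed: if the sum diverges, both sides take the default value zero. -/
theorem sobolevCircle_eq (s : ℝ) (f : ℝ → ℂ) :
    sobolevCircle s f =
      Real.sqrt (sqNorm Measure.count intFrequency s 1 (circleCoeff f)).toReal := by
  rw [sobolevCircle, sqNorm, lintegral_count, ENNReal.tsum_toReal_eq (f := fun n =>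
    weight intFrequency 1 s n * ‖circleCoeff f n‖ₑ ^ 2) fun n =>
    ENNReal.mul_ne_top ENNReal.ofReal_ne_top (by finiteness)]
  congr 1
  refine tsum_congr fun n => ?_
  rw [ENNReal.toReal_mul, weight, ENNReal.toReal_ofReal
    (Real.rpow_nonneg (sqWeight_pos one_pos n).le _), ENNReal.toReal_pow, toReal_enorm, circleCoeff,
    sqWeight, one_pow, Int.coe_castAddHom]

theorem exists_bound_circle {s : ℝ} (hs₁ : -(1 / 2 : ℝ) < s) (hs₂ : s < 0) :
    ∃ C : ℝ, 0 < C ∧ ∀ (σ : ℝ) (q : ℝ → ℝ → ℂ), σ = 1 ∨ σ = -1 → IsSmoothCircleCurve q →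
      SolvesNLS σ q ∨ SolvesMKdVComplex σ q → ∀ t,
      GrowthBound C s (sobolevCircle s (q 0)) (sobolevCircle s (q t)) := by
  obtain ⟨B, hB₀, hB⟩ := exists_lintegral_weight_int_le hs₁
  obtain ⟨C, hC, h⟩ := exists_apriori_bound hs₁ hs₂ isParseval_circle measurable_intFrequency hB₀ hB
  refine ⟨C, hC, fun σ q hσ hq hs t => ?_⟩
  rw [sobolevCircle_eq, sobolevCircle_eq]
  simpa only [iteratedDeriv_zero] using h σ q _ hσ (isFourierCurve_circle hs₁ hs₂.le hq) hs t

end Circle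

theorem GrowthBound.mono {C C' s a b : ℝ} (h : GrowthBound C s a b) (hC : C ≤ C') (ha : 0 ≤ a) :
    GrowthBound C' s a b :=
  le_trans h (mul_le_mul_of_nonneg_right hC (by positivity))

theorem IsSmoothCircleCurve.ofReal {q : ℝ → ℝ → ℝ} (h : IsSmoothCircleCurve q) :
    IsSmoothCircleCurve fun t x => (q t x : ℂ) where
  periodic t x := by simp only [h.periodic t x]
  smooth t := Complex.ofRealCLM.contDiff.comp (h.smooth t)
  continuous n := by
    simp only [iteratedDeriv_ofReal (h.smooth _)]
    exact Complex.continuous_ofReal.comp (h.continuous n)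

end AKNS

end

theorem theorem1p3 (s : ℝ) (hs₁ : -(1 / 2 : ℝ) < s) (hs₂ : s < 0) :
    ∃ C : ℝ, 0 < C ∧ ∀ σ : ℝ, σ = 1 ∨ σ = -1 →
      (∀ q : ℝ → SchwartzMap ℝ ℂ, AKNS.IsSchwartzNLSLine σ q → ∀ t : ℝ,
        AKNS.GrowthBound C s (AKNS.sobolevLine s fun x => q 0 x)
          (AKNS.sobolevLine s fun x => q t x)) ∧
      (∀ q : ℝ → SchwartzMap ℝ ℝ, AKNS.IsSchwartzMKdVLine σ q → ∀ t : ℝ,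
        AKNS.GrowthBound C s (AKNS.sobolevLine s fun x => (q 0 x : ℂ))
          (AKNS.sobolevLine s fun x => (q t x : ℂ))) ∧
      (∀ q : ℝ → ℝ → ℂ, AKNS.IsSchwartzNLSCircle σ q → ∀ t : ℝ,
        AKNS.GrowthBound C s (AKNS.sobolevCircle s (q 0)) (AKNS.sobolevCircle s (q t))) ∧
      (∀ q : ℝ → ℝ → ℝ, AKNS.IsSchwartzMKdVCircle σ q → ∀ t : ℝ,
        AKNS.GrowthBound C s (AKNS.sobolevCircle s fun x => (q 0 x : ℂ))
          (AKNS.sobolevCircle s fun x => (q t x : ℂ))) := by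
  obtain ⟨C₁, hC₁, h₁⟩ := AKNS.exists_bound_line hs₁ hs₂
  obtain ⟨C₂, _, h₂⟩ := AKNS.exists_bound_circle hs₁ hs₂
  -- The constants for line and circle do not depend on the equation or on `σ`; real solutions are
  -- handled by viewing them as complex-valued.
  refine ⟨max C₁ C₂, lt_max_of_lt_left hC₁, fun σ hσ => ⟨fun q hq t => ?_, fun q hq t => ?_,
    fun q hq t => ?_, fun q hq t => ?_⟩⟩
  · exact (h₁ σ q hσ hq.continuous (Or.inl hq.solves) t).mono (le_max_left _ _) (Real.sqrt_nonneg _)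
  · exact (h₁ σ (fun t => SchwartzMap.postcompCLM Complex.ofRealCLM (q t)) hσ
      ((SchwartzMap.postcompCLM Complex.ofRealCLM).continuous.comp hq.continuous)
      (Or.inr (hq.solves.toComplex fun t => (q t).smooth ⊤)) t).mono (le_max_left _ _)
      (Real.sqrt_nonneg _)
  · exact (h₂ σ q hσ hq.curve (Or.inl hq.solves) t).mono (le_max_right _ _) (Real.sqrt_nonneg _)
  · exact (h₂ σ _ hσ hq.curve.ofReal (Or.inr (hq.solves.toComplex hq.curve.smooth)) t).mono
      (le_max_right _ _) (Real.sqrt_nonneg _)
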